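/- Let $c>0$ and $\ell(r)=c\,(r-\sin r)^{1/3}$ (real cube root). Identify $\mathbb R^3$ with the imaginary quaternions and let $S^3$ be the group of unit quaternions. Let $\mathbb R^3\rtimes S^3$ be the group with multiplication $(x,p)(y,q)=(x+py\bar p,\,pq)$, endowed with the left invariant pseudo-Riemannian metric whose value at the identity is $$\langle (x,\xi),(y,\eta)\rangle=\tfrac12\big(\langle x,\eta\rangle+\langle y,\xi\rangle\big),\qquad x,y\in\mathbb R^3,\ \xi,\eta\in T_1S^3=\operatorname{Im}\mathbb H .$$ Let $\phi:\mathbb R^3\to\mathbb R^3\rtimes S^3$, $\phi(ru)=(\ell(r)u,\exp(ru/2))$ for $|u|=1$, $r\in\mathbb R$, and let $B=\{v\in\mathbb R^3: |v|<\pi\}$. Then $\phi|_B$ is a smooth embedding and the induced form $g_v(a,b)=\langle d\phi_v a,d\phi_v b\rangle$ is a smooth Riemannian metric on $B\cong\phi(B)$. Let $d$ be its Riemannian distance, which is finite and induces the topology of $B\cong\phi(B)$. Moreover: 1. For every unit vector $u\in\mathbb R^3$ there is $L\in(0,\infty)$ such that the radial curve $r\mapsto\phi(ru)$, $r\in(-\pi,\pi)$,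 is a smooth reparametrization, with positive derivative, of an inextensible geodesic of $\phi(B)$ defined on $(-L,L)$, which has finite length $2L$. 2. $(\phi(B),d)$ is not complete. 3. The metric completion of $(\phi(B),d)$ is $N=\phi(B)\cup\{*\}$, obtained by adding a single point $*$. Its metric topology is that of the one-point compactification of $\phi(B)$, with $*$ as the point at infinity, and $N$ is homeomorphic to the three-sphere. 4. The distance of $N$ (still denoted by $d$) is not Riemannian: there is no smooth manifold structure on $N$ (of any finite dimension) compatible with its topology and no smooth Riemannian metric on it whose Riemannian distance is $d$. 5. For $\rho>0$ small let $A(\rho)$ be the area, with respect to $g$, of the distance sphere of $N$ of radius $\rho$ centered at $*$. Then $$\lim_{\rho\to0^+}\frac{A(\rho)}{4\pi\rho^2}=\infty ;$$ in particular $A(\rho)$ is not asymptotic to $4\pi\rho^2$. -/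

import Mathlib

open Real Set Filter Topology Manifold Bundle MeasureTheory
open scoped ENNReal ContDiff Quaternion

noncomputable section

/-- Euclidean space `ℝᵏ`. -/
abbrev Euc (k : ℕ) : Type := EuclideanSpace ℝ (Fin k)

/-- The identification of `ℝ³` with the imaginary quaternions. -/
def toIm (x : Euc 3) : ℍ[ℝ] := ⟨0, x 0, x 1, x 2⟩

/-- The imaginary part of a quaternion, as a vector of `ℝ³`. -/
def ofIm (q : ℍ[ℝ]) : Euc 3 := !₂[q.imI, q.imJ, q.imK]

/-- The three-sphere of unit quaternions (a topological group in Mathlib). -/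
abbrev UnitQuat : Type := Metric.sphere (0 : ℍ[ℝ]) 1

/-- The rotation `x ↦ p x p̄` of `ℝ³ ≅ Im ℍ` determined by a unit quaternion `p`. -/
def quatRot (p : UnitQuat) (x : Euc 3) : Euc 3 := ofIm (p * toIm x * star (p : ℍ[ℝ]))

lemma toIm_ofIm {q : ℍ[ℝ]} (h : q.re = 0) : toIm (ofIm q) = q := by
  ext <;> simp [toIm, ofIm, h]

lemma ofIm_toIm (x : Euc 3) : ofIm (toIm x) = x := by
  ext i; fin_cases i <;> simp [toIm, ofIm]

lemma ofIm_add (p q : ℍ[ℝ]) : ofIm (p + q) = ofIm p + ofIm q := by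
  ext i; fin_cases i <;> simp [ofIm]

lemma ofIm_smul (r : ℝ) (q : ℍ[ℝ]) : ofIm (r • q) = r • ofIm q := by
  ext i; fin_cases i <;> simp [ofIm]

lemma toIm_add (x y : Euc 3) : toIm (x + y) = toIm x + toIm y := by
  apply Quaternion.ext <;> simp only [Quaternion.re_add, Quaternion.imI_add, Quaternion.imJ_add,
    Quaternion.imK_add] <;> simp [toIm]

lemma toIm_smul (r : ℝ) (x : Euc 3) : toIm (r • x) = r • toIm x := by
  apply Quaternion.ext <;> simp only [Quaternion.re_smul, Quaternion.imI_smul,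
    Quaternion.imJ_smul, Quaternion.imK_smul] <;> simp [toIm]

lemma toIm_quatRot (p : UnitQuat) (x : Euc 3) :
    toIm (quatRot p x) = p * toIm x * star (p : ℍ[ℝ]) := by
  refine toIm_ofIm ?_
  have h0 : (toIm x).re = 0 := rfl
  simp only [Quaternion.re_mul, Quaternion.imI_mul, Quaternion.imJ_mul, Quaternion.imK_mul,
    Quaternion.re_star, Quaternion.imI_star, Quaternion.imJ_star, Quaternion.imK_star, h0]
  ring

lemma quatRot_add (p : UnitQuat) (x y : Euc 3) :
    quatRot p (x + y) = quatRot p x + quatRot p y := by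
  rw [quatRot, toIm_add, mul_add, add_mul, ofIm_add, quatRot, quatRot]

lemma quatRot_mul (p q : UnitQuat) (x : Euc 3) :
    quatRot (p * q) x = quatRot p (quatRot q x) := by
  conv_rhs => rw [quatRot, toIm_quatRot]
  simp [quatRot, mul_assoc]

lemma quatRot_one (x : Euc 3) : quatRot 1 x = x := by
  simp [quatRot, ofIm_toIm]

lemma quatRot_zero (p : UnitQuat) : quatRot p 0 = 0 := by
  have h := quatRot_add p 0 0
  simpa using h

lemma quatRot_neg (p : UnitQuat) (x : Euc 3) : quatRot p (-x) = -quatRot p x := by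
  rw [eq_neg_iff_add_eq_zero, ← quatRot_add, neg_add_cancel, quatRot_zero]

lemma UnitQuat.coe_inv_eq_star (p : UnitQuat) : ((p⁻¹ : UnitQuat) : ℍ[ℝ]) = star (p : ℍ[ℝ]) := by
  have h : ‖(p : ℍ[ℝ])‖ = 1 := by simp
  change (p : ℍ[ℝ])⁻¹ = _
  rw [Quaternion.inv_def, Quaternion.normSq_eq_norm_mul_self, h]
  simp

/-- The set `ℝ³ × S³` underlying the semidirect product `ℝ³ ⋊ S³`, the universal covering group of
the group of direct isometries of Euclidean space. -/
@[ext] structure SpinMotion where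
  /-- the translation part -/
  trans : Euc 3
  /-- the rotation part -/
  rot : UnitQuat

namespace SpinMotion

/-- The product topology of `ℝ³ × S³`. -/
instance : TopologicalSpace SpinMotion :=
  TopologicalSpace.induced (fun g ↦ (g.trans, g.rot)) inferInstance

/-- The multiplication `(x, p) (y, q) = (x + p y p̄, p q)`. -/
instance : Mul SpinMotion := ⟨fun g h ↦ ⟨g.trans + quatRot g.rot h.trans, g.rot * h.rot⟩⟩

instance : One SpinMotion := ⟨⟨0, 1⟩⟩

instance : Inv SpinMotion := ⟨fun g ↦ ⟨-quatRot g.rot⁻¹ g.trans, g.rot⁻¹⟩⟩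

lemma mul_def (g h : SpinMotion) :
    g * h = ⟨g.trans + quatRot g.rot h.trans, g.rot * h.rot⟩ := rfl

lemma one_def : (1 : SpinMotion) = ⟨0, 1⟩ := rfl

lemma inv_def (g : SpinMotion) : g⁻¹ = ⟨-quatRot g.rot⁻¹ g.trans, g.rot⁻¹⟩ := rfl

/-- The group `ℝ³ ⋊ S³`. -/
instance : Group SpinMotion :=
  Group.ofLeftAxioms
    (fun a b c ↦ by simp only [mul_def, quatRot_add, quatRot_mul, mul_assoc, add_assoc])
    (fun a ↦ by simp only [mul_def, one_def, quatRot_one, zero_add, one_mul])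
    (fun a ↦ by simp only [mul_def, one_def, inv_def, neg_add_cancel, inv_mul_cancel])

/-- The inclusion of `ℝ³ × S³` in the vector space `ℝ³ × ℍ`. -/
def toProd (g : SpinMotion) : Euc 3 × ℍ[ℝ] := (g.trans, g.rot)

/-- The inner product of signature `(3, 3)` on the Lie algebra `ℝ³ × Im ℍ` at the identity:
`⟨(x, ξ), (y, η)⟩ = (⟨x, η⟩ + ⟨y, ξ⟩) / 2`. -/
def formAtOne (V W : Euc 3 × Euc 3) : ℝ := (inner ℝ V.1 W.2 + inner ℝ W.1 V.2) / 2

/-- The differential at the identity of the left translation by `g = (x, p)`, that is,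
`(ξ, η) ↦ (p ξ p̄, p η)`, for `ξ` in `ℝ³` and `η` in `ℝ³ ≅ Im ℍ`, the tangent space of `S³`
at `1`. Its values are tangent vectors of `ℝ³ × S³` at `g`, written as vectors of `ℝ³ × ℍ`. -/
def dLeft (g : SpinMotion) (V : Euc 3 × Euc 3) : Euc 3 × ℍ[ℝ] :=
  (quatRot g.rot V.1, g.rot * toIm V.2)

/-- The inverse `(a, b) ↦ (p̄ a p, p̄ b)` of `dLeft g`, for `g = (x, p)`, on the tangent space
`{(a, b) | b ⊥ p}` of `ℝ³ × S³` at `g`. -/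
def dLeftInv (g : SpinMotion) (V : Euc 3 × ℍ[ℝ]) : Euc 3 × Euc 3 :=
  (quatRot g.rot⁻¹ V.1, ofIm (star (g.rot : ℍ[ℝ]) * V.2))

lemma dLeftInv_dLeft (g : SpinMotion) (V : Euc 3 × Euc 3) : dLeftInv g (dLeft g V) = V := by
  have h : star (g.rot : ℍ[ℝ]) * (g.rot : ℍ[ℝ]) = 1 := by
    rw [← UnitQuat.coe_inv_eq_star]
    exact congrArg Subtype.val (inv_mul_cancel g.rot)
  ext1
  · simp only [dLeftInv, dLeft, ← quatRot_mul, inv_mul_cancel, quatRot_one]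
  · simp only [dLeftInv, dLeft, ← mul_assoc, h, one_mul, ofIm_toIm]

/-- The left invariant pseudo-Riemannian metric of `ℝ³ ⋊ S³` whose value at the identity is
`formAtOne`, evaluated at two tangent vectors at `g`. -/
def pseudoMetric (g : SpinMotion) (V W : Euc 3 × ℍ[ℝ]) : ℝ :=
  formAtOne (dLeftInv g V) (dLeftInv g W)

end SpinMotion

/-- The odd real cube root. -/
def cbrt (x : ℝ) : ℝ := SignType.sign x * |x| ^ (1 / 3 : ℝ)

/-- The function `ℓ(r) = c (r - sin r)^{1/3}`. -/
def ell (c r : ℝ) : ℝ := c * cbrt (r - sin r)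

lemma norm_exp_toIm (v : Euc 3) : ‖NormedSpace.exp (toIm v)‖ = 1 := by
  rw [Quaternion.norm_exp]
  simp [toIm]

/-- The screw-radial map `φ(r u) = (ℓ(r) u, exp (r u / 2))`, for `|u| = 1`; see `screwMap_smul`. -/
def screwMap (c : ℝ) (v : Euc 3) : SpinMotion :=
  ⟨(ell c ‖v‖ / ‖v‖) • v,
    ⟨NormedSpace.exp (toIm ((1 / 2 : ℝ) • v)), by simpa using norm_exp_toIm _⟩⟩

lemma cbrt_cube (x : ℝ) : cbrt x ^ 3 = x := by
  have h : (|x| ^ (1 / 3 : ℝ)) ^ 3 = |x| := by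
    rw [← Real.rpow_natCast, ← Real.rpow_mul (abs_nonneg x)]
    norm_num
  rw [cbrt, mul_pow, h]
  rcases lt_trichotomy x 0 with hx | hx | hx
  · simp [sign_neg hx, abs_of_neg hx]
    ring
  · simp [hx]
  · simp [sign_pos hx, abs_of_pos hx]

lemma ell_neg (c r : ℝ) : ell c (-r) = -ell c r := by
  have h : -r - sin (-r) = -(r - sin r) := by rw [Real.sin_neg]; ring
  rw [ell, ell, h, cbrt, cbrt, abs_neg, Left.sign_neg]
  simp

lemma screwMap_smul (c r : ℝ) {u : Euc 3} (hu : ‖u‖ = 1) :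
    (screwMap c (r • u)).trans = ell c r • u ∧
      ((screwMap c (r • u)).rot : ℍ[ℝ]) = NormedSpace.exp ((r / 2) • toIm u) := by
  constructor
  · simp only [screwMap, norm_smul, hu, mul_one, smul_smul, Real.norm_eq_abs]
    rcases lt_trichotomy r 0 with h | h | h
    · rw [abs_of_neg h, ell_neg]
      congr 1
      field_simp [h.ne]
    · simp [h, ell, cbrt]
    · rw [abs_of_pos h, div_mul_cancel₀ _ h.ne']
  · simp only [screwMap, smul_smul, toIm_smul]
    congr 2
    ring

/-- The form induced on `ℝ³` by `φ` from the pseudo-Riemannian metric of `ℝ³ ⋊ S³`: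
`g_v(a, b) = ⟨dφ_v a, dφ_v b⟩`. -/
def inducedForm (c : ℝ) (v a b : Euc 3) : ℝ :=
  (screwMap c v).pseudoMetric
    (fderiv ℝ (fun w ↦ (screwMap c w).toProd) v a) (fderiv ℝ (fun w ↦ (screwMap c w).toProd) v b)

section Coordinates

variable (g : Euc 3 → Euc 3 → Euc 3 → ℝ)

/-- The Christoffel symbols of the first kind of a Riemannian metric `g` on an open set of `ℝ³`,
contracted with the vectors `a`, `b`, `w`: this is `g_x(∇_a B, w)` for the Levi-Civita
connection, where `B` is the constant vector field equal to `b`. -/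
def christoffel (x a b w : Euc 3) : ℝ :=
  (fderiv ℝ (fun y ↦ g y b w) x a + fderiv ℝ (fun y ↦ g y a w) x b
    - fderiv ℝ (fun y ↦ g y a b) x w) / 2

/-- `γ` is a geodesic of `(Ω, g)` with domain the open interval `J`: it is smooth, takes values in
`Ω` and its covariant acceleration, whose `g`-product with `w` is the left hand side of the last
condition, vanishes. -/
structure IsGeodesicOn (Ω : Set (Euc 3)) (γ : ℝ → Euc 3) (J : Set ℝ) : Prop where
  isOpen : IsOpen J
  ordConnected : J.OrdConnected
  contDiffOn : ContDiffOn ℝ ∞ γ J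
  mapsTo : MapsTo γ J Ω
  acceleration : ∀ t ∈ J, ∀ w : Euc 3,
    g (γ t) (deriv (deriv γ) t) w + christoffel g (γ t) (deriv γ t) (deriv γ t) w = 0

/-- A geodesic with domain `J` that is not the restriction of a geodesic with a larger domain. -/
def IsInextensibleGeodesicOn (Ω : Set (Euc 3)) (γ : ℝ → Euc 3) (J : Set ℝ) : Prop :=
  IsGeodesicOn g Ω γ J ∧
    ∀ (γ' : ℝ → Euc 3) (J' : Set ℝ), J ⊆ J' → EqOn γ γ' J → IsGeodesicOn g Ω γ' J' → J' = J

/-- The `g`-length of the restriction of a curve `γ` to `J`. -/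
def curveLength (γ : ℝ → Euc 3) (J : Set ℝ) : ℝ≥0∞ :=
  ∫⁻ t in J, ENNReal.ofReal √(g (γ t) (deriv γ t) (deriv γ t))

/-- The `g`-area of the parametrized surface `f : U → ℝ³`, the integral of the square root of the
determinant of the first fundamental form. -/
def patchArea (U : Set (Euc 2)) (f : Euc 2 → Euc 3) : ℝ≥0∞ :=
  ∫⁻ x in U, ENNReal.ofReal √(Matrix.det (Matrix.of fun i j : Fin 2 ↦
    g (f x) (fderiv ℝ f x (EuclideanSpace.single i 1)) (fderiv ℝ f x (EuclideanSpace.single j 1))))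

/-- The `g`-area of an embedded surface `S`: the supremum of the areas of its smooth injective
parametrized patches. The open parameter sets `U` need not be connected, and `S` has such a patch
whose complement in `S` is negligible, so this is the area of the whole of `S`. -/
def surfaceArea (S : Set (Euc 3)) : ℝ≥0∞ :=
  ⨆ (U : Set (Euc 2)) (f : Euc 2 → Euc 3) (_ : IsOpen U) (_ : ContDiffOn ℝ ∞ f U)
    (_ : InjOn f U) (_ : MapsTo f U S), patchArea g U f

end Coordinates

/-- The distance (with values in `[0, ∞]`) determined by a smooth Riemannian metric on a manifold
of dimension `n`: the infimum of the lengths of the `C¹` curves joining two points. -/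
def riemDist {n : ℕ} {M : Type*} [TopologicalSpace M] [ChartedSpace (Euc n) M]
    [IsManifold (𝓡 n) ∞ M]
    (G : ContMDiffRiemannianMetric (𝓡 n) ∞ (Euc n) (fun x : M ↦ TangentSpace (𝓡 n) x))
    (x y : M) : ℝ≥0∞ :=
  letI : RiemannianBundle (fun x : M ↦ TangentSpace (𝓡 n) x) := ⟨G.toRiemannianMetric⟩
  riemannianEDist (𝓡 n) x y

/-- The distance of the metric space `N` is Riemannian: it is the distance of a smooth Riemannian
metric, for some smooth structure (of some dimension) compatible with the topology of `N`. -/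
def HasRiemannianDistance (N : Type*) [MetricSpace N] : Prop :=
  ∃ (n : ℕ) (_ : ChartedSpace (Euc n) N) (_ : IsManifold (𝓡 n) ∞ N)
    (G : ContMDiffRiemannianMetric (𝓡 n) ∞ (Euc n) (fun x : N ↦ TangentSpace (𝓡 n) x)),
    ∀ x y : N, edist x y = riemDist G x y

/-- The open ball of radius `π` of `ℝ³` centered at the origin, as an open subset. -/
def ballOpens : TopologicalSpace.Opens (Euc 3) := ⟨Metric.ball 0 π, Metric.isOpen_ball⟩

/-- The ball `B` of radius `π` as a smooth manifold. It is a type of its own, in order that it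
should not carry the Euclidean distance. -/
def PiBall : Type := ballOpens

namespace PiBall

instance topology : TopologicalSpace PiBall := inferInstanceAs (TopologicalSpace ballOpens)

instance : ChartedSpace (Euc 3) PiBall := inferInstanceAs (ChartedSpace (Euc 3) ballOpens)

instance : IsManifold (𝓡 3) ∞ PiBall := inferInstanceAs (IsManifold (𝓡 3) ∞ ballOpens)

/-- The inclusion of the ball in `ℝ³`. -/
def val (x : PiBall) : Euc 3 := Subtype.val (p := fun v ↦ v ∈ ballOpens) x

end PiBall

/-- `G` is the Riemannian metric induced on the ball `B` by `φ`. The tangent spaces of the open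
subset `B` of `ℝ³` are `ℝ³` by definition. -/
def IsInducedMetric (c : ℝ)
    (G : ContMDiffRiemannianMetric (𝓡 3) ∞ (Euc 3) (fun x : PiBall ↦ TangentSpace (𝓡 3) x)) :
    Prop :=
  ∀ (x : PiBall) (a b : Euc 3), G.inner x a b = inducedForm c x.val a b

end

/-! In polar coordinates the induced form is `(ℓ'/2) dr² + (ℓ sin r / 2) dσ²`, where `dσ²` is the
round metric of the unit sphere. Along a ray the translation and rotation parts both move in the
direction `u`, at rates `ℓ'` and `1/2`, whence the radial coefficient. As `ℓ³ = c³ (r - sin r)`, one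
has `3 ℓ² ℓ' = c³ (1 - cos r)`, so `ℓ'` is positive up to and beyond `r = π`. The spherical
coefficient is positive for `0 < r < π` and vanishes at `π`. In Cartesian form the metric is
`A(|v|²) ⟨a, b⟩ + B(|v|²) ⟨v, a⟩ ⟨v, b⟩` with `A` and `B` smooth, because `(r - sin r) / r³` is a
smooth positive function of `r²` (`inducedForm_eq`, `metE_pos`, `metA_pos`).

By rotational symmetry radial curves are geodesics up to parametrization. Their speed is bounded
above and below up to `r = π`, so they leave the ball after a finite length. The spheres `|v| = r`
shrink as `r → π`, so the complements of compact sets have diameter tending to zero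
(`riemDist_le_of_le_norm`, `tendsto_diam_bound`). Hence the completion adds one point and is the
one-point compactification; the distance from `v` to this point is the remaining radial arc length
(`dist_completion_point`).

At depth `τ = π - r` the sphere has radius of order `√τ`, much larger than its distance to the new
point, which is of order `τ`. Two consequences follow. First, for each `N` and all small `τ` there
are `N` points at depth `τ` with mutual distances at least `κ τ`, where `κ` does not depend on `N`
(`exists_separated_points`). For a Riemannian distance, comparison with a Euclidean space in a chart
bounds the number of such points (`HasRiemannianDistance.exists_packing_bound`), so the distance of
the completion is not Riemannian. Second, the area of the distance sphere of radius `ρ` is at least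
a constant times `ρ`, so its quotient by `ρ²` is unbounded (`tendsto_surfaceArea_div`).

Upper bounds for the distance come from explicit curves. Lower bounds come from test functions
`ψ(|v|) ⟨v/|v|, e⟩ᵏ`, whose gradient is estimated in `abs_fderiv_coneFn_le`. -/

/-! ### Scalar functions of the squared radius -/

/-- The entire function `∑ (-x)ⁿ / (2n + 3)!`, for which `r³ · sinRem (r²) = r - sin r`. -/
noncomputable def sinRem (x : ℝ) : ℝ :=
  FormalMultilinearSeries.ofScalarsSum (E := ℝ)
    (fun n : ℕ ↦ ((-1) ^ n / (Nat.factorial (2 * n + 3) : ℝ) : ℝ)) x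

/-- The ratios of successive coefficients tend to zero, so the radius of convergence is infinite and
the sum is analytic on the whole line. -/
lemma sinRem_contDiff : ContDiff ℝ ∞ sinRem := by
  set s : ℕ → ℝ := fun n : ℕ ↦ (-1) ^ n / (Nat.factorial (2 * n + 3) : ℝ) with hs
  have hrad : (FormalMultilinearSeries.ofScalars ℝ s).radius = ⊤ := by
    refine FormalMultilinearSeries.ofScalars_radius_eq_top_of_tendsto ℝ s
      (Eventually.of_forall fun n ↦ by simp [hs, Nat.factorial_ne_zero]) ?_
    have h1 : ∀ n : ℕ, ‖s n.succ‖ / ‖s n‖ = 1 / (((2 : ℝ) * n + 5) * (2 * n + 4)) := by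
      intro n
      have h2 : Nat.factorial (2 * n.succ + 3)
          = (2 * n + 5) * ((2 * n + 4) * Nat.factorial (2 * n + 3)) := by
        rw [show 2 * n.succ + 3 = (2 * n + 4) + 1 by omega, Nat.factorial_succ,
          Nat.factorial_succ]
      have h3 : (Nat.factorial (2 * n + 3) : ℝ) ≠ 0 := by positivity
      simp only [hs, norm_div, norm_pow, norm_neg, norm_one, one_pow, RCLike.norm_natCast, h2]
      push_cast
      field_simp
    simp_rw [h1]
    refine squeeze_zero (fun n ↦ by positivity) (fun n ↦ ?_) tendsto_one_div_add_atTop_nhds_zero_nat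
    apply one_div_le_one_div_of_le (by positivity)
    have : (0 : ℝ) ≤ n := n.cast_nonneg
    nlinarith
  have h := (FormalMultilinearSeries.ofScalars ℝ s).hasFPowerSeriesOnBall (by simp [hrad])
  rw [hrad] at h
  have h2 : AnalyticOnNhd ℝ sinRem univ := by
    have := h.analyticOnNhd
    rw [Metric.eball_top] at this
    exact this
  rw [← contDiffOn_univ]
  exact h2.contDiffOn uniqueDiffOn_univ

lemma sinRem_sq_mul (r : ℝ) : sinRem (r ^ 2) * r ^ 3 = r - sin r := by
  have h1 := (hasSum_nat_add_iff' 1).2 (Real.hasSum_sin r)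
  have h3 : sinRem (r ^ 2) =
      ∑' n : ℕ, (-1 : ℝ) ^ n / (Nat.factorial (2 * n + 3)) * (r ^ 2) ^ n := by
    rw [sinRem, FormalMultilinearSeries.ofScalars_sum_eq]
    rfl
  rw [h3, ← tsum_mul_right]
  have h4 : HasSum (fun n : ℕ ↦
      (-1 : ℝ) ^ n / (Nat.factorial (2 * n + 3)) * (r ^ 2) ^ n * r ^ 3) (r - sin r) := by
    have h5 : r - sin r = -(sin r - ∑ i ∈ Finset.range 1,
        (-1) ^ i * r ^ (2 * i + 1) / (Nat.factorial (2 * i + 1) : ℝ)) := by simp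
    have h6 : ∀ n : ℕ, (-1 : ℝ) ^ n / (Nat.factorial (2 * n + 3)) * (r ^ 2) ^ n * r ^ 3 =
        -((-1) ^ (n + 1) * r ^ (2 * (n + 1) + 1) / (Nat.factorial (2 * (n + 1) + 1) : ℝ)) := by
      intro n
      rw [show 2 * (n + 1) + 1 = 2 * n + 3 by ring]
      ring
    simp_rw [h5, h6]
    exact h1.neg
  exact h4.tsum_eq

lemma sinRem_zero : sinRem 0 = 1 / 6 := by
  norm_num [sinRem, FormalMultilinearSeries.ofScalarsSum_zero, Nat.factorial]

lemma sub_sin_pos {r : ℝ} (h : 0 < r) : 0 < r - sin r := by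
  linarith [Real.sin_lt h]

/-- For `q = r² > 0` this is `sin r < r`. It keeps the cube root in `lam` away from its singularity,
so that `φ` is smooth at the origin too. -/
lemma sinRem_pos {q : ℝ} (hq : 0 ≤ q) : 0 < sinRem q := by
  rcases hq.eq_or_lt with rfl | h
  · rw [sinRem_zero]; norm_num
  · have h1 := sinRem_sq_mul (√q)
    rw [Real.sq_sqrt hq] at h1
    have h2 : 0 < √q := Real.sqrt_pos.2 h
    have h3 := sub_sin_pos h2
    rw [← h1] at h3
    exact pos_of_mul_pos_left h3 (by positivity)

/-- `sin (r / 2) / r` as a function of `r²`. -/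
noncomputable def halfSinc (q : ℝ) : ℝ := (1 - q / 4 * sinRem (q / 4)) / 2

/-- `cos (r / 2)` as a function of `r²`. -/
noncomputable def halfCos (q : ℝ) : ℝ := 1 - q / 2 * halfSinc (q / 4) ^ 2

/-- `ℓ(r) / r` as a function of `r²`. -/
noncomputable def lam (c q : ℝ) : ℝ := c * sinRem q ^ (1 / 3 : ℝ)

lemma halfSinc_contDiff : ContDiff ℝ ∞ halfSinc := by
  have h := sinRem_contDiff
  unfold halfSinc
  fun_prop

lemma halfCos_contDiff : ContDiff ℝ ∞ halfCos := by
  have h := halfSinc_contDiff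
  unfold halfCos
  fun_prop

lemma lam_contDiffAt (c : ℝ) {q : ℝ} (hq : 0 ≤ q) : ContDiffAt ℝ ∞ (lam c) q :=
  contDiffAt_const.mul (sinRem_contDiff.contDiffAt.rpow_const_of_ne (sinRem_pos hq).ne')

lemma lam_pos {c : ℝ} (hc : 0 < c) {q : ℝ} (hq : 0 ≤ q) : 0 < lam c q :=
  mul_pos hc (Real.rpow_pos_of_pos (sinRem_pos hq) _)

lemma halfSinc_sq_mul (r : ℝ) : halfSinc (r ^ 2) * r = sin (r / 2) := by
  have h := sinRem_sq_mul (r / 2)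
  rw [show (r / 2) ^ 2 = r ^ 2 / 4 by ring] at h
  rw [halfSinc]
  linear_combination -h

lemma halfCos_sq (r : ℝ) : halfCos (r ^ 2) = cos (r / 2) := by
  have h := halfSinc_sq_mul (r / 2)
  rw [show (r / 2) ^ 2 = r ^ 2 / 4 by ring] at h
  -- Double angle formula `cos (r/2) = 1 - 2 sin² (r/4)`.
  rw [halfCos, show r / 2 = 2 * (r / 2 / 2) by ring, Real.cos_two_mul, Real.cos_sq', ← h]
  ring

lemma cbrt_of_pos {x : ℝ} (hx : 0 < x) : cbrt x = x ^ (1 / 3 : ℝ) := by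
  simp [cbrt, sign_pos hx, abs_of_pos hx]

lemma lam_sq_mul (c : ℝ) {r : ℝ} (hr : 0 ≤ r) : lam c (r ^ 2) * r = ell c r := by
  rcases hr.eq_or_lt with rfl | h
  · simp [ell, cbrt]
  · rw [ell, cbrt_of_pos (sub_sin_pos h), ← sinRem_sq_mul, lam,
      Real.mul_rpow (sinRem_pos (by positivity)).le (by positivity), ← Real.rpow_natCast r 3,
      ← Real.rpow_mul hr]
    norm_num
    ring

lemma lam_pow_three (c : ℝ) {q : ℝ} (hq : 0 ≤ q) : lam c q ^ 3 = c ^ 3 * sinRem q := by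
  rw [lam, mul_pow, ← Real.rpow_natCast (sinRem q ^ _), ← Real.rpow_mul (sinRem_pos hq).le]
  norm_num

lemma halfCos_sq_add {q : ℝ} (hq : 0 ≤ q) : halfCos q ^ 2 + halfSinc q ^ 2 * q = 1 := by
  have h1 := halfSinc_sq_mul (√q)
  have h2 := halfCos_sq (√q)
  rw [Real.sq_sqrt hq] at h1 h2
  have h3 := Real.sq_sqrt hq
  rw [h2]
  have h4 := Real.cos_sq_add_sin_sq (√q / 2)
  rw [← h1, mul_pow, h3] at h4
  linear_combination h4

lemma halfSinc_eq {q : ℝ} (hq : 0 < q) : halfSinc q = sin (√q / 2) / √q := by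
  have h1 := halfSinc_sq_mul (√q)
  rw [Real.sq_sqrt hq.le] at h1
  rw [← h1, mul_div_cancel_right₀ _ (Real.sqrt_pos.2 hq).ne']

lemma halfCos_eq {q : ℝ} (hq : 0 ≤ q) : halfCos q = cos (√q / 2) := by
  rw [← halfCos_sq, Real.sq_sqrt hq]

lemma halfSinc_zero : halfSinc 0 = 1 / 2 := by simp [halfSinc]

lemma halfCos_zero : halfCos 0 = 1 := by simp [halfCos]

lemma halfCos_hasDerivAt {q : ℝ} (hq : 0 ≤ q) : HasDerivAt halfCos (-halfSinc q / 4) q := by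
  rcases hq.eq_or_lt with rfl | h
  · have h1 : DifferentiableAt ℝ halfSinc 0 :=
      halfSinc_contDiff.contDiffAt.differentiableAt (by simp)
    have h2 : HasDerivAt (fun q : ℝ ↦ halfSinc (q / 4)) (deriv halfSinc 0 * (1 / 4)) 0 := by
      have h3 : HasDerivAt halfSinc (deriv halfSinc 0) (0 / 4) := by simpa using h1.hasDerivAt
      exact h3.comp 0 ((hasDerivAt_id (0 : ℝ)).div_const 4)
    have h4 := ((hasDerivAt_id (0 : ℝ)).div_const 2).mul (h2.pow 2)
    have h5 := h4.const_sub 1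
    refine h5.congr_deriv ?_
    norm_num [halfSinc_zero]
  · have h1 : HasDerivAt (fun q ↦ cos (√q / 2)) (-sin (√q / 2) * (1 / (2 * √q) / 2)) q :=
      (Real.hasDerivAt_cos _).comp q ((Real.hasDerivAt_sqrt h.ne').div_const 2)
    have h2 : halfCos =ᶠ[𝓝 q] fun q ↦ cos (√q / 2) := by
      filter_upwards [lt_mem_nhds h] with y hy using halfCos_eq hy.le
    refine (h1.congr_of_eventuallyEq h2).congr_deriv ?_
    rw [halfSinc_eq h]
    field_simp
    ring

/-- This is the derivative of the identity `halfSinc (r²) r = sin (r/2)`, written in `q = r²`. It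
serves to eliminate `deriv halfSinc` from the radial coefficient; at `q = 0`, where the square root
is not differentiable, both sides vanish. -/
lemma two_mul_deriv_halfSinc {q : ℝ} (hq : 0 ≤ q) :
    2 * deriv halfSinc q * q = halfCos q / 2 - halfSinc q := by
  rcases hq.eq_or_lt with rfl | h
  · simp [halfSinc_zero, halfCos_zero]
  · have hs := Real.sqrt_pos.2 h
    have h0 : HasDerivAt (fun q ↦ sin (√q / 2)) (cos (√q / 2) * (1 / (2 * √q) / 2)) q :=
      (Real.hasDerivAt_sin _).comp q ((Real.hasDerivAt_sqrt h.ne').div_const 2)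
    have h1 := h0.div (Real.hasDerivAt_sqrt h.ne') hs.ne'
    have h2 : halfSinc =ᶠ[𝓝 q] fun q ↦ sin (√q / 2) / √q := by
      filter_upwards [lt_mem_nhds h] with y hy using halfSinc_eq hy
    have h3 := (h1.congr_of_eventuallyEq h2).deriv
    rw [h3, halfSinc_eq h, halfCos_eq h.le]
    have h4 := Real.sq_sqrt h.le
    field_simp
    rw [h4]
    field_simp

/-- The coefficient of `⟨a, b⟩` in the induced form, as a function of the squared radius. -/
noncomputable def metA (c q : ℝ) : ℝ := lam c q * halfSinc q * halfCos q

/-- The coefficient of `⟨v, a⟩ ⟨v, b⟩` in the induced form, as a function of the squared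
radius. -/
noncomputable def metB (c q : ℝ) : ℝ :=
  lam c q * (halfSinc q ^ 2 / 2 + 2 * deriv halfSinc q * halfCos q) + deriv (lam c) q

/-- The square of the radial speed, as a function of the squared radius. -/
noncomputable def metE (c q : ℝ) : ℝ := metA c q + metB c q * q

lemma metA_contDiffAt (c : ℝ) {q : ℝ} (hq : 0 ≤ q) : ContDiffAt ℝ ∞ (metA c) q :=
  ((lam_contDiffAt c hq).mul halfSinc_contDiff.contDiffAt).mul halfCos_contDiff.contDiffAt

lemma metB_contDiffAt (c : ℝ) {q : ℝ} (hq : 0 ≤ q) : ContDiffAt ℝ ∞ (metB c) q := by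
  have h1 : ContDiffAt ℝ ∞ (deriv (lam c)) q := by
    exact (lam_contDiffAt c hq).derivWithin (m := ∞) (by simp)
  have h2 : ContDiff ℝ ∞ (deriv halfSinc) := (contDiff_infty_iff_deriv.1 halfSinc_contDiff).2
  exact ((lam_contDiffAt c hq).mul (((halfSinc_contDiff.contDiffAt.pow 2).div_const 2).add
    ((contDiffAt_const.mul h2.contDiffAt).mul halfCos_contDiff.contDiffAt))).add h1

lemma metE_contDiffAt (c : ℝ) {q : ℝ} (hq : 0 ≤ q) : ContDiffAt ℝ ∞ (metE c) q :=
  (metA_contDiffAt c hq).add ((metB_contDiffAt c hq).mul contDiffAt_id)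

/-- Since `ℓ(r) = r λ(r²)`, the right hand side at `q = r²` is `ℓ'(r)/2`: the trigonometric terms
cancel along the radius. -/
lemma metE_eq (c : ℝ) {q : ℝ} (hq : 0 ≤ q) :
    metE c q = (lam c q + 2 * deriv (lam c) q * q) / 2 := by
  have h1 := halfCos_sq_add hq
  have h2 := two_mul_deriv_halfSinc hq
  rw [metE, metA, metB]
  linear_combination (lam c q) * (halfCos q) * h2 + lam c q / 2 * h1

/-- Differentiating the cube `ℓ³ = c³ (r - sin r)` gives `3 ℓ² ℓ' = c³ (1 - cos r)`, without
differentiating a cube root. The range contains `r = π`, so the radial speed does not degenerate at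
the boundary of the ball. -/
lemma metE_pos {c : ℝ} (hc : 0 < c) {r : ℝ} (h : |r| < 2 * π) : 0 < metE c (r ^ 2) := by
  rw [metE_eq c (sq_nonneg r)]
  rcases eq_or_ne r 0 with rfl | h0
  · simpa using lam_pos hc le_rfl
  have h1 : HasDerivAt (fun r : ℝ ↦ lam c (r ^ 2) * r)
      (deriv (lam c) (r ^ 2) * (2 * r) * r + lam c (r ^ 2)) r := by
    have h3 := ((lam_contDiffAt c (sq_nonneg r)).differentiableAt (by simp)).hasDerivAt
    have h4 : HasDerivAt (fun r : ℝ ↦ r ^ 2) (2 * r) r := by simpa using hasDerivAt_pow 2 r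
    have h5 := (HasDerivAt.comp r (h := fun r : ℝ ↦ r ^ 2) (h₂ := lam c) h3 h4).mul
      (hasDerivAt_id r)
    exact h5.congr_deriv (by simp)
  have h2 : HasDerivAt (fun r : ℝ ↦ c ^ 3 * (r - sin r)) (c ^ 3 * (1 - cos r)) r :=
    ((hasDerivAt_id r).sub (Real.hasDerivAt_sin r)).const_mul _
  have h3 : (fun r : ℝ ↦ (lam c (r ^ 2) * r) ^ 3) = fun r ↦ c ^ 3 * (r - sin r) := by
    ext x
    rw [mul_pow, lam_pow_three c (sq_nonneg x), ← sinRem_sq_mul]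
    ring
  have h4 := h1.pow 3
  simp only [Pi.pow_def] at h4
  rw [h3] at h4
  have h5 := h4.unique h2
  have h6 : 0 < c ^ 3 * (1 - cos r) := by
    have : cos r < 1 := by
      refine lt_of_le_of_ne (Real.cos_le_one r) fun h7 ↦ h0 ?_
      exact (Real.cos_eq_one_iff_of_lt_of_lt (by linarith [abs_lt.1 h])
        (by linarith [abs_lt.1 h])).1 h7
    have := pow_pos hc 3
    nlinarith
  rw [← h5] at h6
  norm_num at h6
  have h7 := pos_of_mul_pos_right h6 (by positivity)
  linarith

/-- The factor `cos (r/2)` is what confines the metric to the ball of radius `π`. -/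
lemma metA_pos {c : ℝ} (hc : 0 < c) {r : ℝ} (h : |r| < π) : 0 < metA c (r ^ 2) := by
  have h0 := lam_pos hc (sq_nonneg r)
  have hr := abs_lt.1 h
  have h1 : 0 < halfCos (r ^ 2) := by
    rw [halfCos_sq]
    exact Real.cos_pos_of_mem_Ioo ⟨by linarith, by linarith⟩
  have h2 : 0 < halfSinc (r ^ 2) := by
    rcases eq_or_ne r 0 with rfl | h0
    · norm_num [halfSinc_zero]
    · have h3 := halfSinc_sq_mul |r|
      rw [sq_abs] at h3
      have h4 : 0 < sin (|r| / 2) :=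
        Real.sin_pos_of_pos_of_lt_pi (by positivity) (by linarith)
      rw [← h3] at h4
      exact pos_of_mul_pos_left h4 (abs_nonneg r)
  exact mul_pos (mul_pos h0 h2) h1

lemma metA_mul_sq (c : ℝ) {r : ℝ} (hr : 0 ≤ r) : metA c (r ^ 2) * r ^ 2 = ell c r * sin r / 2 := by
  have h1 := halfSinc_sq_mul r
  have h2 := halfCos_sq r
  have h3 := lam_sq_mul c hr
  have h4 : sin r = 2 * sin (r / 2) * cos (r / 2) := by rw [← Real.sin_two_mul]; ring_nf
  rw [metA, ← h3, h4, ← h1, ← h2]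
  ring

/-! ### The induced form -/

/-- `toIm` as a continuous linear map. -/
noncomputable def toImL : Euc 3 →L[ℝ] ℍ[ℝ] :=
  LinearMap.toContinuousLinearMap
    { toFun := toIm, map_add' := toIm_add, map_smul' := toIm_smul }

lemma toImL_apply (v : Euc 3) : toImL v = toIm v := rfl

lemma toIm_re (x : Euc 3) : (toIm x).re = 0 := rfl
lemma toIm_imI (x : Euc 3) : (toIm x).imI = x 0 := rfl
lemma toIm_imJ (x : Euc 3) : (toIm x).imJ = x 1 := rfl
lemma toIm_imK (x : Euc 3) : (toIm x).imK = x 2 := rfl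
lemma ofIm_zero (q : ℍ[ℝ]) : ofIm q 0 = q.imI := rfl
lemma ofIm_one (q : ℍ[ℝ]) : ofIm q 1 = q.imJ := rfl
lemma ofIm_two (q : ℍ[ℝ]) : ofIm q 2 = q.imK := rfl

lemma norm_toIm (v : Euc 3) : ‖toIm v‖ = ‖v‖ := by
  rw [EuclideanSpace.norm_eq, ← Real.sqrt_sq (norm_nonneg (toIm v)), sq,
    ← Quaternion.normSq_eq_norm_mul_self, Quaternion.normSq_def']
  simp [toIm_re, toIm_imI, toIm_imJ, toIm_imK, Fin.sum_univ_three]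

lemma exp_toIm_half (v : Euc 3) : NormedSpace.exp (toIm ((1 / 2 : ℝ) • v)) =
    (halfCos (‖v‖ ^ 2) : ℍ[ℝ]) + halfSinc (‖v‖ ^ 2) • toIm v := by
  rw [Quaternion.exp_of_re_eq_zero _ rfl, norm_toIm, norm_smul, halfCos_sq, toIm_smul]
  have h0 : ‖(1 / 2 : ℝ)‖ * ‖v‖ = ‖v‖ / 2 := by norm_num; ring
  rw [h0, smul_smul]
  congr 1
  rcases eq_or_ne v 0 with rfl | hv
  · have : toIm (0 : Euc 3) = 0 := toImL.map_zero
    simp [this]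
  · have hv' : ‖v‖ ≠ 0 := norm_ne_zero_iff.2 hv
    congr 1
    rw [← halfSinc_sq_mul]
    field_simp

lemma screwMap_trans (c : ℝ) (v : Euc 3) : (screwMap c v).trans = lam c (‖v‖ ^ 2) • v := by
  rcases eq_or_ne v 0 with rfl | hv
  · simp [screwMap]
  · have hv' : ‖v‖ ≠ 0 := norm_ne_zero_iff.2 hv
    rw [screwMap, ← lam_sq_mul c (norm_nonneg v), mul_div_cancel_right₀ _ hv']

lemma screwMap_rot (c : ℝ) (v : Euc 3) : ((screwMap c v).rot : ℍ[ℝ]) =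
    (halfCos (‖v‖ ^ 2) : ℍ[ℝ]) + halfSinc (‖v‖ ^ 2) • toIm v := exp_toIm_half v

lemma screwMap_toProd (c : ℝ) : (fun v ↦ (screwMap c v).toProd) = fun v ↦
    (lam c (‖v‖ ^ 2) • v, (halfCos (‖v‖ ^ 2)) • (1 : ℍ[ℝ]) + halfSinc (‖v‖ ^ 2) • toImL v) := by
  ext1 v
  rw [SpinMotion.toProd, screwMap_trans, screwMap_rot, ← Algebra.algebraMap_eq_smul_one]
  rfl

lemma screwMap_contDiff (c : ℝ) : ContDiff ℝ ∞ (fun v ↦ (screwMap c v).toProd) := by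
  rw [screwMap_toProd, contDiff_iff_contDiffAt]
  intro v
  have hq : ContDiffAt ℝ ∞ (fun v : Euc 3 ↦ ‖v‖ ^ 2) v := (contDiff_norm_sq ℝ).contDiffAt
  have h1 : ContDiffAt ℝ ∞ (fun v : Euc 3 ↦ lam c (‖v‖ ^ 2)) v :=
    ContDiffAt.comp (g := lam c) v (lam_contDiffAt c (sq_nonneg ‖v‖)) hq
  have h2 : ContDiffAt ℝ ∞ (fun v : Euc 3 ↦ halfCos (‖v‖ ^ 2)) v :=
    ContDiffAt.comp (g := halfCos) v halfCos_contDiff.contDiffAt hq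
  have h3 : ContDiffAt ℝ ∞ (fun v : Euc 3 ↦ halfSinc (‖v‖ ^ 2)) v :=
    ContDiffAt.comp (g := halfSinc) v halfSinc_contDiff.contDiffAt hq
  exact (h1.smul contDiffAt_id).prodMk
    ((h2.smul contDiffAt_const).add (h3.smul toImL.contDiff.contDiffAt))

lemma hasFDerivAt_comp_normSq {f : ℝ → ℝ} {f' : ℝ} {v : Euc 3} (hf : HasDerivAt f f' (‖v‖ ^ 2)) :
    HasFDerivAt (fun v : Euc 3 ↦ f (‖v‖ ^ 2)) (f' • (2 • innerSL ℝ v)) v :=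
  hf.comp_hasFDerivAt v (hasStrictFDerivAt_norm_sq v).hasFDerivAt

lemma fderiv_screwMap (c : ℝ) (v a : Euc 3) : fderiv ℝ (fun v ↦ (screwMap c v).toProd) v a =
    (lam c (‖v‖ ^ 2) • a + (2 * deriv (lam c) (‖v‖ ^ 2) * inner ℝ v a) • v,
      (-halfSinc (‖v‖ ^ 2) / 2 * inner ℝ v a) • (1 : ℍ[ℝ]) + (halfSinc (‖v‖ ^ 2) • toIm a +
      (2 * deriv halfSinc (‖v‖ ^ 2) * inner ℝ v a) • toIm v)) := by
  have h1 := hasFDerivAt_comp_normSq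
    ((lam_contDiffAt c (sq_nonneg ‖v‖)).differentiableAt (by simp)).hasDerivAt
  have h2 := hasFDerivAt_comp_normSq (halfCos_hasDerivAt (sq_nonneg ‖v‖))
  have h3 := hasFDerivAt_comp_normSq (v := v)
    (halfSinc_contDiff.contDiffAt.differentiableAt (by simp)).hasDerivAt
  have h4 := (h1.smul (hasFDerivAt_id v)).prodMk
    ((h2.smul_const (1 : ℍ[ℝ])).add (h3.smul toImL.hasFDerivAt))
  rw [screwMap_toProd]
  have h5 := congrArg (fun l ↦ l a) h4.fderiv
  refine h5.trans ?_
  ext1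
  · simp [two_smul]
    module
  · simp [two_smul, toImL_apply]
    module

/-- Conjugation by a unit quaternion is an isometry of the imaginary quaternions and takes `ξ p̄` to
`p̄ ξ`. Thus the left invariant metric can be computed from right translated rotation parts, without
rotating `x`. -/
lemma inner_conj (p ξ : ℍ[ℝ]) (hp : Quaternion.normSq p = 1) (x : Euc 3) :
    inner ℝ (ofIm (star p * toIm x * p)) (ofIm (star p * ξ)) = inner ℝ x (ofIm (ξ * star p)) := by
  -- Inserting the factor `|p|² = 1` makes both sides homogeneous in `p`, hence a polynomial
  -- identity.
  rw [← one_mul (inner ℝ x _), ← hp, Quaternion.normSq_def']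
  simp only [PiLp.inner_apply, Fin.sum_univ_three, ofIm_zero, ofIm_one, ofIm_two, toIm_re, toIm_imI,
    toIm_imJ, toIm_imK, RCLike.inner_apply, conj_trivial, Quaternion.re_mul,
    Quaternion.imI_mul, Quaternion.imJ_mul, Quaternion.imK_mul,
    Quaternion.re_star, Quaternion.imI_star, Quaternion.imJ_star, Quaternion.imK_star]
  ring

lemma inducedForm_eq (c : ℝ) (v a b : Euc 3) : inducedForm c v a b =
    metA c (‖v‖ ^ 2) * inner ℝ a b + metB c (‖v‖ ^ 2) * inner ℝ v a * inner ℝ v b := by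
  have hp : Quaternion.normSq ((screwMap c v).rot : ℍ[ℝ]) = 1 := by
    rw [Quaternion.normSq_eq_norm_mul_self]; simp
  have key : ∀ x (ξ : ℍ[ℝ]),
      inner ℝ (quatRot (screwMap c v).rot⁻¹ x) (ofIm (star ((screwMap c v).rot : ℍ[ℝ]) * ξ)) =
      inner ℝ x (ofIm (ξ * star ((screwMap c v).rot : ℍ[ℝ]))) := by
    intro x ξ
    rw [← inner_conj _ _ hp, quatRot, UnitQuat.coe_inv_eq_star, star_star]
  have h1 := halfCos_sq_add (sq_nonneg ‖v‖)
  have h2 := two_mul_deriv_halfSinc (sq_nonneg ‖v‖)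
  rw [inducedForm, SpinMotion.pseudoMetric, SpinMotion.formAtOne, SpinMotion.dLeftInv,
    SpinMotion.dLeftInv, key, key, fderiv_screwMap, fderiv_screwMap, screwMap_rot, metA, metB]
  have hq : ‖v‖ ^ 2 = v 0 ^ 2 + v 1 ^ 2 + v 2 ^ 2 := by
    rw [EuclideanSpace.norm_sq_eq]; simp [Fin.sum_univ_three]
  -- With the scalar functions as free variables, the claim is a polynomial identity modulo `C² + D²
  -- q = 1` and `2 D' q = C/2 - D`; both are needed only for the terms containing `l'`.
  generalize halfCos (‖v‖ ^ 2) = C at *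
  generalize halfSinc (‖v‖ ^ 2) = D at *
  generalize deriv halfSinc (‖v‖ ^ 2) = D' at *
  generalize lam c (‖v‖ ^ 2) = l at *
  generalize deriv (lam c) (‖v‖ ^ 2) = l' at *
  rw [hq] at h1 h2
  simp only [PiLp.inner_apply, Fin.sum_univ_three, ofIm_zero, ofIm_one, ofIm_two, toIm_re, toIm_imI,
    toIm_imJ, toIm_imK, RCLike.inner_apply, conj_trivial,
    Quaternion.imI_mul, Quaternion.imJ_mul, Quaternion.imK_mul,
    Quaternion.re_star, Quaternion.imI_star, Quaternion.imJ_star, Quaternion.imK_star,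
    Quaternion.re_add, Quaternion.imI_add, Quaternion.imJ_add, Quaternion.imK_add,
    Quaternion.re_smul, Quaternion.imI_smul, Quaternion.imJ_smul, Quaternion.imK_smul,
    Quaternion.re_coe, Quaternion.imI_coe, Quaternion.imJ_coe, Quaternion.imK_coe,
    Quaternion.re_one, Quaternion.imI_one, Quaternion.imJ_one, Quaternion.imK_one,
    PiLp.add_apply, PiLp.smul_apply, smul_eq_mul]
  linear_combination
    (v 0 * a 0 + v 1 * a 1 + v 2 * a 2) * (v 0 * b 0 + v 1 * b 1 + v 2 * b 2) * l' *
      (h1 + 2 * C * h2)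

/-- Splits `a` into its tangential and radial parts, which the form scales by `metA` and `metE`. The
factor `|v|²` avoids dividing by the radius. -/
lemma sq_mul_inducedForm (c : ℝ) (v a : Euc 3) : ‖v‖ ^ 2 * inducedForm c v a a =
    metA c (‖v‖ ^ 2) * (‖v‖ ^ 2 * ‖a‖ ^ 2 - inner ℝ v a ^ 2) +
      metE c (‖v‖ ^ 2) * inner ℝ v a ^ 2 := by
  rw [inducedForm_eq, real_inner_self_eq_norm_sq, metE]
  ring

lemma inner_sq_le (v a : Euc 3) : inner ℝ v a ^ 2 ≤ ‖v‖ ^ 2 * ‖a‖ ^ 2 := by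
  rw [← mul_pow, sq_le_sq, abs_mul, abs_norm, abs_norm]
  exact abs_real_inner_le_norm v a

lemma inducedForm_pos {c : ℝ} (hc : 0 < c) {v : Euc 3} (hv : ‖v‖ < π) {a : Euc 3} (ha : a ≠ 0) :
    0 < inducedForm c v a a := by
  have hv' : |‖v‖| < π := by rwa [abs_norm]
  have hA := metA_pos hc hv'
  rcases eq_or_ne v 0 with rfl | h0
  · rw [inducedForm_eq]
    have := norm_pos_iff.2 ha
    simp only [inner_zero_left, real_inner_self_eq_norm_sq]
    have := mul_pos hA (pow_pos this 2)
    simpa using this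
  · have hE := metE_pos hc (hv'.trans (by linarith [Real.pi_pos]))
    have hn : 0 < ‖v‖ ^ 2 := pow_pos (norm_pos_iff.2 h0) 2
    refine pos_of_mul_pos_right ?_ hn.le
    rw [sq_mul_inducedForm]
    have h1 := inner_sq_le v a
    rcases (sq_nonneg (inner ℝ v a)).eq_or_lt with h2 | h2
    · rw [← h2]
      have := mul_pos hn (pow_pos (norm_pos_iff.2 ha) 2)
      simpa using mul_pos hA this
    · exact add_pos_of_nonneg_of_pos (mul_nonneg hA.le (by linarith)) (mul_pos hE h2)

/-! ### The embedding -/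

lemma ell_strictMonoOn {c : ℝ} (hc : 0 < c) : StrictMonoOn (ell c) (Ici 0) := by
  intro x hx y hy hxy
  -- `sin y - sin x = 2 sin ((y - x)/2) cos ((y + x)/2)` is less than `y - x` in absolute value.
  have hmono : x - sin x < y - sin y := by
    have h1 := Real.sin_sub_sin y x
    have h2 : sin ((y - x) / 2) < (y - x) / 2 := Real.sin_lt (by linarith)
    have h3 : -((y - x) / 2) < sin ((y - x) / 2) := by
      rcases le_or_gt ((y - x) / 2) 1 with h | h
      · have := Real.sin_pos_of_pos_of_le_one (x := (y - x) / 2) (by linarith) h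
        linarith
      · linarith [Real.neg_one_le_sin ((y - x) / 2)]
    have h4 : |sin ((y - x) / 2) * cos ((y + x) / 2)| < (y - x) / 2 := by
      rw [abs_mul]
      exact (mul_le_of_le_one_right (abs_nonneg _) (Real.abs_cos_le_one _)).trans_lt
        (abs_lt.2 ⟨h3, h2⟩)
    linarith [(abs_lt.1 h4).2]
  have h0 : 0 ≤ x - sin x := by
    have := Real.sin_le hx
    linarith
  have h1 : cbrt (x - sin x) < cbrt (y - sin y) := by
    refine lt_of_pow_lt_pow_left₀ 3 ?_ ?_
    · rw [cbrt_of_pos (h0.trans_lt hmono)]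
      exact Real.rpow_nonneg (h0.trans hmono.le) _
    · rwa [cbrt_cube, cbrt_cube]
  exact mul_lt_mul_of_pos_left h1 hc

lemma norm_lam_smul {c : ℝ} (hc : 0 < c) (v : Euc 3) : ‖lam c (‖v‖ ^ 2) • v‖ = ell c ‖v‖ := by
  rw [norm_smul, Real.norm_of_nonneg (lam_pos hc (sq_nonneg _)).le, lam_sq_mul c (norm_nonneg v)]

lemma lam_smul_injective {c : ℝ} (hc : 0 < c) :
    Function.Injective (fun v : Euc 3 ↦ lam c (‖v‖ ^ 2) • v) := by
  intro v w h
  have h1 : ell c ‖v‖ = ell c ‖w‖ := by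
    rw [← norm_lam_smul hc, ← norm_lam_smul hc]; exact congrArg norm h
  have h2 := (ell_strictMonoOn hc).injOn (norm_nonneg v) (norm_nonneg w) h1
  simp only [h2] at h
  exact smul_right_injective _ (lam_pos hc (sq_nonneg ‖w‖)).ne' h

lemma continuous_lam_smul (c : ℝ) : Continuous (fun v : Euc 3 ↦ lam c (‖v‖ ^ 2) • v) := by
  have h := (screwMap_contDiff c).continuous.fst
  rwa [show (fun v ↦ (screwMap c v).toProd.1) = fun v : Euc 3 ↦ lam c (‖v‖ ^ 2) • v from
    funext fun v ↦ screwMap_trans c v] at h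

lemma continuous_screwMap (c : ℝ) : Continuous (screwMap c) := by
  refine continuous_induced_rng.2 (Continuous.prodMk ?_ ?_)
  · exact (screwMap_contDiff c).continuous.fst
  · exact (screwMap_contDiff c).continuous.snd.subtype_mk _

lemma PiBall.continuous_val : Continuous PiBall.val := continuous_subtype_val

lemma PiBall.isOpenEmbedding_val : IsOpenEmbedding PiBall.val :=
  ballOpens.isOpen.isOpenEmbedding_subtypeVal

/-- The translation part alone is an embedding. It is continuous and injective on the compact closed
ball, because `ell` is strictly increasing, and it restricts to the open ball. -/
lemma isEmbedding_screwMap {c : ℝ} (hc : 0 < c) :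
    IsEmbedding (fun x : PiBall ↦ screwMap c x.val) := by
  have hcont : Continuous SpinMotion.trans :=
    continuous_fst.comp (continuous_induced_dom (f := fun g : SpinMotion ↦ (g.trans, g.rot)))
  refine IsEmbedding.of_comp ((continuous_screwMap c).comp PiBall.continuous_val) hcont ?_
  have h1 : IsEmbedding (fun v : Metric.closedBall (0 : Euc 3) π ↦ lam c (‖v.1‖ ^ 2) • v.1) := by
    have := isCompact_iff_compactSpace.1 (isCompact_closedBall (0 : Euc 3) π)
    exact (((continuous_lam_smul c).comp continuous_subtype_val).isClosedEmbedding
      ((lam_smul_injective hc).comp Subtype.val_injective)).isEmbedding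
  have h2 : IsEmbedding (fun x : PiBall ↦
      (⟨x.val, Metric.ball_subset_closedBall x.2⟩ : Metric.closedBall (0 : Euc 3) π)) :=
    IsEmbedding.of_comp (PiBall.continuous_val.subtype_mk _) continuous_subtype_val
      PiBall.isOpenEmbedding_val.isEmbedding
  have h3 := h1.comp h2
  rwa [show SpinMotion.trans ∘ (fun x : PiBall ↦ screwMap c x.val) = _ from
    funext fun x ↦ screwMap_trans c x.val]

/-! ### Arc length along radial curves -/

/-- The speed of radial curves, as a function of the signed radius; it is extended by constants
outside `[-π, π]`. -/
noncomputable def radSpeed (c t : ℝ) : ℝ := √(metE c (max (-π) (min t π) ^ 2))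

/-- The arc length along radial curves, as a function of the signed radius. -/
noncomputable def arc (c r : ℝ) : ℝ := ∫ t in (0 : ℝ)..r, radSpeed c t

lemma clamp_mem (t : ℝ) : max (-π) (min t π) ∈ Icc (-π) π :=
  ⟨le_max_left _ _, max_le (by linarith [Real.pi_pos]) (min_le_right _ _)⟩

lemma radSpeed_continuous (c : ℝ) : Continuous (radSpeed c) := by
  refine Real.continuous_sqrt.comp (continuous_iff_continuousAt.2 fun t ↦ ?_)
  exact ContinuousAt.comp (g := metE c) (metE_contDiffAt c (sq_nonneg _)).continuousAt
    (by fun_prop)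

lemma radSpeed_eq (c : ℝ) {t : ℝ} (ht : |t| ≤ π) : radSpeed c t = √(metE c (t ^ 2)) := by
  have h := abs_le.1 ht
  rw [radSpeed, min_eq_left h.2, max_eq_right h.1]

lemma radSpeed_pos {c : ℝ} (hc : 0 < c) (t : ℝ) : 0 < radSpeed c t := by
  rw [radSpeed]
  refine Real.sqrt_pos.2 (metE_pos hc ?_)
  have := abs_le.2 (clamp_mem t)
  linarith [Real.pi_pos]

lemma radSpeed_sq {c : ℝ} (hc : 0 < c) {t : ℝ} (ht : |t| ≤ π) :
    radSpeed c t ^ 2 = metE c (t ^ 2) := by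
  rw [radSpeed_eq c ht, Real.sq_sqrt (metE_pos hc (by linarith [Real.pi_pos])).le]

/-- The clamped speed takes only its values on the compact interval `[-π, π]`, where it is positive
including at the ends. These bounds make arc length and radius comparable. -/
lemma exists_radSpeed_bounds {c : ℝ} (hc : 0 < c) :
    ∃ m W : ℝ, 0 < m ∧ ∀ t, m ≤ radSpeed c t ∧ radSpeed c t ≤ W := by
  have hne : (Icc (-π) π).Nonempty := ⟨0, by simp [Real.pi_pos.le]⟩
  have heq : ∀ t, radSpeed c t = radSpeed c (max (-π) (min t π)) := fun t ↦
    (radSpeed_eq c (abs_le.2 (clamp_mem t))).symm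
  obtain ⟨a, -, ha⟩ := isCompact_Icc.exists_isMinOn hne (radSpeed_continuous c).continuousOn
  obtain ⟨b, -, hb⟩ := isCompact_Icc.exists_isMaxOn hne (radSpeed_continuous c).continuousOn
  refine ⟨radSpeed c a, radSpeed c b, radSpeed_pos hc a, fun t ↦ ?_⟩
  rw [heq t]
  exact ⟨ha (clamp_mem t), hb (clamp_mem t)⟩

lemma arc_hasDerivAt (c r : ℝ) : HasDerivAt (arc c) (radSpeed c r) r :=
  intervalIntegral.integral_hasDerivAt_right ((radSpeed_continuous c).intervalIntegrable _ _)
    ((radSpeed_continuous c).stronglyMeasurableAtFilter _ _) (radSpeed_continuous c).continuousAt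

lemma arc_continuous (c : ℝ) : Continuous (arc c) :=
  continuous_iff_continuousAt.2 fun r ↦ (arc_hasDerivAt c r).continuousAt

lemma arc_zero (c : ℝ) : arc c 0 = 0 := intervalIntegral.integral_same

lemma arc_strictMono {c : ℝ} (hc : 0 < c) : StrictMono (arc c) :=
  strictMono_of_deriv_pos fun r ↦ by
    rw [(arc_hasDerivAt c r).deriv]; exact radSpeed_pos hc r

lemma arc_sub_bounds {c m W : ℝ} (h : ∀ t, m ≤ radSpeed c t ∧ radSpeed c t ≤ W) {r s : ℝ}
    (hrs : r ≤ s) : m * (s - r) ≤ arc c s - arc c r ∧ arc c s - arc c r ≤ W * (s - r) := by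
  have hd : Differentiable ℝ (arc c) := fun r ↦ (arc_hasDerivAt c r).differentiableAt
  refine ⟨mul_sub_le_image_sub_of_le_deriv hd (fun x ↦ ?_) hrs,
    image_sub_le_mul_sub_of_deriv_le hd (fun x ↦ ?_) hrs⟩ <;>
  rw [(arc_hasDerivAt c x).deriv]
  exacts [(h x).1, (h x).2]

lemma arc_neg (c r : ℝ) : arc c (-r) = -arc c r := by
  have h : ∀ t, radSpeed c (-t) = radSpeed c t := by
    intro t
    have hp := Real.pi_pos
    have : max (-π) (min (-t) π) = -max (-π) (min t π) := by
      rcases le_total t π with h1 | h1 <;> rcases le_total (-π) t with h2 | h2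
      · rw [min_eq_left h1, max_eq_right h2, min_eq_left (by linarith), max_eq_right (by linarith)]
      · rw [min_eq_left h1, max_eq_left h2, min_eq_right (by linarith), max_eq_right (by linarith)]
        ring
      · rw [min_eq_right h1, max_eq_right (show -π ≤ π by linarith),
          min_eq_left (show -t ≤ π by linarith), max_eq_left (show -t ≤ -π by linarith)]
      · linarith
    rw [radSpeed, radSpeed, this, neg_sq]
  rw [arc, arc, intervalIntegral.integral_symm, ← neg_zero, ← intervalIntegral.integral_comp_neg]
  simp [h]

lemma arc_surjective {c : ℝ} (hc : 0 < c) : Function.Surjective (arc c) := by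
  obtain ⟨m, W, hm, h⟩ := exists_radSpeed_bounds hc
  refine (arc_continuous c).surjective ?_ ?_
  · refine tendsto_atTop_mono' atTop ?_ (tendsto_id.const_mul_atTop hm)
    filter_upwards [eventually_ge_atTop 0] with r hr
    simpa [arc_zero] using (arc_sub_bounds h hr).1
  · refine tendsto_atBot_mono' atBot ?_ (tendsto_id.const_mul_atBot hm)
    filter_upwards [eventually_le_atBot 0] with r hr
    have := (arc_sub_bounds h hr).1
    rw [arc_zero] at this
    simp only [id]
    linarith

/-- The radius as a function of arc length. -/
noncomputable def arcHomeo {c : ℝ} (hc : 0 < c) : ℝ ≃ₜ ℝ :=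
  ((arc_strictMono hc).orderIsoOfSurjective _ (arc_surjective hc)).toHomeomorph

lemma arc_contDiffOn {c : ℝ} (hc : 0 < c) : ContDiffOn ℝ ∞ (arc c) (Ioo (-π) π) := by
  refine (contDiffOn_infty_iff_deriv_of_isOpen isOpen_Ioo).2
    ⟨fun r _ ↦ (arc_hasDerivAt c r).differentiableAt.differentiableWithinAt, ?_⟩
  have : ContDiffOn ℝ ∞ (fun t ↦ √(metE c (t ^ 2))) (Ioo (-π) π) := by
    intro t ht
    have h := metE_pos (r := t) hc ((abs_lt.2 ht).trans (by linarith [Real.pi_pos]))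
    have h1 : ContDiffAt ℝ ∞ (fun t : ℝ ↦ metE c (t ^ 2)) t :=
      ContDiffAt.comp (g := metE c) t (metE_contDiffAt c (sq_nonneg t)) (by fun_prop)
    exact (h1.sqrt h.ne').contDiffWithinAt
  refine this.congr fun t ht ↦ ?_
  rw [(arc_hasDerivAt c t).deriv, radSpeed_eq c (abs_lt.2 ht).le]

lemma arc_mem_Ioo {c : ℝ} (hc : 0 < c) {r : ℝ} :
    arc c r ∈ Ioo (-arc c π) (arc c π) ↔ r ∈ Ioo (-π) π := by
  rw [← arc_neg, mem_Ioo, mem_Ioo, (arc_strictMono hc).lt_iff_lt, (arc_strictMono hc).lt_iff_lt]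

lemma arc_arcHomeo_symm {c : ℝ} (hc : 0 < c) (s : ℝ) : arc c ((arcHomeo hc).symm s) = s :=
  (arcHomeo hc).apply_symm_apply s

lemma arcHomeo_symm_mem {c : ℝ} (hc : 0 < c) {s : ℝ} (hs : s ∈ Ioo (-arc c π) (arc c π)) :
    (arcHomeo hc).symm s ∈ Ioo (-π) π := by
  rwa [← arc_mem_Ioo hc, arc_arcHomeo_symm]

lemma arcHomeo_symm_hasDerivAt {c : ℝ} (hc : 0 < c) (s : ℝ) :
    HasDerivAt (arcHomeo hc).symm (radSpeed c ((arcHomeo hc).symm s))⁻¹ s :=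
  HasDerivAt.of_local_left_inverse (f := arc c) (arcHomeo hc).symm.continuous.continuousAt
    (arc_hasDerivAt c _) (radSpeed_pos hc _).ne' (Eventually.of_forall (arc_arcHomeo_symm hc))

lemma arcHomeo_symm_contDiffOn {c : ℝ} (hc : 0 < c) :
    ContDiffOn ℝ ∞ (arcHomeo hc).symm (Ioo (-arc c π) (arc c π)) := by
  intro s hs
  have h := arcHomeo_symm_mem hc hs
  exact ((arcHomeo hc).toOpenPartialHomeomorph.contDiffAt_symm_deriv (radSpeed_pos hc _).ne'
    (mem_univ s) (arc_hasDerivAt c _)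
    ((arc_contDiffOn hc).contDiffAt (isOpen_Ioo.mem_nhds h))).contDiffWithinAt

/-! ### Radial geodesics -/

lemma fderiv_inducedForm (c : ℝ) (v a b h : Euc 3) :
    fderiv ℝ (fun y ↦ inducedForm c y a b) v h =
      2 * deriv (metA c) (‖v‖ ^ 2) * inner ℝ v h * inner ℝ a b +
      2 * deriv (metB c) (‖v‖ ^ 2) * inner ℝ v h * inner ℝ v a * inner ℝ v b +
      metB c (‖v‖ ^ 2) * (inner ℝ h a * inner ℝ v b + inner ℝ v a * inner ℝ h b) := by
  have hA := hasFDerivAt_comp_normSq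
    ((metA_contDiffAt c (sq_nonneg ‖v‖)).differentiableAt (by simp)).hasDerivAt
  have hB := hasFDerivAt_comp_normSq
    ((metB_contDiffAt c (sq_nonneg ‖v‖)).differentiableAt (by simp)).hasDerivAt
  have hl : ∀ a : Euc 3, HasFDerivAt (fun v : Euc 3 ↦ inner ℝ v a) (innerSL ℝ a) v := by
    intro a
    have := (innerSL ℝ a).hasFDerivAt (x := v)
    refine this.congr_of_eventuallyEq (Eventually.of_forall fun y ↦ ?_)
    exact real_inner_comm _ _
  have h1 := (hA.mul_const (inner ℝ a b)).add ((hB.mul (hl a)).mul (hl b))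
  have h2 : (fun y ↦ inducedForm c y a b) = fun y ↦ metA c (‖y‖ ^ 2) * inner ℝ a b +
      metB c (‖y‖ ^ 2) * inner ℝ y a * inner ℝ y b := funext fun y ↦ inducedForm_eq c y a b
  rw [h2]
  refine (congrArg (fun l ↦ l h) h1.fderiv).trans ?_
  simp [real_inner_comm h]
  ring

lemma deriv_metE (c : ℝ) {q : ℝ} (hq : 0 ≤ q) :
    HasDerivAt (metE c) (deriv (metA c) q + (deriv (metB c) q * q + metB c q)) q := by
  have hA := ((metA_contDiffAt c hq).differentiableAt (by simp)).hasDerivAt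
  have hB := ((metB_contDiffAt c hq).differentiableAt (by simp)).hasDerivAt
  exact (hA.add (hB.mul (hasDerivAt_id q))).congr_deriv (by simp)

/-- By rotational symmetry only the radial derivative of the radial coefficient survives, and the
result depends on `w` only through `⟨u, w⟩`. The geodesic equation of a ray is therefore scalar. -/
lemma christoffel_radial (c ρ k : ℝ) {u : Euc 3} (hu : ‖u‖ = 1) (w : Euc 3) :
    christoffel (inducedForm c) (ρ • u) (k • u) (k • u) w =
      k ^ 2 * ρ * deriv (metE c) (ρ ^ 2) * inner ℝ u w := by
  have h1 : ‖ρ • u‖ ^ 2 = ρ ^ 2 := by rw [norm_smul, hu, mul_one, Real.norm_eq_abs, sq_abs]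
  have h2 : inner ℝ u u = (1 : ℝ) := by rw [real_inner_self_eq_norm_sq, hu]; norm_num
  rw [christoffel, fderiv_inducedForm, fderiv_inducedForm, h1, (deriv_metE c (sq_nonneg ρ)).deriv]
  simp only [inner_smul_left, inner_smul_right, h2, conj_trivial, real_inner_comm u w]
  ring

lemma inducedForm_radial (c ρ k : ℝ) {u : Euc 3} (hu : ‖u‖ = 1) (w : Euc 3) :
    inducedForm c (ρ • u) (k • u) w = k * metE c (ρ ^ 2) * inner ℝ u w := by
  have h1 : ‖ρ • u‖ ^ 2 = ρ ^ 2 := by rw [norm_smul, hu, mul_one, Real.norm_eq_abs, sq_abs]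
  have h2 : inner ℝ u u = (1 : ℝ) := by rw [real_inner_self_eq_norm_sq, hu]; norm_num
  rw [inducedForm_eq, h1, metE]
  simp only [inner_smul_left, inner_smul_right, h2, conj_trivial]
  ring

/-- The radial curve in the direction of `u`, parametrized by arc length. -/
noncomputable def radGeodesic {c : ℝ} (hc : 0 < c) (u : Euc 3) (s : ℝ) : Euc 3 :=
  (arcHomeo hc).symm s • u

section radGeodesic

variable {c : ℝ} (hc : 0 < c) (u : Euc 3)

lemma radGeodesic_continuous : Continuous (radGeodesic hc u) :=
  (arcHomeo hc).symm.continuous.smul continuous_const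

lemma radGeodesic_contDiffOn :
    ContDiffOn ℝ ∞ (radGeodesic hc u) (Ioo (-arc c π) (arc c π)) :=
  (arcHomeo_symm_contDiffOn hc).smul contDiffOn_const

lemma deriv_radGeodesic (s : ℝ) :
    deriv (radGeodesic hc u) s = (radSpeed c ((arcHomeo hc).symm s))⁻¹ • u :=
  ((arcHomeo_symm_hasDerivAt hc s).smul_const u).deriv

lemma radGeodesic_mem_ball (hu : ‖u‖ = 1) {s : ℝ} (hs : s ∈ Ioo (-arc c π) (arc c π)) :
    radGeodesic hc u s ∈ Metric.ball 0 π := by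
  rw [mem_ball_zero_iff, radGeodesic, norm_smul, hu, mul_one]
  exact abs_lt.2 (arcHomeo_symm_mem hc hs)

lemma isGeodesicOn_radGeodesic (hu : ‖u‖ = 1) :
    IsGeodesicOn (inducedForm c) (Metric.ball 0 π) (radGeodesic hc u)
      (Ioo (-arc c π) (arc c π)) := by
  refine ⟨isOpen_Ioo, ordConnected_Ioo, radGeodesic_contDiffOn hc u,
    fun s hs ↦ radGeodesic_mem_ball hc u hu hs, fun s hs w ↦ ?_⟩
  set ρ := (arcHomeo hc).symm with hρ
  have hd : ∀ s, HasDerivAt ρ (radSpeed c (ρ s))⁻¹ s := arcHomeo_symm_hasDerivAt hc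
  have hmem := abs_lt.2 (arcHomeo_symm_mem hc hs)
  have hpos := radSpeed_pos hc (ρ s)
  have hsp : DifferentiableAt ℝ (radSpeed c) (ρ s) := by
    have h := ((contDiffOn_infty_iff_deriv_of_isOpen isOpen_Ioo).1 (arc_contDiffOn hc)).2
    rw [show deriv (arc c) = radSpeed c from funext fun r ↦ (arc_hasDerivAt c r).deriv] at h
    exact (h.contDiffAt (isOpen_Ioo.mem_nhds (abs_lt.1 hmem))).differentiableAt (by simp)
  have h2 : HasDerivAt (fun s ↦ (radSpeed c (ρ s))⁻¹)
      (-(deriv (radSpeed c) (ρ s) * (radSpeed c (ρ s))⁻¹) / radSpeed c (ρ s) ^ 2) s :=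
    (HasDerivAt.comp s hsp.hasDerivAt (hd s)).inv hpos.ne'
  have h3 : deriv (deriv (radGeodesic hc u)) s =
      (-(deriv (radSpeed c) (ρ s) * (radSpeed c (ρ s))⁻¹) / radSpeed c (ρ s) ^ 2) • u := by
    rw [show deriv (radGeodesic hc u) = fun s ↦ (radSpeed c (ρ s))⁻¹ • u from
      funext (deriv_radGeodesic hc u)]
    exact (h2.smul_const u).deriv
  -- Derivative of `radSpeed² = metE (t²)`. Through it the second derivative of `ρ` cancels the
  -- Christoffel term.
  have h4 : 2 * radSpeed c (ρ s) * deriv (radSpeed c) (ρ s) =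
      deriv (metE c) (ρ s ^ 2) * (2 * ρ s) := by
    have h5 : HasDerivAt (fun t ↦ radSpeed c t ^ 2)
        (2 * radSpeed c (ρ s) * deriv (radSpeed c) (ρ s)) (ρ s) := by
      exact (hsp.hasDerivAt.pow 2).congr_deriv (by simp)
    have h6 : HasDerivAt (fun t : ℝ ↦ metE c (t ^ 2))
        (deriv (metE c) (ρ s ^ 2) * (2 * ρ s)) (ρ s) :=
      HasDerivAt.comp (ρ s) (h := fun r : ℝ ↦ r ^ 2) (h₂ := metE c)
        ((metE_contDiffAt c (sq_nonneg _)).differentiableAt (by simp)).hasDerivAt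
        (by simpa using hasDerivAt_pow 2 (ρ s))
    refine h5.unique (h6.congr_of_eventuallyEq ?_)
    filter_upwards [isOpen_Ioo.mem_nhds (abs_lt.1 hmem)] with t ht
    exact radSpeed_sq hc (abs_lt.2 ht).le
  have h5 := radSpeed_sq hc hmem.le
  rw [h3, deriv_radGeodesic, radGeodesic, inducedForm_radial c _ _ hu, christoffel_radial c _ _ hu,
    ← h5]
  rw [← hρ]
  have h6 : ρ s * deriv (metE c) (ρ s ^ 2) = radSpeed c (ρ s) * deriv (radSpeed c) (ρ s) := by
    linarith
  field_simp
  linear_combination inner ℝ u w * h6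

lemma isInextensible_radGeodesic (hu : ‖u‖ = 1) :
    IsInextensibleGeodesicOn (inducedForm c) (Metric.ball 0 π) (radGeodesic hc u)
      (Ioo (-arc c π) (arc c π)) := by
  refine ⟨isGeodesicOn_radGeodesic hc u hu, fun γ' J' hJ heq hγ ↦ ?_⟩
  have hL : 0 < arc c π := by rw [← arc_zero c]; exact arc_strictMono hc Real.pi_pos
  have h0 : (0 : ℝ) ∈ J' := hJ ⟨by linarith, hL⟩
  -- An extension would be continuous at an end of the interval, so its value there would have norm
  -- `π`, outside the open ball.
  have hend : ∀ s : ℝ, s ∈ closure (Ioo (-arc c π) (arc c π)) → |(arcHomeo hc).symm s| = π →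
      s ∉ J' := by
    intro s hs hsπ hsJ
    have hc1 : ContinuousAt γ' s :=
      (hγ.contDiffOn.contDiffAt (hγ.isOpen.mem_nhds hsJ)).continuousAt
    have : (𝓝[Ioo (-arc c π) (arc c π)] s).NeBot := mem_closure_iff_nhdsWithin_neBot.1 hs
    have h1 : Tendsto γ' (𝓝[Ioo (-arc c π) (arc c π)] s) (𝓝 (γ' s)) :=
      hc1.tendsto.mono_left nhdsWithin_le_nhds
    have h2 : Tendsto (radGeodesic hc u) (𝓝[Ioo (-arc c π) (arc c π)] s)
        (𝓝 (radGeodesic hc u s)) :=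
      ((radGeodesic_continuous hc u).tendsto s).mono_left nhdsWithin_le_nhds
    have h3 : γ' s = radGeodesic hc u s :=
      tendsto_nhds_unique (h1.congr' (by
        filter_upwards [self_mem_nhdsWithin] with t ht using (heq ht).symm)) h2
    have h4 := hγ.mapsTo hsJ
    rw [h3, mem_ball_zero_iff, radGeodesic, norm_smul, hu, mul_one, Real.norm_eq_abs, hsπ] at h4
    exact lt_irrefl _ h4
  rw [closure_Ioo (by linarith)] at hend
  have hsymm : ∀ r, (arcHomeo hc).symm (arc c r) = r := (arcHomeo hc).symm_apply_apply
  refine Subset.antisymm (fun t ht ↦ ?_) hJ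
  constructor
  · by_contra! h
    refine hend (-arc c π) ⟨le_rfl, by linarith⟩ ?_ (hγ.ordConnected.out ht h0 ⟨h, by linarith⟩)
    rw [← arc_neg, hsymm, abs_neg, abs_of_pos Real.pi_pos]
  · by_contra! h
    refine hend (arc c π) ⟨by linarith, le_rfl⟩ ?_ (hγ.ordConnected.out h0 ht ⟨hL.le, h⟩)
    rw [hsymm, abs_of_pos Real.pi_pos]

lemma curveLength_radGeodesic (hu : ‖u‖ = 1) :
    curveLength (inducedForm c) (radGeodesic hc u) (Ioo (-arc c π) (arc c π)) =
      ENNReal.ofReal (2 * arc c π) := by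
  have h : ∀ s ∈ Ioo (-arc c π) (arc c π), ENNReal.ofReal √(inducedForm c (radGeodesic hc u s)
      (deriv (radGeodesic hc u) s) (deriv (radGeodesic hc u) s)) = 1 := by
    intro s hs
    have hmem := abs_lt.2 (arcHomeo_symm_mem hc hs)
    have hpos := (radSpeed_pos hc ((arcHomeo hc).symm s)).ne'
    rw [deriv_radGeodesic, radGeodesic, inducedForm_radial c _ _ hu, inner_smul_right,
      real_inner_self_eq_norm_sq, hu, ← radSpeed_sq hc hmem.le]
    field_simp
    simp
  rw [curveLength, setLIntegral_congr_fun measurableSet_Ioo h]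
  rw [setLIntegral_const, one_mul, Real.volume_Ioo]
  ring_nf

end radGeodesic

lemma exists_radial_geodesic {c : ℝ} (hc : 0 < c) (u : Euc 3) (hu : ‖u‖ = 1) :
    ∃ (L : ℝ) (σ : ℝ → ℝ) (γ : ℝ → Euc 3), 0 < L ∧
        ContDiffOn ℝ ∞ σ (Ioo (-π) π) ∧ (∀ r ∈ Ioo (-π) π, 0 < deriv σ r) ∧
        BijOn σ (Ioo (-π) π) (Ioo (-L) L) ∧
        (∀ r ∈ Ioo (-π) π, γ (σ r) = r • u) ∧
        IsInextensibleGeodesicOn (inducedForm c) (Metric.ball 0 π) γ (Ioo (-L) L) ∧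
        curveLength (inducedForm c) γ (Ioo (-L) L) = ENNReal.ofReal (2 * L) := by
  refine ⟨arc c π, arc c, radGeodesic hc u, ?_, arc_contDiffOn hc, fun r _ ↦ ?_, ?_, fun r _ ↦ ?_,
    isInextensible_radGeodesic hc u hu, curveLength_radGeodesic hc u hu⟩
  · rw [← arc_zero c]; exact arc_strictMono hc Real.pi_pos
  · rw [(arc_hasDerivAt c r).deriv]; exact radSpeed_pos hc r
  · exact ⟨fun r hr ↦ (arc_mem_Ioo hc).2 hr, (arc_strictMono hc).injective.injOn, fun s hs ↦
      ⟨_, arcHomeo_symm_mem hc hs, arc_arcHomeo_symm hc s⟩⟩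
  · exact congrArg (· • u) ((arcHomeo hc).symm_apply_apply r)

/-! ### The Riemannian metric on the ball -/

/-- The Euclidean inner product as a continuous bilinear form. -/
noncomputable def innerBL : Euc 3 →L[ℝ] Euc 3 →L[ℝ] ℝ :=
  LinearMap.mkContinuous₂ (innerₗ (Euc 3)) 1 fun a b ↦ by
    rw [one_mul]; exact norm_inner_le_norm a b

/-- The induced form as a continuous bilinear form. -/
noncomputable def inducedFormL (c : ℝ) (v : Euc 3) : Euc 3 →L[ℝ] Euc 3 →L[ℝ] ℝ :=
  metA c (‖v‖ ^ 2) • innerBL + metB c (‖v‖ ^ 2) • (innerBL v).smulRight (innerBL v)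

lemma inducedFormL_apply (c : ℝ) (v a b : Euc 3) :
    inducedFormL c v a b = inducedForm c v a b := by
  rw [inducedForm_eq]
  change metA c (‖v‖ ^ 2) * inner ℝ a b + metB c (‖v‖ ^ 2) * (inner ℝ v a * inner ℝ v b) = _
  ring

lemma inducedForm_contDiff (c : ℝ) (a b : Euc 3) : ContDiff ℝ ∞ (fun v ↦ inducedForm c v a b) := by
  simp only [inducedForm_eq]
  rw [contDiff_iff_contDiffAt]
  intro v
  have hq : ContDiffAt ℝ ∞ (fun v : Euc 3 ↦ ‖v‖ ^ 2) v := (contDiff_norm_sq ℝ).contDiffAt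
  have h1 : ContDiffAt ℝ ∞ (fun v : Euc 3 ↦ metA c (‖v‖ ^ 2)) v :=
    ContDiffAt.comp (g := metA c) v (metA_contDiffAt c (sq_nonneg ‖v‖)) hq
  have h2 : ContDiffAt ℝ ∞ (fun v : Euc 3 ↦ metB c (‖v‖ ^ 2)) v :=
    ContDiffAt.comp (g := metB c) v (metB_contDiffAt c (sq_nonneg ‖v‖)) hq
  have h3 : ∀ a : Euc 3, ContDiffAt ℝ ∞ (fun v : Euc 3 ↦ inner ℝ v a) v := fun a ↦
    contDiffAt_id.inner ℝ contDiffAt_const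
  exact (h1.mul contDiffAt_const).add ((h2.mul (h3 a)).mul (h3 b))

lemma inducedFormL_contDiff (c : ℝ) : ContDiff ℝ ∞ (inducedFormL c) := by
  refine contDiff_clm_apply_iff.2 fun a ↦ contDiff_clm_apply_iff.2 fun b ↦ ?_
  simp only [inducedFormL_apply]
  exact inducedForm_contDiff c a b

lemma PiBall.norm_val_lt (x : PiBall) : ‖x.val‖ < π := mem_ball_zero_iff.1 x.2

lemma PiBall.mem_chartAt_source (x y : PiBall) : y ∈ (chartAt (Euc 3) x).source :=
  mem_chart_source (Euc 3) y

/-- Every chart of the open subset is the restricted identity chart, so the coordinate change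
between the charts at `x₀` and at `x` is a self-change. -/
lemma PiBall.trivializationAt_symm (x₀ x : PiBall) (v : Euc 3) :
    (trivializationAt (Euc 3) (TangentSpace (𝓡 3) (M := PiBall)) x₀).symm x v = v := by
  have h := TangentBundle.symmL_trivializationAt_eq_core (I := 𝓡 3)
    (PiBall.mem_chartAt_source x₀ x)
  have h2 := congrArg (fun l ↦ l v) h
  refine Eq.trans ?_ (h2.trans ?_)
  · exact (Trivialization.symmL_apply (hb := PiBall.mem_chartAt_source x₀ x) ..).symm
  · exact (tangentBundleCore (𝓡 3) PiBall).coordChange_self (achart (Euc 3) x) x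
      (PiBall.mem_chartAt_source x x) v

lemma PiBall.contMDiff_val : ContMDiff (𝓡 3) (𝓡 3) ∞ PiBall.val :=
  contMDiff_subtype_val (U := ballOpens)

/-- The induced form on the tangent spaces of the ball. -/
noncomputable def ballInner (c : ℝ) (x : PiBall) :
    TangentSpace (𝓡 3) x →L[ℝ] TangentSpace (𝓡 3) x →L[ℝ] ℝ :=
  inducedFormL c x.val

lemma ballInner_apply (c : ℝ) (x : PiBall) (a b : TangentSpace (𝓡 3) x) :
    ballInner c x a b = inducedForm c x.val a b :=
  inducedFormL_apply c x.val a b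

lemma contMDiff_ballInner (c : ℝ) : ContMDiff (𝓡 3) ((𝓡 3).prod 𝓘(ℝ, Euc 3 →L[ℝ] Euc 3 →L[ℝ] ℝ)) ∞
    (fun x : PiBall ↦ TotalSpace.mk' (Euc 3 →L[ℝ] Euc 3 →L[ℝ] ℝ) x (ballInner c x)) := by
  intro x₀
  rw [contMDiffAt_section]
  have h : ContMDiffAt (𝓡 3) 𝓘(ℝ, Euc 3 →L[ℝ] Euc 3 →L[ℝ] ℝ) ∞
      (fun x : PiBall ↦ inducedFormL c x.val) x₀ :=
    (inducedFormL_contDiff c).contMDiff.comp PiBall.contMDiff_val x₀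
  refine h.congr_of_eventuallyEq (Eventually.of_forall fun x ↦ ?_)
  ext1 a
  ext1 b
  have hx : x ∈ (trivializationAt (Euc 3) (TangentSpace (𝓡 3) (M := PiBall)) x₀).baseSet :=
    PiBall.mem_chartAt_source x₀ x
  refine (inCoordinates_apply_eq₂ hx hx (mem_univ _)).trans ?_
  rw [PiBall.trivializationAt_symm, PiBall.trivializationAt_symm]
  simp [ballInner]
  rfl

lemma inducedForm_comm (c : ℝ) (v a b : Euc 3) : inducedForm c v a b = inducedForm c v b a := by
  rw [inducedForm_eq, inducedForm_eq, real_inner_comm]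
  ring

lemma exists_mul_le_inducedForm {c : ℝ} (hc : 0 < c) {v : Euc 3} (hv : ‖v‖ < π) :
    ∃ m > 0, ∀ a, m * ‖a‖ ^ 2 ≤ inducedForm c v a a := by
  have hA := metA_pos hc (r := ‖v‖) (by rwa [abs_norm])
  have hE := metE_pos hc (r := ‖v‖) (by rw [abs_norm]; linarith [Real.pi_pos])
  rcases eq_or_ne v 0 with rfl | h0
  · refine ⟨_, hA, fun a ↦ ?_⟩
    rw [inducedForm_eq, real_inner_self_eq_norm_sq]
    simp
  · refine ⟨min (metA c (‖v‖ ^ 2)) (metE c (‖v‖ ^ 2)), lt_min hA hE, fun a ↦ ?_⟩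
    have hn : 0 < ‖v‖ ^ 2 := pow_pos (norm_pos_iff.2 h0) 2
    refine le_of_mul_le_mul_left ?_ hn
    rw [sq_mul_inducedForm]
    have h1 := inner_sq_le v a
    have h2 := mul_le_mul_of_nonneg_right (min_le_left (metA c (‖v‖ ^ 2)) (metE c (‖v‖ ^ 2)))
      (sub_nonneg.2 h1)
    have h3 := mul_le_mul_of_nonneg_right (min_le_right (metA c (‖v‖ ^ 2)) (metE c (‖v‖ ^ 2)))
      (sq_nonneg (inner ℝ v a))
    linarith

/-- The Riemannian metric induced on the ball. -/
noncomputable def ballMetric {c : ℝ} (hc : 0 < c) :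
    ContMDiffRiemannianMetric (𝓡 3) ∞ (Euc 3) (fun x : PiBall ↦ TangentSpace (𝓡 3) x) where
  inner := ballInner c
  symm x a b := by
    rw [ballInner_apply, ballInner_apply]
    exact inducedForm_comm c x.val a b
  pos x a ha := by
    rw [ballInner_apply]
    exact inducedForm_pos hc x.norm_val_lt ha
  isVonNBounded x := by
    obtain ⟨m, hm, h⟩ := exists_mul_le_inducedForm hc x.norm_val_lt
    have h1 : Bornology.IsVonNBounded ℝ (Metric.ball (0 : Euc 3) √(1 / m)) :=
      NormedSpace.isVonNBounded_ball ℝ (Euc 3) _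
    refine Bornology.IsVonNBounded.subset (E := Euc 3)
      (s₁ := {a | ballInner c x a a < 1}) (s₂ := Metric.ball (0 : Euc 3) √(1 / m)) ?_ h1
    intro a ha
    have h2 : inducedForm c x.val a a < 1 := (ballInner_apply c x a a).symm.trans_lt ha
    refine mem_ball_zero_iff.2 (Real.lt_sqrt_of_sq_lt ?_)
    rw [lt_div_iff₀ hm, mul_comm]
    exact (h a).trans_lt h2
  contMDiff := contMDiff_ballInner c

lemma isInducedMetric_ballMetric {c : ℝ} (hc : 0 < c) : IsInducedMetric c (ballMetric hc) :=
  fun x a b ↦ inducedFormL_apply c x.val a b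

/-! ### Lengths of curves and Lipschitz functions -/

section Lipschitz

variable {E : Type*} [NormedAddCommGroup E] [NormedSpace ℝ E] {H : Type*} [TopologicalSpace H]
  {I : ModelWithCorners ℝ E H} {M : Type*} [TopologicalSpace M] [ChartedSpace H M]
  [∀ x : M, ENorm (TangentSpace I x)] {V : Type*} [NormedAddCommGroup V] [NormedSpace ℝ V]

/-- A function whose differential is bounded by `C` on an open set increases distances along
curves in this set at most by the factor `C`. -/
lemma edist_comp_le_pathELength {F : M → V} {s : Set M} (hs : IsOpen s)
    (hF : ContMDiffOn I 𝓘(ℝ, V) 1 F s) {C : NNReal}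
    (hC : ∀ x ∈ s, ∀ v : TangentSpace I x, @enorm V _ (mfderiv I 𝓘(ℝ, V) F x v) ≤ C * ‖v‖ₑ)
    {γ : ℝ → M} (hγ : ContMDiff 𝓘(ℝ, ℝ) I 1 γ) {a b : ℝ} (hab : a < b)
    (hγs : ∀ t ∈ Icc a b, γ t ∈ s) :
    edist (F (γ a)) (F (γ b)) ≤ C * pathELength I γ a b := by
  have hsm : ContMDiffOn 𝓘(ℝ, ℝ) 𝓘(ℝ, V) 1 (F ∘ γ) (Icc a b) :=
    hF.comp hγ.contMDiffOn hγs
  have h1 := enorm_sub_le_lintegral_derivWithin_Icc_of_contDiffOn_Icc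
    (contMDiffOn_iff_contDiffOn.1 hsm) hab.le
  rw [edist_comm, edist_eq_enorm_sub]
  refine h1.trans ?_
  rw [pathELength_eq_lintegral_mfderivWithin_Icc, ← lintegral_const_mul' _ _ ENNReal.coe_ne_top]
  refine setLIntegral_mono' measurableSet_Icc fun t ht ↦ ?_
  have h2 : mfderivWithin 𝓘(ℝ, ℝ) 𝓘(ℝ, V) (F ∘ γ) (Icc a b) t =
      (mfderiv I 𝓘(ℝ, V) F (γ t)) ∘L (mfderivWithin 𝓘(ℝ, ℝ) I γ (Icc a b) t) := by
    apply mfderiv_comp_mfderivWithin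
    · exact ((hF _ (hγs t ht)).contMDiffAt (hs.mem_nhds (hγs t ht))).mdifferentiableAt one_ne_zero
    · exact (hγ.mdifferentiable one_ne_zero).mdifferentiableOn t ht
    · rw [uniqueMDiffWithinAt_iff_uniqueDiffWithinAt]
      exact uniqueDiffOn_Icc hab t ht
  have h3 : derivWithin (F ∘ γ) (Icc a b) t =
      mfderiv I 𝓘(ℝ, V) F (γ t) (mfderivWithin 𝓘(ℝ, ℝ) I γ (Icc a b) t 1) := by
    rw [← fderivWithin_derivWithin, ← mfderivWithin_eq_fderivWithin]
    exact congrArg (fun l ↦ l 1) h2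
  rw [h3]
  exact hC _ (hγs t ht) _

end Lipschitz

section RiemDist

variable {n : ℕ} {M : Type*} [TopologicalSpace M] [ChartedSpace (Euc n) M] [IsManifold (𝓡 n) ∞ M]
  (G : ContMDiffRiemannianMetric (𝓡 n) ∞ (Euc n) (fun x : M ↦ TangentSpace (𝓡 n) x))

lemma enorm_tangent (x : M) (v : TangentSpace (𝓡 n) x) :
    letI : RiemannianBundle (fun x : M ↦ TangentSpace (𝓡 n) x) := ⟨G.toRiemannianMetric⟩
    ‖v‖ₑ = ENNReal.ofReal √(G.inner x v v) := by
  let _ : RiemannianBundle (fun x : M ↦ TangentSpace (𝓡 n) x) := ⟨G.toRiemannianMetric⟩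
  rw [← ofReal_norm, norm_eq_sqrt_real_inner]
  rfl

lemma edist_le_mul_riemDist {V : Type*} [NormedAddCommGroup V] [NormedSpace ℝ V]
    {F : M → V} (hF : ContMDiff (𝓡 n) 𝓘(ℝ, V) 1 F) {C : NNReal} (h0 : C ≠ 0)
    (hC : ∀ x, ∀ v : TangentSpace (𝓡 n) x, @enorm V _ (mfderiv (𝓡 n) 𝓘(ℝ, V) F x v) ≤
      C * ENNReal.ofReal √(G.inner x v v)) (x y : M) :
    edist (F x) (F y) ≤ C * riemDist G x y := by
  let _ : RiemannianBundle (fun x : M ↦ TangentSpace (𝓡 n) x) := ⟨G.toRiemannianMetric⟩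
  have h0' : (C : ℝ≥0∞) ≠ 0 := by exact_mod_cast h0
  refine le_of_forall_gt fun r hr ↦ ?_
  have h1 : riemannianEDist (𝓡 n) x y < r / C := by
    rw [ENNReal.lt_div_iff_mul_lt (Or.inl h0') (Or.inl ENNReal.coe_ne_top), mul_comm]
    exact hr
  -- A nearly minimizing curve that is `C¹` on the whole line, as `edist_comp_le_pathELength`
  -- requires.
  obtain ⟨γ, rfl, rfl, hγ, hlt, -⟩ := exists_lt_locally_constant_of_riemannianEDist_lt h1
    zero_lt_one
  refine (edist_comp_le_pathELength isOpen_univ hF.contMDiffOn (fun x _ v ↦ ?_) hγ zero_lt_one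
    fun t _ ↦ mem_univ _).trans_lt ((ENNReal.mul_lt_mul_right h0' ENNReal.coe_ne_top hlt).trans_le
      ENNReal.mul_div_le)
  exact (hC x v).trans_eq (congrArg _ (enorm_tangent G x v).symm)

end RiemDist

/-! ### The distance of the ball -/

namespace PiBall

lemma hasMFDerivAt_val (x : PiBall) :
    HasMFDerivAt (𝓡 3) 𝓘(ℝ, Euc 3) PiBall.val x (ContinuousLinearMap.id ℝ (Euc 3)) := by
  refine ⟨PiBall.continuous_val.continuousAt, ?_⟩
  have h : HasFDerivAt (fun v : Euc 3 ↦ v) (ContinuousLinearMap.id ℝ (Euc 3))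
      (extChartAt (𝓡 3) x x) := hasFDerivAt_id _
  have ht : (extChartAt (𝓡 3) x).target ∈ 𝓝 (extChartAt (𝓡 3) x x) := extChartAt_target_mem_nhds x
  refine (h.congr_of_eventuallyEq ?_).hasFDerivWithinAt
  filter_upwards [ht] with v hv
  exact (extChartAt (𝓡 3) x).right_inv hv

lemma mfderiv_comp_val {V : Type*} [NormedAddCommGroup V] [NormedSpace ℝ V] {F : Euc 3 → V}
    {x : PiBall} (hF : DifferentiableAt ℝ F x.val) (a : Euc 3) :
    mfderiv (𝓡 3) 𝓘(ℝ, V) (fun y : PiBall ↦ F y.val) x a = fderiv ℝ F x.val a := by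
  have h1 : HasMFDerivAt 𝓘(ℝ, Euc 3) 𝓘(ℝ, V) F x.val (fderiv ℝ F x.val) :=
    hF.hasFDerivAt.hasMFDerivAt
  have h2 := (h1.comp x (hasMFDerivAt_val x)).mfderiv
  exact congrArg (fun l ↦ l a) h2

/-- The point of `PiBall` given by a point of the ball. -/
def mk (v : Euc 3) (h : v ∈ Metric.ball 0 π) : PiBall := (⟨v, h⟩ : ballOpens)

lemma val_mk (v : Euc 3) (h : v ∈ Metric.ball 0 π) : (mk v h).val = v := rfl

/-- The curve in the manifold `PiBall` given by a curve in the ball. -/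
noncomputable def lift (x : PiBall) (γ : ℝ → Euc 3) (t : ℝ) : PiBall :=
  open Classical in if h : γ t ∈ Metric.ball 0 π then mk (γ t) h else x

lemma val_lift {x : PiBall} {γ : ℝ → Euc 3} {t : ℝ} (h : γ t ∈ Metric.ball 0 π) :
    (lift x γ t).val = γ t := by
  rw [lift, dif_pos h, val_mk]

lemma val_injective : Function.Injective PiBall.val := Subtype.val_injective

lemma contMDiffAt_of_val {γ : ℝ → PiBall} {t : ℝ} {k : ℕ∞ω}
    (h : ContDiffAt ℝ k (fun s ↦ (γ s).val) t) : ContMDiffAt 𝓘(ℝ, ℝ) (𝓡 3) k γ t := by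
  rw [contMDiffAt_iff]
  refine ⟨PiBall.isOpenEmbedding_val.isEmbedding.isInducing.continuousAt_iff.2 h.continuousAt, ?_⟩
  exact h.contDiffWithinAt

lemma contMDiffAt_lift (x : PiBall) {γ : ℝ → Euc 3} {t : ℝ} {k : ℕ∞ω} (hγ : ContDiffAt ℝ k γ t)
    (h : γ t ∈ Metric.ball 0 π) : ContMDiffAt 𝓘(ℝ, ℝ) (𝓡 3) k (lift x γ) t := by
  refine contMDiffAt_of_val (hγ.congr_of_eventuallyEq ?_)
  filter_upwards [hγ.continuousAt.preimage_mem_nhds (Metric.isOpen_ball.mem_nhds h)] with s hs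
  exact val_lift hs

lemma mfderiv_lift (x : PiBall) {γ : ℝ → Euc 3} {t : ℝ} (hγ : ContDiffAt ℝ 1 γ t)
    (h : γ t ∈ Metric.ball 0 π) : mfderiv 𝓘(ℝ, ℝ) (𝓡 3) (lift x γ) t (1 : ℝ) = deriv γ t := by
  have h1 : (fun s ↦ (lift x γ s).val) =ᶠ[𝓝 t] γ := by
    filter_upwards [hγ.continuousAt.preimage_mem_nhds (Metric.isOpen_ball.mem_nhds h)] with s hs
    exact val_lift hs
  have h2 := (contMDiffAt_lift x hγ h).mdifferentiableAt one_ne_zero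
  have h3 := ((hasMFDerivAt_val (lift x γ t)).comp t h2.hasMFDerivAt).mfderiv
  have h4 := mfderiv_eq_fderiv (𝕜 := ℝ) (f := fun s ↦ (lift x γ s).val) (x := t)
  have h5 := congrArg (fun l ↦ l (1 : ℝ)) (h3.symm.trans h4)
  refine Eq.trans h5 ?_
  change fderiv ℝ (fun s ↦ (lift x γ s).val) t 1 = deriv γ t
  rw [h1.fderiv_eq, fderiv_apply_one_eq_deriv]

end PiBall

section BallDist

variable {c : ℝ} (hc : 0 < c)

lemma riemDist_le_lintegral {γ : ℝ → Euc 3} (hγ : ContDiff ℝ 1 γ) {a b : ℝ} (hab : a ≤ b)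
    (hmem : ∀ t ∈ Icc a b, γ t ∈ Metric.ball 0 π) {x y : PiBall} (hx : γ a = x.val)
    (hy : γ b = y.val) : riemDist (ballMetric hc) x y ≤
      ∫⁻ t in Icc a b, ENNReal.ofReal √(inducedForm c (γ t) (deriv γ t) (deriv γ t)) := by
  let _ : RiemannianBundle (fun x : PiBall ↦ TangentSpace (𝓡 3) x) :=
    ⟨(ballMetric hc).toRiemannianMetric⟩
  have h1 : riemannianEDist (𝓡 3) x y ≤ pathELength (𝓡 3) (PiBall.lift x γ) a b := by
    refine riemannianEDist_le_pathELength (fun t ht ↦ ?_) (PiBall.val_injective ?_)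
      (PiBall.val_injective ?_) hab
    · exact (PiBall.contMDiffAt_lift x hγ.contDiffAt (hmem t ht)).contMDiffWithinAt
    · rw [PiBall.val_lift (hmem a ⟨le_rfl, hab⟩), hx]
    · rw [PiBall.val_lift (hmem b ⟨hab, le_rfl⟩), hy]
  refine h1.trans (le_of_eq ?_)
  rw [pathELength_eq_lintegral_mfderiv_Icc]
  refine setLIntegral_congr_fun measurableSet_Icc fun t ht ↦ ?_
  refine (enorm_tangent (ballMetric hc) _ _).trans ?_
  have h2 := PiBall.mfderiv_lift x (hγ.contDiffAt (x := t)) (hmem t ht)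
  have h3 := PiBall.val_lift (x := x) (hmem t ht)
  have h4 := isInducedMetric_ballMetric hc (PiBall.lift x γ t) (deriv γ t) (deriv γ t)
  rw [h3] at h4
  rw [← h4]
  change ENNReal.ofReal √((ballMetric hc).inner (PiBall.lift x γ t)
    (mfderiv 𝓘(ℝ, ℝ) (𝓡 3) (PiBall.lift x γ) t (1 : ℝ))
    (mfderiv 𝓘(ℝ, ℝ) (𝓡 3) (PiBall.lift x γ) t (1 : ℝ))) = _
  rw [h2]

/-- Source of all lower bounds for the distance of the ball: integrate `dF` along curves and test
with suitable `F`. -/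
lemma abs_sub_le_mul_riemDist {F : Euc 3 → ℝ} (hF : ContDiffOn ℝ 1 F (Metric.ball 0 π)) {K : ℝ}
    (hK : 0 < K)
    (h : ∀ v ∈ Metric.ball (0 : Euc 3) π, ∀ a, |fderiv ℝ F v a| ≤ K * √(inducedForm c v a a))
    (x y : PiBall) :
    ENNReal.ofReal |F x.val - F y.val| ≤ ENNReal.ofReal K * riemDist (ballMetric hc) x y := by
  have h1 : ContMDiff (𝓡 3) 𝓘(ℝ, ℝ) 1 (fun x : PiBall ↦ F x.val) := by
    have h2 : ContMDiff (𝓡 3) (𝓡 3) 1 PiBall.val := PiBall.contMDiff_val.of_le (by simp)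
    exact hF.contMDiffOn.comp_contMDiff h2 fun x ↦ x.2
  have h2 := edist_le_mul_riemDist (ballMetric hc) h1 (C := K.toNNReal)
    (Real.toNNReal_pos.2 hK).ne' (fun x v ↦ ?_) x y
  · rwa [edist_dist, Real.dist_eq] at h2
  have hd : DifferentiableAt ℝ F x.val :=
    (hF.contDiffAt (Metric.isOpen_ball.mem_nhds x.2)).differentiableAt one_ne_zero
  have h3 := PiBall.mfderiv_comp_val hd v
  have h4 : (ballMetric hc).inner x v v = inducedForm c x.val v v :=
    isInducedMetric_ballMetric hc x v v
  rw [h4]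
  refine (congrArg (fun r : ℝ ↦ ‖r‖ₑ) h3).trans_le ?_
  change ‖fderiv ℝ F x.val v‖ₑ ≤ ENNReal.ofReal K * _
  rw [Real.enorm_eq_ofReal_abs, ← ENNReal.ofReal_mul hK.le]
  exact ENNReal.ofReal_le_ofReal (h x.val x.2 v)

end BallDist

/-! ### Upper bounds for the distance of the ball -/

section UpperBounds

variable {c : ℝ} (hc : 0 < c)

lemma riemDist_comm {n : ℕ} {M : Type*} [TopologicalSpace M] [ChartedSpace (Euc n) M]
    [IsManifold (𝓡 n) ∞ M]
    (G : ContMDiffRiemannianMetric (𝓡 n) ∞ (Euc n) (fun x : M ↦ TangentSpace (𝓡 n) x)) (x y : M) :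
    riemDist G x y = riemDist G y x :=
  letI : RiemannianBundle (fun x : M ↦ TangentSpace (𝓡 n) x) := ⟨G.toRiemannianMetric⟩
  riemannianEDist_comm

lemma riemDist_triangle {n : ℕ} {M : Type*} [TopologicalSpace M] [ChartedSpace (Euc n) M]
    [IsManifold (𝓡 n) ∞ M]
    (G : ContMDiffRiemannianMetric (𝓡 n) ∞ (Euc n) (fun x : M ↦ TangentSpace (𝓡 n) x))
    (x y z : M) : riemDist G x z ≤ riemDist G x y + riemDist G y z :=
  letI : RiemannianBundle (fun x : M ↦ TangentSpace (𝓡 n) x) := ⟨G.toRiemannianMetric⟩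
  riemannianEDist_triangle

/-- The radius of the distance sphere which is the image of the sphere of radius `r`, measured
along great circles. -/
noncomputable def warp (c r : ℝ) : ℝ := √(ell c r * sin r / 2)

lemma warp_eq (c : ℝ) {r : ℝ} (hr : 0 ≤ r) : warp c r = √(metA c (r ^ 2)) * r := by
  rw [warp, ← metA_mul_sq c hr, Real.sqrt_mul' _ (sq_nonneg r), Real.sqrt_sq hr]

lemma riemDist_radial_le {u : Euc 3} (hu : ‖u‖ = 1) {r s : ℝ} (hrs : r ≤ s) {x y : PiBall}
    (hx : x.val = r • u) (hy : y.val = s • u) :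
    riemDist (ballMetric hc) x y ≤ ENNReal.ofReal (arc c s - arc c r) := by
  have hnorm : ∀ t : ℝ, ‖t • u‖ = |t| := fun t ↦ by rw [norm_smul, hu, mul_one, Real.norm_eq_abs]
  have hr : |r| < π := by rw [← hnorm, ← hx]; exact x.norm_val_lt
  have hs : |s| < π := by rw [← hnorm, ← hy]; exact y.norm_val_lt
  have hmem : ∀ t ∈ Icc r s, |t| < π := fun t ht ↦
    abs_lt.2 ⟨(abs_lt.1 hr).1.trans_le ht.1, ht.2.trans_lt (abs_lt.1 hs).2⟩
  have hd : ∀ t : ℝ, deriv (fun t : ℝ ↦ t • u) t = (1 : ℝ) • u := fun t ↦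
    ((hasDerivAt_id t).smul_const u).deriv
  refine (riemDist_le_lintegral hc (γ := fun t : ℝ ↦ t • u) (contDiff_id.smul contDiff_const)
    hrs (fun t ht ↦ ?_) hx.symm hy.symm).trans (le_of_eq ?_)
  · rw [mem_ball_zero_iff, hnorm]; exact hmem t ht
  have h1 : ∀ t ∈ Icc r s, ENNReal.ofReal √(inducedForm c (t • u) (deriv (fun t : ℝ ↦ t • u) t)
      (deriv (fun t : ℝ ↦ t • u) t)) = ENNReal.ofReal (radSpeed c t) := by
    intro t ht
    rw [hd, inducedForm_radial c _ _ hu, radSpeed_eq c (hmem t ht).le, one_smul,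
      real_inner_self_eq_norm_sq, hu]
    simp
  rw [setLIntegral_congr_fun measurableSet_Icc h1, ← ofReal_integral_eq_lintegral_ofReal
    (radSpeed_continuous c).integrableOn_Icc (Eventually.of_forall fun t ↦ (radSpeed_pos hc t).le),
    integral_Icc_eq_integral_Ioc, ← intervalIntegral.integral_of_le hrs]
  congr 1
  rw [arc, arc, intervalIntegral.integral_interval_sub_left] <;>
  exact (radSpeed_continuous c).intervalIntegrable _ _

lemma riemDist_quarter_le {u w : Euc 3} (hu : ‖u‖ = 1) (hw : ‖w‖ = 1) (huw : inner ℝ u w = (0 : ℝ))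
    {r : ℝ} (hr : 0 ≤ r) {x y : PiBall} (hx : x.val = r • u) (hy : y.val = r • w) :
    riemDist (ballMetric hc) x y ≤ ENNReal.ofReal (π / 2 * warp c r) := by
  have hr' : r < π := by
    have := x.norm_val_lt
    rwa [hx, norm_smul, hu, mul_one, Real.norm_of_nonneg hr] at this
  set γ : ℝ → Euc 3 := fun t ↦ r • (cos t • u + sin t • w) with hγ
  have hd : ∀ t : ℝ, deriv γ t = r • (-sin t • u + cos t • w) := fun t ↦
    ((((Real.hasDerivAt_cos t).smul_const u).add
      ((Real.hasDerivAt_sin t).smul_const w)).const_smul r).deriv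
  have huu : inner ℝ u u = (1 : ℝ) := by rw [real_inner_self_eq_norm_sq, hu]; norm_num
  have hww : inner ℝ w w = (1 : ℝ) := by rw [real_inner_self_eq_norm_sq, hw]; norm_num
  have hwu : inner ℝ w u = (0 : ℝ) := by rw [real_inner_comm, huw]
  have hn : ∀ t, ‖γ t‖ ^ 2 = r ^ 2 := by
    intro t
    rw [← real_inner_self_eq_norm_sq]
    simp only [hγ, inner_smul_left, inner_smul_right, inner_add_left, inner_add_right, huu, hww,
      huw, hwu, conj_trivial]
    linear_combination r ^ 2 * Real.cos_sq_add_sin_sq t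
  have hform : ∀ t, inducedForm c (γ t) (deriv γ t) (deriv γ t) = metA c (r ^ 2) * r ^ 2 := by
    intro t
    have h1 : inner ℝ (γ t) (deriv γ t) = (0 : ℝ) := by
      rw [hd]
      simp only [hγ, inner_smul_left, inner_smul_right, inner_add_left, inner_add_right, huu, hww,
        huw, hwu, conj_trivial]
      ring
    have h2 : inner ℝ (deriv γ t) (deriv γ t) = r ^ 2 := by
      rw [hd]
      simp only [inner_smul_left, inner_smul_right, inner_add_left, inner_add_right, huu, hww,
        huw, hwu, conj_trivial]
      linear_combination r ^ 2 * Real.cos_sq_add_sin_sq t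
    rw [inducedForm_eq, h1, h2, hn]
    ring
  have hsm : ContDiff ℝ 1 γ := by
    have h1 := (Real.contDiff_cos (n := 1)).smul (contDiff_const (c := u))
    have h2 := (Real.contDiff_sin (n := 1)).smul (contDiff_const (c := w))
    exact (contDiff_const (c := r)).smul (h1.add h2)
  refine (riemDist_le_lintegral hc hsm (a := 0) (b := π / 2) (by positivity)
    (fun t ht ↦ ?_) (by simp [hγ, hx]) (by simp [hγ, hy])).trans (le_of_eq ?_)
  · rw [mem_ball_zero_iff, ← abs_norm, ← Real.sqrt_sq_eq_abs, hn, Real.sqrt_sq hr]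
    exact hr'
  · simp only [hform]
    rw [setLIntegral_const, Real.volume_Icc, metA_mul_sq c hr, ← warp, sub_zero,
      ENNReal.ofReal_mul (by positivity), mul_comm]

lemma norm_inv_norm_smul {w : Euc 3} (hw : w ≠ 0) : ‖‖w‖⁻¹ • w‖ = 1 := by
  rw [norm_smul, norm_inv, norm_norm, inv_mul_cancel₀ (norm_ne_zero_iff.2 hw)]

lemma exists_unit_orthogonal (u v : Euc 3) :
    ∃ w : Euc 3, ‖w‖ = 1 ∧ inner ℝ u w = (0 : ℝ) ∧ inner ℝ v w = (0 : ℝ) := by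
  set K := Submodule.span ℝ ({u, v} : Set (Euc 3)) with hK
  have h1 : Module.finrank ℝ K ≤ 2 := by
    refine (finrank_span_le_card ({u, v} : Set (Euc 3))).trans ?_
    rw [Set.toFinset_insert, Set.toFinset_singleton]
    exact Finset.card_le_two
  have h2 : Kᗮ ≠ ⊥ := by
    intro h
    have h3 := K.finrank_add_finrank_orthogonal
    rw [h, finrank_bot, finrank_euclideanSpace, Fintype.card_fin] at h3
    omega
  obtain ⟨w, hw, hw0⟩ := Submodule.exists_mem_ne_zero_of_ne_bot h2
  have h4 := (Submodule.mem_orthogonal K w).1 hw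
  refine ⟨‖w‖⁻¹ • w, norm_inv_norm_smul hw0, ?_, ?_⟩ <;> rw [inner_smul_right]
  · rw [h4 u (Submodule.subset_span (by simp)), mul_zero]
  · rw [h4 v (Submodule.subset_span (by simp)), mul_zero]

lemma exists_eq_norm_smul (v : Euc 3) : ∃ u : Euc 3, ‖u‖ = 1 ∧ v = ‖v‖ • u := by
  rcases eq_or_ne v 0 with rfl | h
  · obtain ⟨w, hw, -⟩ := exists_unit_orthogonal 0 0
    exact ⟨w, hw, by simp⟩
  · have := norm_ne_zero_iff.2 h
    exact ⟨‖v‖⁻¹ • v, norm_inv_norm_smul h, by rw [smul_smul, mul_inv_cancel₀ this, one_smul]⟩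

/-- The point of `PiBall` at the signed distance `r` from the origin in the direction of `u`. -/
def radPoint (u : Euc 3) (hu : ‖u‖ = 1) (r : ℝ) (hr : |r| < π) : PiBall :=
  PiBall.mk (r • u) (by rw [mem_ball_zero_iff, norm_smul, hu, mul_one]; exact hr)

/-- Both points move radially inward to the sphere of radius `r`, which costs at most `arc c π - arc
c r` each. There they are joined by two quarter circles through a direction `w` orthogonal to both,
which exists in dimension three; this treats all angles, antipodal points included, alike. -/
lemma riemDist_le_of_le_norm {r : ℝ} (hr : 0 ≤ r) (hrπ : r < π) {x y : PiBall} (hx : r ≤ ‖x.val‖)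
    (hy : r ≤ ‖y.val‖) : riemDist (ballMetric hc) x y ≤
      ENNReal.ofReal (2 * (arc c π - arc c r) + π * warp c r) := by
  obtain ⟨u, hu, hxu⟩ := exists_eq_norm_smul x.val
  obtain ⟨v, hv, hyv⟩ := exists_eq_norm_smul y.val
  obtain ⟨w, hw, huw, hvw⟩ := exists_unit_orthogonal u v
  have hr' : |r| < π := by rwa [abs_of_nonneg hr]
  have h1 : ∀ (z : PiBall) (e : Euc 3) (he : ‖e‖ = 1), z.val = ‖z.val‖ • e → r ≤ ‖z.val‖ →
      riemDist (ballMetric hc) (radPoint e he r hr') z ≤ ENNReal.ofReal (arc c π - arc c r) := by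
    intro z e he hz hrz
    refine (riemDist_radial_le hc he hrz rfl hz).trans (ENNReal.ofReal_le_ofReal ?_)
    have := (arc_strictMono hc).monotone z.norm_val_lt.le
    linarith
  have h2 := riemDist_quarter_le hc hu hw huw hr (x := radPoint u hu r hr')
    (y := radPoint w hw r hr') rfl rfl
  have h3 := riemDist_quarter_le hc hv hw hvw hr (x := radPoint v hv r hr')
    (y := radPoint w hw r hr') rfl rfl
  rw [riemDist_comm] at h3
  have h4 : 0 ≤ arc c π - arc c r := sub_nonneg.2 ((arc_strictMono hc).monotone hrπ.le)
  have h5 : 0 ≤ π / 2 * warp c r := mul_nonneg (by positivity) (Real.sqrt_nonneg _)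
  have h6 := h1 x u hu hxu hx
  rw [riemDist_comm] at h6
  calc riemDist (ballMetric hc) x y
      ≤ ENNReal.ofReal (arc c π - arc c r) + (ENNReal.ofReal (π / 2 * warp c r) +
        (ENNReal.ofReal (π / 2 * warp c r) + ENNReal.ofReal (arc c π - arc c r))) :=
        (riemDist_triangle _ _ _ _).trans (add_le_add h6 ((riemDist_triangle _ _ _ _).trans
          (add_le_add h2 ((riemDist_triangle _ _ _ _).trans (add_le_add h3 (h1 y v hv hyv hy))))))
    _ = _ := by
        rw [← ENNReal.ofReal_add h5 h4, ← ENNReal.ofReal_add h5 (by positivity),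
          ← ENNReal.ofReal_add h4 (by positivity)]
        ring_nf

lemma riemDist_ballMetric_ne_top (x y : PiBall) : riemDist (ballMetric hc) x y ≠ ⊤ :=
  ((riemDist_le_of_le_norm hc le_rfl Real.pi_pos (norm_nonneg _) (norm_nonneg _)).trans_lt
    ENNReal.ofReal_lt_top).ne

/-- The distance of the ball, as a real number. -/
noncomputable def ballDist (x y : PiBall) : ℝ := (riemDist (ballMetric hc) x y).toReal

lemma ofReal_ballDist (x y : PiBall) :
    ENNReal.ofReal (ballDist hc x y) = riemDist (ballMetric hc) x y :=
  ENNReal.ofReal_toReal (riemDist_ballMetric_ne_top hc x y)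

lemma ballDist_nonneg (x y : PiBall) : 0 ≤ ballDist hc x y := ENNReal.toReal_nonneg

lemma ballDist_comm (x y : PiBall) : ballDist hc x y = ballDist hc y x := by
  rw [ballDist, riemDist_comm, ballDist]

lemma ballDist_triangle (x y z : PiBall) :
    ballDist hc x z ≤ ballDist hc x y + ballDist hc y z := by
  rw [ballDist, ballDist, ballDist, ← ENNReal.toReal_add (riemDist_ballMetric_ne_top hc x y)
    (riemDist_ballMetric_ne_top hc y z)]
  exact ENNReal.toReal_mono (ENNReal.add_ne_top.2 ⟨riemDist_ballMetric_ne_top hc x y,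
    riemDist_ballMetric_ne_top hc y z⟩) (riemDist_triangle _ _ _ _)

lemma ballDist_radial_le {u : Euc 3} (hu : ‖u‖ = 1) {r s : ℝ} (hrs : r ≤ s) {x y : PiBall}
    (hx : x.val = r • u) (hy : y.val = s • u) : ballDist hc x y ≤ arc c s - arc c r :=
  ENNReal.toReal_le_of_le_ofReal (sub_nonneg.2 ((arc_strictMono hc).monotone hrs))
    (riemDist_radial_le hc hu hrs hx hy)

lemma ballDist_le_of_le_norm {r : ℝ} (hr : 0 ≤ r) (hrπ : r < π) {x y : PiBall} (hx : r ≤ ‖x.val‖)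
    (hy : r ≤ ‖y.val‖) : ballDist hc x y ≤ 2 * (arc c π - arc c r) + π * warp c r :=
  ENNReal.toReal_le_of_le_ofReal
    (add_nonneg (mul_nonneg zero_le_two (sub_nonneg.2 ((arc_strictMono hc).monotone hrπ.le)))
      (mul_nonneg Real.pi_pos.le (Real.sqrt_nonneg _)))
    (riemDist_le_of_le_norm hc hr hrπ hx hy)

/-- The spheres collapse because `sin π = 0`. The warping factor is rewritten with `lam`, whose
continuity at `π²` is known. -/
lemma tendsto_diam_bound :
    Tendsto (fun r ↦ 2 * (arc c π - arc c r) + π * warp c r) (𝓝[<] π) (𝓝 0) := by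
  have h1 : ContinuousAt (fun r ↦ lam c (r ^ 2)) π :=
    ContinuousAt.comp (g := lam c) (lam_contDiffAt c (sq_nonneg _)).continuousAt (by fun_prop)
  have h2 : Tendsto (fun r ↦ √(lam c (r ^ 2) * r * sin r / 2)) (𝓝 π) (𝓝 0) := by
    have h3 : ContinuousAt (fun r ↦ √(lam c (r ^ 2) * r * sin r / 2)) π := by fun_prop
    simpa [ContinuousAt] using h3
  have h4 : Tendsto (fun r ↦ π * warp c r) (𝓝[<] π) (𝓝 0) := by
    have h5 := (h2.mono_left (nhdsWithin_le_nhds (s := Iio π))).const_mul (π)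
    rw [mul_zero] at h5
    refine h5.congr' ?_
    filter_upwards [mem_nhdsWithin_of_mem_nhds (lt_mem_nhds Real.pi_pos)] with r hr
    rw [warp, lam_sq_mul c hr.le]
  have h6 : Tendsto (fun r ↦ 2 * (arc c π - arc c r)) (𝓝[<] π) (𝓝 0) := by
    have h7 : Tendsto (fun r ↦ 2 * (arc c π - arc c r)) (𝓝 π) (𝓝 (2 * (arc c π - arc c π))) :=
      (((arc_continuous c).tendsto π).const_sub _).const_mul _
    rw [sub_self, mul_zero] at h7
    exact h7.mono_left nhdsWithin_le_nhds
  simpa using h6.add h4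

end UpperBounds

/-! ### Lower bounds for the distance of the ball -/

section LowerBounds

variable {c : ℝ} (hc : 0 < c)

lemma hasFDerivAt_norm_euc {v : Euc 3} (hv : v ≠ 0) :
    HasFDerivAt (fun v : Euc 3 ↦ ‖v‖) (‖v‖⁻¹ • innerSL ℝ v) v := by
  have h0 : ‖v‖ ≠ 0 := norm_ne_zero_iff.2 hv
  have h := hasFDerivAt_comp_normSq (Real.hasDerivAt_sqrt (pow_ne_zero 2 h0))
  simp only [Real.sqrt_sq (norm_nonneg _)] at h
  refine h.congr_fderiv ?_
  ext a
  simp [two_smul]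
  field_simp
  ring

/-- The function on the ball with radial profile `ψ` and angular factor `⟨v / |v|, e⟩ᵏ`. -/
noncomputable def coneFn (ψ : ℝ → ℝ) (e : Euc 3) (k : ℕ) (v : Euc 3) : ℝ :=
  ψ ‖v‖ * (‖v‖⁻¹ * inner ℝ v e) ^ k

/-- The angular factor is singular at the origin; a profile vanishing near zero hides this. -/
lemma coneFn_contDiff {ψ : ℝ → ℝ} (hψ : ContDiff ℝ 1 ψ) {δ : ℝ} (hδ : 0 < δ)
    (h0 : ∀ t < δ, ψ t = 0) (e : Euc 3) (k : ℕ) : ContDiff ℝ 1 (coneFn ψ e k) := by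
  rw [contDiff_iff_contDiffAt]
  intro v
  rcases eq_or_ne v 0 with rfl | hv
  · have h1 : coneFn ψ e k =ᶠ[𝓝 0] fun _ ↦ 0 := by
      filter_upwards [Metric.ball_mem_nhds (0 : Euc 3) hδ] with v hv
      rw [coneFn, h0 _ (mem_ball_zero_iff.1 hv), zero_mul]
    exact contDiffAt_const.congr_of_eventuallyEq h1
  · have h1 : ContDiffAt ℝ 1 (fun v : Euc 3 ↦ ‖v‖) v := contDiffAt_norm ℝ hv
    have h2 : ContDiffAt ℝ 1 (fun v : Euc 3 ↦ inner ℝ v e) v :=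
      contDiffAt_id.inner ℝ contDiffAt_const
    exact (hψ.contDiffAt.comp v h1).mul (((h1.inv (norm_ne_zero_iff.2 hv)).mul h2).pow k)

lemma fderiv_coneFn {ψ : ℝ → ℝ} (hψ : ContDiff ℝ 1 ψ) (e : Euc 3) (k : ℕ) {v : Euc 3} (hv : v ≠ 0)
    (a : Euc 3) : fderiv ℝ (coneFn ψ e k) v a =
      deriv ψ ‖v‖ * (‖v‖⁻¹ * inner ℝ v a) * (‖v‖⁻¹ * inner ℝ v e) ^ k +
      ψ ‖v‖ * (k * (‖v‖⁻¹ * inner ℝ v e) ^ (k - 1) *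
        (‖v‖⁻¹ * inner ℝ (a - (‖v‖⁻¹ * inner ℝ v a) • (‖v‖⁻¹ • v)) e)) := by
  have h0 : ‖v‖ ≠ 0 := norm_ne_zero_iff.2 hv
  have h1 := hasFDerivAt_norm_euc hv
  have h2 : HasFDerivAt (fun v : Euc 3 ↦ ψ ‖v‖) (deriv ψ ‖v‖ • (‖v‖⁻¹ • innerSL ℝ v)) v :=
    (hψ.differentiable one_ne_zero ‖v‖).hasDerivAt.comp_hasFDerivAt v h1
  have h3 : HasFDerivAt (fun v : Euc 3 ↦ ‖v‖⁻¹) ((-(‖v‖ ^ 2)⁻¹) • (‖v‖⁻¹ • innerSL ℝ v)) v :=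
    (hasDerivAt_inv h0).comp_hasFDerivAt v h1
  have h4 : HasFDerivAt (fun v : Euc 3 ↦ inner ℝ v e) (innerSL ℝ e) v :=
    ((innerSL ℝ e).hasFDerivAt (x := v)).congr_of_eventuallyEq
      (Eventually.of_forall fun y ↦ real_inner_comm _ _)
  have h5 := h2.mul ((h3.mul h4).pow k)
  refine (congrArg (fun l ↦ l a) h5.fderiv).trans ?_
  simp only [add_apply, smul_apply, innerSL_apply_apply,
    smul_eq_mul, inner_sub_left, inner_smul_left, conj_trivial, nsmul_eq_mul,
    real_inner_comm a e, Pi.mul_apply]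
  field_simp
  ring

/-- With `s` and `p` the radial component and the tangential part of `a`, the form is `metA |p|² +
(radSpeed s)²`. So `√(g(a, a))` dominates both `radSpeed |s|` and `(warp / r) |p|`, which control
the derivatives of the radial profile and of the angular factor respectively. -/
lemma abs_fderiv_coneFn_le {c : ℝ} (hc : 0 < c) {ψ : ℝ → ℝ} (hψ : ContDiff ℝ 1 ψ)
    {e : Euc 3} (he : ‖e‖ ≤ 1) (k : ℕ)
    {v : Euc 3} (hv : v ≠ 0) (hvπ : ‖v‖ < π) (a : Euc 3) :
    |fderiv ℝ (coneFn ψ e k) v a| ≤ (|deriv ψ ‖v‖| / radSpeed c ‖v‖ + k * |ψ ‖v‖| / warp c ‖v‖) *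
      √(inducedForm c v a a) := by
  have hr : 0 < ‖v‖ := norm_pos_iff.2 hv
  set r := ‖v‖ with hr_def
  set s := r⁻¹ * inner ℝ v a with hs
  set N := r⁻¹ * inner ℝ v e with hN
  set p := a - s • (r⁻¹ • v) with hp
  have hN1 : |N| ≤ 1 := by
    rw [hN, abs_mul, abs_inv, abs_of_pos hr, inv_mul_le_iff₀ hr]
    calc |inner ℝ v e| ≤ ‖v‖ * ‖e‖ := abs_real_inner_le_norm v e
      _ ≤ r * 1 := mul_le_mul_of_nonneg_left he hr.le
  have hA : 0 < metA c (r ^ 2) := metA_pos hc (by rwa [abs_of_pos hr])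
  have hsp := radSpeed_pos hc r
  have hp2 : ‖p‖ ^ 2 = ‖a‖ ^ 2 - s ^ 2 := by
    rw [hp, norm_sub_sq_real, inner_smul_right, inner_smul_right, norm_smul, norm_smul, norm_inv,
      norm_norm, ← hr_def, inv_mul_cancel₀ hr.ne', mul_one, Real.norm_eq_abs, sq_abs,
      real_inner_comm, ← hs]
    ring
  have hform : inducedForm c v a a = metA c (r ^ 2) * ‖p‖ ^ 2 + (radSpeed c r * s) ^ 2 := by
    have h1 := sq_mul_inducedForm c v a
    have h2 : inner ℝ v a = r * s := by rw [hs]; field_simp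
    rw [← hr_def, h2] at h1
    refine mul_left_cancel₀ (pow_ne_zero 2 hr.ne') (h1.trans ?_)
    rw [hp2, mul_pow (radSpeed c r), radSpeed_sq hc (by rw [abs_of_pos hr]; exact hvπ.le)]
    ring
  have hwarp : warp c r = √(metA c (r ^ 2)) * r := warp_eq c hr.le
  have hsA := Real.sqrt_pos.2 hA
  have hg1 : radSpeed c r * |s| ≤ √(inducedForm c v a a) := by
    refine Real.le_sqrt_of_sq_le ?_
    rw [hform, mul_pow, sq_abs, mul_pow]
    have := mul_nonneg hA.le (sq_nonneg ‖p‖)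
    linarith
  have hg2 : √(metA c (r ^ 2)) * ‖p‖ ≤ √(inducedForm c v a a) := by
    refine Real.le_sqrt_of_sq_le ?_
    rw [hform, mul_pow, Real.sq_sqrt hA.le]
    have := sq_nonneg (radSpeed c r * s)
    linarith
  have hpe : |inner ℝ p e| ≤ ‖p‖ := (abs_real_inner_le_norm p e).trans
    (mul_le_of_le_one_right (norm_nonneg p) he)
  rw [fderiv_coneFn hψ e k hv]
  calc |deriv ψ r * s * N ^ k + ψ r * (k * N ^ (k - 1) * (r⁻¹ * inner ℝ p e))|
      ≤ |deriv ψ r| * |s| * |N| ^ k + |ψ r| * (k * |N| ^ (k - 1) * (r⁻¹ * |inner ℝ p e|)) := by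
        refine (abs_add_le _ _).trans (le_of_eq ?_)
        simp only [abs_mul, abs_pow, abs_inv, abs_of_pos hr, Nat.abs_cast]
    _ ≤ |deriv ψ r| * |s| * 1 + |ψ r| * (k * 1 * (r⁻¹ * ‖p‖)) := by
        gcongr
        · exact pow_le_one₀ (abs_nonneg _) hN1
        · exact pow_le_one₀ (abs_nonneg _) hN1
    _ = |deriv ψ r| / radSpeed c r * (radSpeed c r * |s|) +
        k * |ψ r| / warp c r * (√(metA c (r ^ 2)) * ‖p‖) := by
        rw [hwarp]; field_simp
    _ ≤ _ := by
        rw [add_mul]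
        have h1 : 0 ≤ warp c r := Real.sqrt_nonneg _
        gcongr

lemma abs_coneFn_sub_le {ψ : ℝ → ℝ} (hψ : ContDiff ℝ 1 ψ) {δ : ℝ} (hδ : 0 < δ)
    (h0 : ∀ t < δ, ψ t = 0) {e : Euc 3} (he : ‖e‖ ≤ 1) (k : ℕ) {K : ℝ} (hK : 0 < K)
    (h : ∀ t ∈ Ioo 0 π, |deriv ψ t| / radSpeed c t + k * |ψ t| / warp c t ≤ K) (x y : PiBall) :
    |coneFn ψ e k x.val - coneFn ψ e k y.val| ≤ K * ballDist hc x y := by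
  have h1 := abs_sub_le_mul_riemDist hc (coneFn_contDiff hψ hδ h0 e k).contDiffOn hK
    (fun v hv a ↦ ?_) x y
  · rw [← ofReal_ballDist, ← ENNReal.ofReal_mul hK.le] at h1
    exact (ENNReal.ofReal_le_ofReal_iff (mul_nonneg hK.le (ballDist_nonneg hc x y))).1 h1
  · rcases eq_or_ne v 0 with rfl | hv0
    · have h2 : coneFn ψ e k =ᶠ[𝓝 0] fun _ ↦ 0 := by
        filter_upwards [Metric.ball_mem_nhds (0 : Euc 3) hδ] with v hv
        rw [coneFn, h0 _ (mem_ball_zero_iff.1 hv), zero_mul]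
      rw [h2.fderiv_eq]
      simp only [fderiv_fun_const, Pi.zero_apply, zero_apply, abs_zero]
      positivity
    · have hv' := mem_ball_zero_iff.1 hv
      refine (abs_fderiv_coneFn_le hc hψ he k hv0 hv' a).trans ?_
      exact mul_le_mul_of_nonneg_right (h _ ⟨norm_pos_iff.2 hv0, hv'⟩) (Real.sqrt_nonneg _)

lemma arc_sub_le_ballDist_of_pos {x y : PiBall} (hx : 0 < ‖x.val‖) (hxy : ‖x.val‖ ≤ ‖y.val‖) :
    arc c ‖y.val‖ - arc c ‖x.val‖ ≤ ballDist hc x y := by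
  set δ := ‖x.val‖ / 2 with hδ
  have hδ0 : 0 < δ := by positivity
  -- Cutoff equal to `0` for `t ≤ δ` and to `1` for `t ≥ 2 δ = |x|`. The resulting `ψ` vanishes near
  -- the origin and differs from arc length by a constant beyond `|x|`.
  set χ : ℝ → ℝ := fun t ↦ Real.smoothTransition (t / δ - 1) with hχ
  have hχc : Continuous χ := Real.smoothTransition.continuous.comp (by fun_prop)
  have hcont : Continuous fun t ↦ χ t * radSpeed c t := hχc.mul (radSpeed_continuous c)
  set ψ : ℝ → ℝ := fun r ↦ ∫ t in δ..r, χ t * radSpeed c t with hψ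
  have hd : ∀ r, HasDerivAt ψ (χ r * radSpeed c r) r := fun r ↦
    intervalIntegral.integral_hasDerivAt_right (hcont.intervalIntegrable _ _)
      (hcont.stronglyMeasurableAtFilter _ _) hcont.continuousAt
  have hderiv : deriv ψ = fun t ↦ χ t * radSpeed c t := funext fun r ↦ (hd r).deriv
  have hC1 : ContDiff ℝ 1 ψ :=
    contDiff_one_iff_deriv.2 ⟨fun r ↦ (hd r).differentiableAt, by rw [hderiv]; exact hcont⟩
  have h0 : ∀ t < δ, ψ t = 0 := by
    intro t ht
    refine intervalIntegral.integral_zero_ae (Eventually.of_forall fun s hs ↦ ?_)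
    rw [uIoc_of_ge ht.le] at hs
    have : s / δ - 1 ≤ 0 := by rw [sub_nonpos, div_le_one hδ0]; exact hs.2
    rw [hχ]
    simp only [Real.smoothTransition.zero_of_nonpos this, zero_mul]
  -- With exponent `k = 0` the angular factor is `1`, even for `e = 0`, and the test function is
  -- purely radial.
  have h1 := abs_coneFn_sub_le hc hC1 hδ0 h0 (e := 0) (by simp) 0 one_pos (fun t _ ↦ ?_) x y
  · have h2 : coneFn ψ 0 0 y.val - coneFn ψ 0 0 x.val = arc c ‖y.val‖ - arc c ‖x.val‖ := by
      simp only [coneFn, pow_zero, mul_one, hψ, arc]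
      rw [intervalIntegral.integral_interval_sub_left (hcont.intervalIntegrable _ _)
        (hcont.intervalIntegrable _ _), intervalIntegral.integral_interval_sub_left
        ((radSpeed_continuous c).intervalIntegrable _ _)
        ((radSpeed_continuous c).intervalIntegrable _ _)]
      refine intervalIntegral.integral_congr fun t ht ↦ ?_
      rw [uIcc_of_le hxy] at ht
      have : 1 ≤ t / δ - 1 := by
        rw [le_sub_iff_add_le, le_div_iff₀ hδ0]; linarith [ht.1]
      simp only [hχ, Real.smoothTransition.one_of_one_le this, one_mul]
    rw [← h2]
    rw [abs_sub_comm, one_mul] at h1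
    exact (le_abs_self _).trans h1
  · have hsp := radSpeed_pos hc t
    rw [hderiv, abs_mul, abs_of_pos hsp, mul_div_cancel_right₀ _ hsp.ne',
      abs_of_nonneg (Real.smoothTransition.nonneg _)]
    simpa using Real.smoothTransition.le_one _

lemma arc_sub_le_ballDist {x y : PiBall} (hxy : ‖x.val‖ ≤ ‖y.val‖) :
    arc c ‖y.val‖ - arc c ‖x.val‖ ≤ ballDist hc x y := by
  rcases (norm_nonneg x.val).eq_or_lt with hx | hx
  · rw [← hx, arc_zero, sub_zero]
    rcases (norm_nonneg y.val).eq_or_lt with hy | hy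
    · rw [← hy, arc_zero]; exact ballDist_nonneg hc x y
    obtain ⟨u, hu, hyu⟩ := exists_eq_norm_smul y.val
    -- The origin is replaced by a point at radius `r` on the ray of `y`. Leaving the origin and
    -- shortening the ray each lose `arc c r`, which tends to zero with `r`.
    have h1 : ∀ r ∈ Ioo 0 ‖y.val‖, arc c ‖y.val‖ - 2 * arc c r ≤ ballDist hc x y := by
      intro r hr
      have hrπ : |r| < π := by rw [abs_of_pos hr.1]; exact hr.2.trans y.norm_val_lt
      have hn : ‖(radPoint u hu r hrπ).val‖ = r := by
        rw [radPoint, PiBall.val_mk, norm_smul, hu, mul_one, Real.norm_of_nonneg hr.1.le]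
      have h2 := arc_sub_le_ballDist_of_pos hc (x := radPoint u hu r hrπ) (y := y)
        (hn.symm ▸ hr.1) (hn.symm ▸ hr.2.le)
      have h3 := ballDist_radial_le hc hu hr.1.le (x := x) (y := radPoint u hu r hrπ)
        (by rw [zero_smul]; exact norm_eq_zero.1 hx.symm) rfl
      rw [hn] at h2
      rw [arc_zero, ballDist_comm] at h3
      have h4 := ballDist_triangle hc (radPoint u hu r hrπ) x y
      linarith
    have h2 : Tendsto (fun r ↦ arc c ‖y.val‖ - 2 * arc c r) (𝓝[>] 0)
        (𝓝 (arc c ‖y.val‖ - 2 * arc c 0)) :=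
      ((((arc_continuous c).tendsto 0).const_mul 2).const_sub _).mono_left nhdsWithin_le_nhds
    rw [arc_zero, mul_zero, sub_zero] at h2
    refine le_of_tendsto h2 ?_
    filter_upwards [Ioo_mem_nhdsGT hy] with r hr using h1 r hr
  · exact arc_sub_le_ballDist_of_pos hc hx hxy

end LowerBounds

/-! ### Completions with one additional point -/

section OnePointCompletion

variable {X : Type*} [MetricSpace X]

open UniformSpace

/-- If the complements of the compact sets have arbitrarily small diameter, the completion of a
noncompact locally compact metric space has one additional point. -/
lemma exists_completion_point [NoncompactSpace X] [WeaklyLocallyCompactSpace X]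
    (h : ∀ ε > 0, ∃ K : Set X, IsCompact K ∧ ∀ x ∉ K, ∀ y ∉ K, dist x y < ε) :
    ∃ pt : Completion X, Tendsto (fun x : X ↦ (x : Completion X)) (cocompact X) (𝓝 pt) ∧
      ∀ y : Completion X, y ≠ pt ↔ ∃ x : X, (x : Completion X) = y := by
  -- The new point is the limit of the filter of complements of compact sets.
  have hC : Cauchy (cocompact X) := by
    refine Metric.cauchy_iff.2 ⟨inferInstance, fun ε hε ↦ ?_⟩
    obtain ⟨K, hK, hd⟩ := h ε hε
    exact ⟨Kᶜ, hK.compl_mem_cocompact, hd⟩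
  obtain ⟨pt, hpt⟩ := CompleteSpace.complete (hC.map (Completion.uniformContinuous_coe X))
  have hpt' : Tendsto (fun x : X ↦ (x : Completion X)) (cocompact X) (𝓝 pt) := hpt
  refine ⟨pt, hpt', fun y ↦ ⟨fun hy ↦ ?_, ?_⟩⟩
  -- A point `y ≠ pt` has a neighbourhood meeting `X` only inside a compact set `K`. By density `y`
  -- lies in the closure of the image of `K`, which is already closed.
  · obtain ⟨U, V, hU, hV, hUV⟩ := t2_separation_nhds hy
    have hV' := hpt' hV
    obtain ⟨K, hK, hKV⟩ := mem_cocompact.1 hV'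
    have hKy : y ∈ closure ((fun x : X ↦ (x : Completion X)) '' K) := by
      rw [mem_closure_iff_nhds]
      intro t ht
      obtain ⟨z, ⟨hzt, hzU⟩, x, rfl⟩ := mem_closure_iff_nhds.1 (Completion.denseRange_coe y) _
        (inter_mem ht hU)
      refine ⟨_, hzt, x, ?_, rfl⟩
      by_contra hx
      exact disjoint_left.1 hUV hzU (hKV hx)
    rw [(hK.image (Completion.continuous_coe X)).isClosed.closure_eq] at hKy
    obtain ⟨x, -, hx⟩ := hKy
    exact ⟨x, hx⟩
  · rintro ⟨x, rfl⟩ hx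
    -- If `pt` were the image of `x`, a compact neighbourhood of `x` would belong to the cocompact
    -- filter, against noncompactness.
    obtain ⟨K, hK, hKx⟩ := exists_compact_mem_nhds x
    have h1 : comap (fun x : X ↦ (x : Completion X)) (𝓝 (x : Completion X)) = 𝓝 x :=
      (Completion.isUniformInducing_coe X).isInducing.nhds_eq_comap x |>.symm
    have h2 : cocompact X ≤ 𝓝 x := by
      rw [← h1, ← tendsto_iff_comap, hx]
      exact hpt'
    have h3 : K ∩ Kᶜ ∈ cocompact X := inter_mem (h2 hKx) hK.compl_mem_cocompact
    rw [inter_compl_self] at h3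
    exact (NeBot.ne inferInstance : cocompact X ≠ ⊥) (empty_mem_iff_bot.1 h3)

/-- The completion of a metric space with one additional point is the one-point
compactification. -/
lemma exists_onePoint_homeomorph_completion {pt : Completion X}
    (hpt : Tendsto (fun x : X ↦ (x : Completion X)) (cocompact X) (𝓝 pt))
    (h : ∀ y : Completion X, y ≠ pt ↔ ∃ x : X, (x : Completion X) = y) :
    ∃ e : OnePoint X ≃ₜ Completion X, e OnePoint.infty = pt ∧
      ∀ x : X, e (x : OnePoint X) = (x : Completion X) := by
  let f : OnePoint X → Completion X := fun a ↦ a.elim pt (fun x : X ↦ (x : Completion X))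
  have hf : Continuous f := by
    rw [OnePoint.continuous_iff]
    refine ⟨?_, Completion.continuous_coe X⟩
    rw [coclosedCompact_eq_cocompact]
    exact hpt
  have hinj : Function.Injective f := by
    intro a b hab
    induction a with
    | infty =>
      induction b with
      | infty => rfl
      | coe b => exact absurd hab.symm ((h _).2 ⟨b, rfl⟩)
    | coe a =>
      induction b with
      | infty => exact absurd hab ((h _).2 ⟨a, rfl⟩)
      | coe b => exact congrArg _ (Completion.coe_injective X hab)
  have hsurj : Function.Surjective f := by
    intro y
    by_cases hy : y = pt
    · exact ⟨OnePoint.infty, hy.symm⟩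
    · obtain ⟨x, hx⟩ := (h y).1 hy
      exact ⟨x, hx⟩
  exact ⟨hf.homeoOfEquivCompactToT2 (f := Equiv.ofBijective f ⟨hinj, hsurj⟩), rfl, fun x ↦ rfl⟩

end OnePointCompletion

/-! ### The ball as a metric space -/

section BallMetricSpace

namespace PiBall

instance : T3Space PiBall := inferInstanceAs (T3Space ballOpens)

lemma isCompact_norm_le {r : ℝ} (hr : r < π) : IsCompact {x : PiBall | ‖x.val‖ ≤ r} := by
  refine (PiBall.isOpenEmbedding_val.isInducing.isCompact_iff).2 ?_
  have h : PiBall.val '' {x | ‖x.val‖ ≤ r} = Metric.closedBall 0 r := by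
    ext v
    refine ⟨?_, fun hv ↦ ?_⟩
    · rintro ⟨x, hx, rfl⟩
      exact mem_closedBall_zero_iff.2 hx
    · have hv' := mem_closedBall_zero_iff.1 hv
      exact ⟨mk v (mem_ball_zero_iff.2 (hv'.trans_lt hr)), hv', rfl⟩
  rw [h]
  exact isCompact_closedBall 0 r

lemma nonempty_homeomorph : Nonempty (PiBall ≃ₜ Euc 3) := by
  let e := OpenPartialHomeomorph.univBall (0 : Euc 3) π
  have h1 : e.target = ballOpens := OpenPartialHomeomorph.univBall_target 0 Real.pi_pos
  have h2 : e.source = univ := OpenPartialHomeomorph.univBall_source 0 (π)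
  exact ⟨(Homeomorph.setCongr h1.symm).trans (e.toHomeomorphSourceTarget.symm.trans
    ((Homeomorph.setCongr h2).trans (Homeomorph.Set.univ _)))⟩

lemma nonempty_onePoint_homeomorph_sphere :
    Nonempty (OnePoint PiBall ≃ₜ Metric.sphere (0 : Euc 4) 1) := by
  obtain ⟨e⟩ := nonempty_homeomorph
  exact ⟨e.onePointCongr.trans (onePointEquivSphereOfFinrankEq (ι := Fin 4) (V := Euc 3) (by simp))⟩

instance : NoncompactSpace PiBall := by
  obtain ⟨e⟩ := nonempty_homeomorph
  refine not_compactSpace_iff.1 fun h ↦ ?_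
  exact not_compactSpace_iff.2 (inferInstance : NoncompactSpace (Euc 3)) e.compactSpace

instance : LocallyCompactSpace PiBall := PiBall.isOpenEmbedding_val.locallyCompactSpace

end PiBall

variable {c : ℝ} (hc : 0 < c)

lemma isContinuousRiemannianBundle {n : ℕ} {M : Type*} [TopologicalSpace M]
    [ChartedSpace (Euc n) M] [IsManifold (𝓡 n) ∞ M]
    (G : ContMDiffRiemannianMetric (𝓡 n) ∞ (Euc n) (fun x : M ↦ TangentSpace (𝓡 n) x)) :
    letI : RiemannianBundle (fun x : M ↦ TangentSpace (𝓡 n) x) := ⟨G.toRiemannianMetric⟩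
    IsContinuousRiemannianBundle (Euc n) (fun x : M ↦ TangentSpace (𝓡 n) x) :=
  letI : RiemannianBundle (fun x : M ↦ TangentSpace (𝓡 n) x) := ⟨G.toRiemannianMetric⟩
  ⟨⟨G.inner, G.contMDiff.continuous, fun _ _ _ ↦ rfl⟩⟩

/-- The ball with the Riemannian distance. -/
@[reducible] noncomputable def ballMetricSpace : MetricSpace PiBall :=
  letI : RiemannianBundle (fun x : PiBall ↦ TangentSpace (𝓡 3) x) :=
    ⟨(ballMetric hc).toRiemannianMetric⟩
  haveI := isContinuousRiemannianBundle (ballMetric hc)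
  letI : EMetricSpace PiBall := EMetricSpace.ofRiemannianMetric (𝓡 3) PiBall
  EMetricSpace.toMetricSpace (riemDist_ballMetric_ne_top hc)

lemma ballMetricSpace_topology :
    (ballMetricSpace hc).toUniformSpace.toTopologicalSpace = PiBall.topology := rfl

lemma PiBall.eventually_lt_norm {r : ℝ} (hr : r < π) :
    ∀ᶠ x : PiBall in cocompact PiBall, r < ‖x.val‖ := by
  filter_upwards [(PiBall.isCompact_norm_le hr).compl_mem_cocompact] with x hx
  exact not_le.1 hx

lemma exists_ball_completion_point :
    letI := ballMetricSpace hc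
    ∃ pt : UniformSpace.Completion PiBall,
      Tendsto (fun x : PiBall ↦ (x : UniformSpace.Completion PiBall)) (cocompact PiBall) (𝓝 pt) ∧
      ∀ y : UniformSpace.Completion PiBall,
        y ≠ pt ↔ ∃ x : PiBall, (x : UniformSpace.Completion PiBall) = y := by
  let _ := ballMetricSpace hc
  refine exists_completion_point fun ε hε ↦ ?_
  obtain ⟨r, ⟨hr, hr0⟩, hrπ⟩ := (((tendsto_diam_bound (c := c)).eventually_lt_const hε).and
    ((eventually_ge_nhds Real.pi_pos).filter_mono nhdsWithin_le_nhds)).and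
    self_mem_nhdsWithin |>.exists
  refine ⟨_, PiBall.isCompact_norm_le hrπ, fun x hx y hy ↦ ?_⟩
  exact (ballDist_le_of_le_norm hc hr0 hrπ (not_le.1 hx).le (not_le.1 hy).le).trans_lt hr

/-- The distance to `pt` is the limit of `ballDist x y` as `y` leaves every compact set. From above,
follow the ray of `x` to radius `r` and use the diameter bound beyond `r`; from below, distances
dominate differences of radial arc length. -/
lemma dist_completion_point {pt : letI := ballMetricSpace hc; UniformSpace.Completion PiBall}
    (hpt : letI := ballMetricSpace hc;
      Tendsto (fun x : PiBall ↦ (x : UniformSpace.Completion PiBall)) (cocompact PiBall) (𝓝 pt))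
    (x : PiBall) :
    letI := ballMetricSpace hc
    dist (x : UniformSpace.Completion PiBall) pt = arc c (π) - arc c ‖x.val‖ := by
  let _ := ballMetricSpace hc
  have hlim : ∀ x : PiBall, Tendsto (fun y : PiBall ↦ ballDist hc x y) (cocompact PiBall)
      (𝓝 (dist (x : UniformSpace.Completion PiBall) pt)) := fun x ↦
    (tendsto_const_nhds.dist hpt).congr fun y ↦ UniformSpace.Completion.dist_eq x y
  have hnorm : Tendsto (fun y : PiBall ↦ ‖y.val‖) (cocompact PiBall) (𝓝 π) := by
    refine tendsto_order.2 ⟨fun r hr ↦ PiBall.eventually_lt_norm hr, fun r hr ↦ ?_⟩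
    exact Eventually.of_forall fun y ↦ y.norm_val_lt.trans hr
  have hbound : ∀ r, 0 ≤ r → r < π → ∀ y : PiBall, r ≤ ‖y.val‖ →
      dist (y : UniformSpace.Completion PiBall) pt ≤ 2 * (arc c π - arc c r) + π * warp c r := by
    intro r hr hrπ y hy
    refine le_of_tendsto (hlim y) ?_
    filter_upwards [PiBall.eventually_lt_norm hrπ] with z hz
    exact ballDist_le_of_le_norm hc hr hrπ hy hz.le
  refine le_antisymm ?_ ?_
  · have h1 : Tendsto (fun r ↦ (arc c r - arc c ‖x.val‖) +
        (2 * (arc c π - arc c r) + π * warp c r)) (𝓝[<] π) (𝓝 (arc c π - arc c ‖x.val‖)) := by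
      have h2 := (((arc_continuous c).tendsto (π)).mono_left
        (nhdsWithin_le_nhds (s := Iio (π)))).sub_const (arc c ‖x.val‖)
      simpa using h2.add (tendsto_diam_bound (c := c))
    refine ge_of_tendsto h1 ?_
    filter_upwards [self_mem_nhdsWithin,
      (eventually_ge_nhds x.norm_val_lt).filter_mono nhdsWithin_le_nhds] with r hrπ hr
    have hr0 : 0 ≤ r := (norm_nonneg _).trans hr
    obtain ⟨u, hu, hx⟩ := exists_eq_norm_smul x.val
    have hy : ‖(radPoint u hu r (by rwa [abs_of_nonneg hr0])).val‖ = r := by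
      rw [radPoint, PiBall.val_mk, norm_smul, hu, mul_one, Real.norm_eq_abs, abs_of_nonneg hr0]
    refine (dist_triangle _ ((radPoint u hu r (by rwa [abs_of_nonneg hr0]) : PiBall) :
      UniformSpace.Completion PiBall) _).trans (add_le_add ?_ (hbound r hr0 hrπ _ hy.ge))
    rw [UniformSpace.Completion.dist_eq]
    exact ballDist_radial_le hc hu hr hx rfl
  · have h1 := ((arc_continuous c).tendsto (π)).comp hnorm
    refine le_of_tendsto_of_tendsto (h1.sub_const _) (hlim x) ?_
    filter_upwards [PiBall.eventually_lt_norm x.norm_val_lt] with y hy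
    exact arc_sub_le_ballDist hc hy.le

end BallMetricSpace

/-! ### Riemannian distances near a point -/

section LocalComparison

open scoped NNReal

attribute [local instance] normedAddCommGroupTangentSpaceVectorSpace
attribute [local instance] normedSpaceTangentSpaceVectorSpace

variable {E : Type*} [NormedAddCommGroup E] [NormedSpace ℝ E] {H : Type*} [TopologicalSpace H]
  (I : ModelWithCorners ℝ E H) {M : Type*} [TopologicalSpace M] [ChartedSpace H M]
  [RiemannianBundle (fun x : M ↦ TangentSpace I x)] [IsManifold I 1 M]
  [IsContinuousRiemannianBundle E (fun x : M ↦ TangentSpace I x)]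

/-- Near a point, the Riemannian distance is bounded above by the distance in the chart. -/
lemma exists_riemannianEDist_le_edist_extChartAt (x : M) :
    ∃ C > (0 : ℝ≥0), ∃ s ∈ 𝓝 x, ∀ y ∈ s, ∀ z ∈ s,
    riemannianEDist I y z ≤ C * edist (extChartAt I x y) (extChartAt I x z) := by
  rcases eventually_enorm_mfderivWithin_symm_extChartAt_lt I x with ⟨C, C_pos, hC'⟩
  have hC : ∀ᶠ y in 𝓝[range I] (extChartAt I x x), ∀ v : TangentSpace 𝓘(ℝ, E) y,
      ‖mfderivWithin 𝓘(ℝ, E) I (extChartAt I x).symm (range I) y v‖ₑ ≤ C * @enorm E _ v :=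
    hC'.mono fun y hy v ↦ (ContinuousLinearMap.le_opENorm _ v).trans (mul_le_mul_left hy.le _)
  obtain ⟨r, r_pos, hr⟩ : ∃ r > 0,
      Metric.ball (extChartAt I x x) r ∩ range I ⊆ (extChartAt I x).target ∩
        {y | ∀ v : TangentSpace 𝓘(ℝ, E) y,
          ‖mfderivWithin 𝓘(ℝ, E) I (extChartAt I x).symm (range I) y v‖ₑ ≤ C * @enorm E _ v} :=
    Metric.mem_nhdsWithin_iff.1 (inter_mem (extChartAt_target_mem_nhdsWithin x) hC)
  have A : (extChartAt I x) ⁻¹' (Metric.ball (extChartAt I x x) r ∩ range I) ∈ 𝓝 x := by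
    apply extChartAt_preimage_mem_nhds_of_mem_nhdsWithin (by simp)
    rw [inter_comm]
    exact inter_mem_nhdsWithin _ (Metric.ball_mem_nhds _ r_pos)
  refine ⟨C, C_pos, _, inter_mem A (chart_source_mem_nhds H x), ?_⟩
  rintro y ⟨hy, h'y⟩ z ⟨hz, h'z⟩
  -- The competing curve is the preimage of a segment. By convexity it stays where the derivative of
  -- the inverse chart is bounded by `C`.
  let η := ContinuousAffineMap.lineMap (R := ℝ) (extChartAt I x y) (extChartAt I x z)
  set γ := (extChartAt I x).symm ∘ η
  have hη : Icc 0 1 ⊆ ⇑η ⁻¹' ((extChartAt I x).target ∩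
        {y | ∀ v : TangentSpace 𝓘(ℝ, E) y,
          ‖mfderivWithin 𝓘(ℝ, E) I (extChartAt I x).symm (range I) y v‖ₑ ≤ C * @enorm E _ v}) := by
    simp only [← image_subset_iff, ContinuousAffineMap.coe_lineMap_eq,
     ← segment_eq_image_lineMap, η]
    exact Subset.trans (((convex_ball _ _).inter I.convex_range).segment_subset hy hz) hr
  simp only [preimage_inter, subset_inter_iff] at hη
  have η_smooth : ContMDiffOn 𝓘(ℝ, ℝ) 𝓘(ℝ, E) 1 η (Icc 0 1) := by
    apply ContMDiff.contMDiffOn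
    rw [contMDiff_iff_contDiff]
    exact ContinuousAffineMap.contDiff _
  have : riemannianEDist I y z ≤ pathELength I γ 0 1 := by
    apply riemannianEDist_le_pathELength _ _ _ zero_le_one
    · exact (contMDiffOn_extChartAt_symm x).comp η_smooth hη.1
    · simp [γ, η, ContinuousAffineMap.coe_lineMap_eq, h'y]
    · simp [γ, η, ContinuousAffineMap.coe_lineMap_eq, h'z]
  apply this.trans
  rw [← lintegral_fderiv_lineMap_eq_edist, pathELength_eq_lintegral_mfderivWithin_Icc,
    ← lintegral_const_mul' _ _ ENNReal.coe_ne_top]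
  apply setLIntegral_mono' measurableSet_Icc (fun t ht ↦ ?_)
  have : mfderivWithin 𝓘(ℝ, ℝ) I γ (Icc 0 1) t =
      (mfderivWithin 𝓘(ℝ, E) I (extChartAt I x).symm (range I) (η t)) ∘L
        (mfderivWithin 𝓘(ℝ, ℝ) 𝓘(ℝ, E) η (Icc 0 1) t) := by
    apply mfderivWithin_comp
    · exact mdifferentiableWithinAt_extChartAt_symm (hη.1 ht)
    · exact η_smooth.mdifferentiableOn one_ne_zero t ht
    · exact hη.1.trans (preimage_mono (extChartAt_target_subset_range x))
    · rw [uniqueMDiffWithinAt_iff_uniqueDiffWithinAt]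
      exact uniqueDiffOn_Icc zero_lt_one t ht
  have : mfderivWithin 𝓘(ℝ, ℝ) I γ (Icc 0 1) t 1 =
      (mfderivWithin 𝓘(ℝ, E) I (extChartAt I x).symm (range I) (η t))
        (mfderivWithin 𝓘(ℝ, ℝ) 𝓘(ℝ, E) η (Icc 0 1) t 1) := congrArg (fun l ↦ l 1) this
  rw [this]
  refine (hη.2 ht _).trans (le_of_eq ?_)
  rw [mfderivWithin_eq_fderivWithin]
  rfl

/-- Near a point, the distance in the chart to this point is bounded above by the Riemannian
distance. -/
lemma exists_edist_extChartAt_le_riemannianEDist [RegularSpace M] (x : M) :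
    ∃ C > (0 : ℝ≥0), ∃ s ∈ 𝓝 x, ∀ y ∈ s,
    edist (extChartAt I x x) (extChartAt I x y) ≤ C * riemannianEDist I x y := by
  rcases eventually_enorm_mfderiv_extChartAt_lt I x with ⟨C, C_pos, hC⟩
  obtain ⟨s, hs, hso, hxs⟩ := mem_nhds_iff.1 (inter_mem hC (extChartAt_source_mem_nhds (I := I) x))
  obtain ⟨ε, hε, hεs⟩ := setOfPred_riemannianEDist_lt_subset_nhds' I (hso.mem_nhds hxs)
  refine ⟨C, C_pos, _, eventually_riemannianEDist_lt I x hε, fun y hy ↦ ?_⟩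
  have hC0 : (C : ℝ≥0∞) ≠ 0 := by exact_mod_cast C_pos.ne'
  refine le_of_forall_gt fun r hr ↦ ?_
  -- The bound `ε` forces the nearly minimizing curve, which starts at `x`, to stay in the set where
  -- the derivative of the chart is bounded; `r / C` controls its length.
  have h1 : riemannianEDist I x y < min ε (r / C) := by
    refine lt_min hy ?_
    rw [ENNReal.lt_div_iff_mul_lt (Or.inl hC0) (Or.inl ENNReal.coe_ne_top), mul_comm]
    exact hr
  obtain ⟨γ, h0, rfl, hγ, hlt, -⟩ := exists_lt_locally_constant_of_riemannianEDist_lt h1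
    zero_lt_one
  have h2 : extChartAt I x x = extChartAt I x (γ 0) := by rw [h0]
  rw [h2]
  refine (edist_comp_le_pathELength (I := I) hso (F := extChartAt I x) ?_ (C := C) ?_ hγ
    zero_lt_one fun t ht ↦ hεs ?_).trans_lt ((ENNReal.mul_lt_mul_right hC0 ENNReal.coe_ne_top
      (hlt.trans_le (min_le_right _ _))).trans_le ENNReal.mul_div_le)
  · refine contMDiffOn_extChartAt.mono fun z hz ↦ ?_
    simpa using (hs hz).2
  · intro z hz v
    exact (ContinuousLinearMap.le_opENorm (mfderiv I 𝓘(ℝ, E) (extChartAt I _) z) v).trans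
      (mul_le_mul_left (hs hz).1.le _)
  · refine (riemannianEDist_le_pathELength hγ.contMDiffOn h0 rfl ht.1).trans_lt ?_
    exact (pathELength_mono le_rfl ht.2).trans_lt (hlt.trans_le (min_le_left _ _))

end LocalComparison

/-! ### Packing bounds for Riemannian distances -/

section Packing

open scoped NNReal

/-- A Riemannian distance is, near a point, bounded above by the Euclidean distance in some
coordinates, and the coordinates are Lipschitz at the point. -/
lemma HasRiemannianDistance.exists_coordinates {N : Type*} [MetricSpace N]
    (h : HasRiemannianDistance N) (p : N) :
    ∃ (n : ℕ) (φ : N → Euc n) (C : ℝ) (D : ℝ) (δ : ℝ), 0 < C ∧ 0 < D ∧ 0 < δ ∧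
      ∀ y, dist p y < δ → dist (φ p) (φ y) ≤ D * dist p y ∧
        ∀ z, dist p z < δ → dist y z ≤ C * dist (φ y) (φ z) := by
  obtain ⟨n, _, _, G, hG⟩ := h
  let _ : RiemannianBundle (fun x : N ↦ TangentSpace (𝓡 n) x) := ⟨G.toRiemannianMetric⟩
  have := isContinuousRiemannianBundle G
  obtain ⟨C, hC, s, hs, hCs⟩ := exists_riemannianEDist_le_edist_extChartAt (𝓡 n) p
  obtain ⟨D, hD, t, ht, hDt⟩ := exists_edist_extChartAt_le_riemannianEDist (𝓡 n) p
  obtain ⟨δ, hδ, hst⟩ := Metric.mem_nhds_iff.1 (inter_mem hs ht)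
  have hst' : ∀ y, dist p y < δ → y ∈ s ∩ t := fun y hy ↦ hst (Metric.mem_ball'.2 hy)
  refine ⟨n, extChartAt (𝓡 n) p, C, D, δ, NNReal.coe_pos.2 hC, NNReal.coe_pos.2 hD, hδ,
    fun y hy ↦ ⟨?_, fun z hz ↦ ?_⟩⟩
  · have h1 := (hDt y (hst' y hy).2).trans_eq (congrArg _ (hG p y).symm)
    rw [edist_nndist, edist_nndist] at h1
    exact_mod_cast h1
  · have h1 := (hG y z).trans_le (hCs y (hst' y hy).1 z (hst' z hz).1)
    rw [edist_nndist, edist_nndist] at h1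
    exact_mod_cast h1

/-- In a small ball for a Riemannian distance, the number of points whose mutual distances are
comparable to the radius is bounded. -/
lemma HasRiemannianDistance.exists_packing_bound {N : Type*} [MetricSpace N]
    (h : HasRiemannianDistance N) (p : N) {κ : ℝ} (hκ : 0 < κ) :
    ∃ K : ℕ, ∃ ρ₀ > 0, ∀ ρ, 0 < ρ → ρ < ρ₀ → ∀ x : Fin K → N, (∀ i, dist p (x i) ≤ ρ) →
      ∃ i j, i ≠ j ∧ dist (x i) (x j) < κ * ρ := by
  obtain ⟨n, φ, C, D, δ, hC, hD, hδ, hφ⟩ := h.exists_coordinates p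
  -- The coordinates rescaled by `ρ⁻¹` lie in a fixed ball of radius `D`. Two points in one covering
  -- ball of radius `κ / (2C)` have rescaled coordinates less than `κ / C` apart, hence distance
  -- less than `κ ρ`. One point more than there are balls forces this by the pigeonhole principle,
  -- uniformly in `ρ`.
  obtain ⟨t, -, htf, ht⟩ := (isCompact_closedBall (0 : Euc n) D).finite_cover_balls
    (e := κ / (2 * C)) (by positivity)
  refine ⟨htf.toFinset.card + 1, δ, hδ, fun ρ hρ hρδ x hx ↦ ?_⟩
  have h1 : ∀ i, ∃ w ∈ htf.toFinset, dist (ρ⁻¹ • (φ (x i) - φ p)) w < κ / (2 * C) := by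
    intro i
    have h2 : ρ⁻¹ • (φ (x i) - φ p) ∈ Metric.closedBall (0 : Euc n) D := by
      rw [mem_closedBall_zero_iff, norm_smul, norm_inv, Real.norm_of_nonneg hρ.le,
        ← dist_eq_norm, dist_comm, inv_mul_le_iff₀ hρ, mul_comm]
      exact (hφ _ ((hx i).trans_lt hρδ)).1.trans (mul_le_mul_of_nonneg_left (hx i) hD.le)
    obtain ⟨w, hw, hw'⟩ := mem_iUnion₂.1 (ht h2)
    exact ⟨w, htf.mem_toFinset.2 hw, hw'⟩
  choose w hw hw' using h1
  obtain ⟨i, -, j, -, hij, hwij⟩ := Finset.exists_ne_map_eq_of_card_lt_of_maps_to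
    (s := (Finset.univ : Finset (Fin (htf.toFinset.card + 1)))) (t := htf.toFinset) (f := w)
    (by simp) (fun i _ ↦ hw i)
  refine ⟨i, j, hij, ?_⟩
  refine ((hφ _ ((hx i).trans_lt hρδ)).2 _ ((hx j).trans_lt hρδ)).trans_lt ?_
  have h3 : dist (ρ⁻¹ • (φ (x i) - φ p)) (ρ⁻¹ • (φ (x j) - φ p)) < κ / (2 * C) + κ / (2 * C) :=
    (dist_triangle_right _ _ (w i)).trans_lt (add_lt_add (hw' i) (hwij ▸ hw' j))
  rw [dist_smul₀, dist_sub_right, norm_inv, Real.norm_of_nonneg hρ.le, inv_mul_lt_iff₀ hρ] at h3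
  calc C * dist (φ (x i)) (φ (x j)) < C * (ρ * (κ / (2 * C) + κ / (2 * C))) :=
        mul_lt_mul_of_pos_left h3 hC
    _ = κ * ρ := by field_simp; ring

end Packing

/-! ### Separated points near the end of the ball -/

section Separation

variable {c : ℝ} (hc : 0 < c)

include hc in
-- Jordan's inequality `sin s ≥ 2 s / π` at `s = π - t`, together with `ℓ(t) ≥ ℓ(1)`. So at depth
-- `τ` the warping factor is at least a multiple of `√τ`, the estimate behind both the failure of
-- the packing bound and the growth of the area.
lemma exists_mul_le_ell_mul_sin :
    ∃ κ > 0, ∀ t ∈ Icc (π / 2) π, κ * (π - t) ≤ ell c t * sin t / 2 := by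
  have h0 : ell c 0 = 0 := by simp [ell, cbrt]
  have h1 : 0 < ell c 1 := by
    rw [← h0]
    exact ell_strictMonoOn hc (by simp) (by simp) one_pos
  refine ⟨ell c 1 / π, by positivity, fun t ht ↦ ?_⟩
  have h2 : ell c 1 ≤ ell c t := (ell_strictMonoOn hc).monotoneOn (by simp)
    (by rw [mem_Ici]; linarith [ht.1, Real.pi_pos]) (by linarith [ht.1, Real.pi_gt_three])
  have h3 : 2 / π * (π - t) ≤ sin (π - t) :=
    Real.mul_le_sin (by linarith [ht.2]) (by linarith [ht.1])
  rw [Real.sin_pi_sub] at h3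
  have h4 : 0 ≤ 2 / π * (π - t) := mul_nonneg (by positivity) (by linarith [ht.2])
  calc ell c 1 / π * (π - t) = ell c 1 * (2 / π * (π - t)) / 2 := by ring
    _ ≤ ell c t * sin t / 2 := by
      have := mul_le_mul h2 h3 h4 (h1.le.trans h2)
      linarith

lemma exists_profile : ∃ (χ : ℝ → ℝ) (M : ℝ), ContDiff ℝ 1 χ ∧ 0 < M ∧ χ 1 = 1 ∧
    (∀ s, |χ s| ≤ 1) ∧ (∀ s, |deriv χ s| ≤ M) ∧ ∀ s, χ s ≠ 0 → 1 / 4 ≤ s ∧ s ≤ 7 / 4 := by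
  let χ : ContDiffBump (1 : ℝ) := ⟨1 / 2, 3 / 4, by norm_num, by norm_num⟩
  have h1 : ContDiff ℝ 1 χ := χ.contDiff
  obtain ⟨M, hM⟩ := (χ.hasCompactSupport.deriv).exists_bound_of_continuous
    (h1.continuous_deriv le_rfl)
  refine ⟨χ, max M 1, h1, by positivity, ?_, fun s ↦ ?_, fun s ↦ (hM s).trans (le_max_left _ _),
    fun s hs ↦ ?_⟩
  · exact χ.one_of_mem_closedBall (Metric.mem_closedBall_self (by norm_num [χ]))
  · rw [abs_of_nonneg χ.nonneg]
    exact χ.le_one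
  · have h2 : s ∈ Metric.ball (1 : ℝ) (3 / 4) := by
      rw [← χ.support_eq]
      exact hs
    rw [Metric.mem_ball, Real.dist_eq, abs_lt] at h2
    constructor <;> linarith [h2.1, h2.2]

/-- Points of a great circle at the angles `i / N`. All angles lie in `[0, 1)`, so no two of the
vectors are equal or antipodal. -/
lemma exists_unit_vectors (N : ℕ) : ∃ e : Fin N → Euc 3, (∀ i, ‖e i‖ = 1) ∧
    ∀ i j, i ≠ j → |inner ℝ (e i) (e j)| < (1 : ℝ) := by
  let θ : Fin N → ℝ := fun i ↦ (i : ℝ) / N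
  have hθ : ∀ i, θ i ∈ Ico (0 : ℝ) 1 := fun i ↦ by
    have hN : (0 : ℝ) < N := by exact_mod_cast i.pos
    refine ⟨by positivity, (div_lt_one hN).2 ?_⟩
    exact_mod_cast i.2
  have hinner : ∀ i j, inner ℝ (!₂[cos (θ i), sin (θ i), 0] : Euc 3)
      (!₂[cos (θ j), sin (θ j), 0] : Euc 3) = cos (θ i - θ j) := by
    intro i j
    rw [PiLp.inner_apply]
    simp [Fin.sum_univ_three, Real.cos_sub]
    ring
  refine ⟨fun i ↦ !₂[cos (θ i), sin (θ i), 0], fun i ↦ ?_, fun i j hij ↦ ?_⟩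
  · have h := hinner i i
    rw [real_inner_self_eq_norm_sq, sub_self, Real.cos_zero] at h
    exact (pow_eq_one_iff_of_nonneg (norm_nonneg _) two_ne_zero).1 h
  · refine (congrArg abs (hinner i j)).trans_lt ?_
    have h1 : θ i - θ j ≠ 0 := by
      have hN : (N : ℝ) ≠ 0 := by exact_mod_cast i.pos.ne'
      intro h
      have h2 : (i : ℝ) = j := by
        have := sub_eq_zero.1 h
        simpa [θ, div_left_inj' hN] using this
      exact hij (Fin.ext (by exact_mod_cast h2))
    have h2 := hθ i
    have h3 := hθ j
    have h4 : sin (θ i - θ j) ≠ 0 := by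
      rw [Ne, Real.sin_eq_zero_iff_of_lt_of_lt (by linarith [h2.1, h3.2, Real.pi_gt_three])
        (by linarith [h2.2, h3.1, Real.pi_gt_three])]
      exact h1
    rw [← sq_lt_one_iff_abs_lt_one, ← Real.sin_sq_add_cos_sq (θ i - θ j)]
    have := pow_pos (abs_pos.2 h4) 2
    rw [sq_abs] at this
    linarith

/-- A high power of the angular factor separates the directions, however close together they are. -/
lemma exists_pow_le_half {ι : Type*} [Finite ι] {a : ι → ℝ} (h : ∀ i, |a i| < 1) :
    ∃ k : ℕ, ∀ i, a i ^ k ≤ 1 / 2 := by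
  have h1 : ∀ᶠ k : ℕ in atTop, ∀ i, a i ^ k ≤ 1 / 2 := eventually_all.2 fun i ↦
    (tendsto_pow_atTop_nhds_zero_of_abs_lt_one (h i)).eventually_le_const (by norm_num)
  exact h1.exists

/-- Near the end of the ball, at depth `τ`, there are arbitrarily many points whose mutual distances
are comparable to `τ`. -/
lemma exists_separated_points : ∃ κ > 0, ∀ N : ℕ, ∃ e : Fin N → Euc 3, (∀ i, ‖e i‖ = 1) ∧
    ∃ τ₀ ∈ Ioo (0 : ℝ) (1 / 2), ∀ τ, 0 < τ → τ < τ₀ → ∀ x : Fin N → PiBall,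
      (∀ i, (x i).val = (π - τ) • e i) → ∀ i j, i ≠ j → κ * τ ≤ ballDist hc (x i) (x j) := by
  obtain ⟨m, W, hm, hspeed⟩ := exists_radSpeed_bounds hc
  obtain ⟨b, hb, hwarp⟩ := exists_mul_le_ell_mul_sin hc
  obtain ⟨χ, M, hχ, hM, hχ1, hχle, hχd, hχs⟩ := exists_profile
  have hK : 0 < M / m + 1 := by positivity
  -- The test functions have Lipschitz constant `M / m + 1`: `M / m` from the radial part and `1`
  -- from the angular part. It does not depend on `N`; only the exponent `k` and the threshold for
  -- `τ` do.
  refine ⟨(2 * (M / m + 1))⁻¹, by positivity, fun N ↦ ?_⟩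
  obtain ⟨e, he, hee⟩ := exists_unit_vectors N
  obtain ⟨k, hk⟩ := exists_pow_le_half
    (a := fun p : {p : Fin N × Fin N // p.1 ≠ p.2} ↦ inner ℝ (e p.1.1) (e p.1.2))
    (fun p ↦ hee _ _ p.2)
  -- The angular part of the gradient is at most `k τ / warp`, of order `k √τ`. Hence any fixed
  -- exponent `k` is harmless for small `τ`.
  have hlim : Tendsto (fun τ : ℝ ↦ k * (τ / √(b * (τ / 4)))) (𝓝[>] 0) (𝓝 0) := by
    have h1 : Tendsto (fun τ : ℝ ↦ k * (4 / b * √(b * (τ / 4)))) (𝓝[>] 0) (𝓝 0) := by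
      refine (Continuous.tendsto' ?_ 0 0 (by simp)).mono_left nhdsWithin_le_nhds
      fun_prop
    refine h1.congr' ?_
    filter_upwards [self_mem_nhdsWithin] with τ hτ
    have hτ' : 0 < b * (τ / 4) := mul_pos hb (div_pos hτ (by norm_num))
    congr 1
    rw [eq_div_iff (Real.sqrt_pos.2 hτ').ne', mul_assoc, Real.mul_self_sqrt hτ'.le]
    field_simp
  obtain ⟨τ₀, hτ₀, hsmall⟩ := mem_nhdsGT_iff_exists_Ioo_subset.1 (hlim.eventually_le_const one_pos)
  -- For `τ < 1/4` the profile `ψ` is supported within `7/16` of `π`, hence in `t ≥ π/2`, where the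
  -- lower bound for the warping factor holds, and in `t ≥ 1`, away from the origin.
  refine ⟨e, he, min τ₀ (1 / 4), ⟨lt_min hτ₀ (by norm_num), by
    exact (min_le_right _ _).trans_lt (by norm_num)⟩, fun τ hτ hττ x hx i j hij ↦ ?_⟩
  have hτ1 : k * (τ / √(b * (τ / 4))) ≤ 1 := hsmall ⟨hτ, hττ.trans_le (min_le_left _ _)⟩
  have hτ2 : τ < 1 / 4 := hττ.trans_le (min_le_right _ _)
  have hπ := Real.pi_gt_three
  -- A bump of height and width proportional to `τ` at depth `τ`, so that its derivative is bounded
  -- independently of `τ`.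
  let ψ : ℝ → ℝ := fun t ↦ τ * χ ((π - t) / τ)
  have hψ : ContDiff ℝ 1 ψ := contDiff_const.mul (hχ.comp (by fun_prop))
  have hψ0 : ∀ t, ψ t ≠ 0 → τ / 4 ≤ π - t ∧ π - t ≤ 7 / 4 * τ := by
    intro t ht
    obtain ⟨h1, h2⟩ := hχs _ (right_ne_zero_of_mul ht)
    rw [le_div_iff₀ hτ] at h1
    rw [div_le_iff₀ hτ] at h2
    exact ⟨by linarith, h2⟩
  have hψd : ∀ t, |deriv ψ t| ≤ M := by
    intro t
    have h1 : HasDerivAt (fun t ↦ (π - t) / τ) (-1 / τ) t :=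
      ((hasDerivAt_id t).const_sub (π)).div_const τ
    have h2 := ((hχ.differentiable one_ne_zero ((π - t) / τ)).hasDerivAt.comp t h1).const_mul τ
    have h3 : deriv ψ t = -deriv χ ((π - t) / τ) := by
      refine h2.deriv.trans ?_
      field_simp
    rw [h3, abs_neg]
    exact hχd _
  have hbound : ∀ t ∈ Ioo 0 (π), |deriv ψ t| / radSpeed c t + k * |ψ t| / warp c t ≤ M / m + 1 := by
    intro t ht
    refine add_le_add (div_le_div₀ hM.le (hψd t) hm (hspeed t).1) ?_
    rcases eq_or_ne (ψ t) 0 with h | h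
    · rw [h]; simp
    · obtain ⟨h1, h2⟩ := hψ0 t h
      have h3 : √(b * (τ / 4)) ≤ warp c t := by
        refine Real.sqrt_le_sqrt ((mul_le_mul_of_nonneg_left h1 hb.le).trans
          (hwarp t ⟨?_, ht.2.le⟩))
        linarith
      have h4 : |ψ t| ≤ τ := by
        rw [abs_mul, abs_of_pos hτ]
        exact mul_le_of_le_one_right hτ.le (hχle _)
      rw [mul_div_assoc]
      refine le_trans (mul_le_mul_of_nonneg_left ?_ (Nat.cast_nonneg k)) hτ1
      exact div_le_div₀ hτ.le h4 (Real.sqrt_pos.2 (by positivity)) h3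
  have key := abs_coneFn_sub_le hc hψ (δ := 1) one_pos (fun t ht ↦ by
    by_contra h
    linarith [(hψ0 t h).2]) (he i).le k hK hbound (x i) (x j)
  -- The test function attached to `e i` equals `τ` at `x i` and at most `τ / 2` at every other `x
  -- j`.
  have hval : ∀ j, coneFn ψ (e i) k (x j).val = τ * inner ℝ (e j) (e i) ^ k := by
    intro j
    have h1 : 0 < π - τ := by linarith
    have h2 : ‖(x j).val‖ = π - τ := by
      rw [hx, norm_smul, he, mul_one, Real.norm_of_nonneg h1.le]
    rw [coneFn, h2, hx, inner_smul_left, conj_trivial, inv_mul_cancel_left₀ h1.ne']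
    simp [ψ, hτ.ne', hχ1]
  rw [hval, hval, real_inner_self_eq_norm_sq, he] at key
  have h5 := hk ⟨(j, i), hij.symm⟩
  simp only at h5
  have h6 : τ / 2 ≤ (M / m + 1) * ballDist hc (x i) (x j) := by
    refine le_trans ?_ ((le_abs_self _).trans key)
    have := mul_le_mul_of_nonneg_left h5 hτ.le
    simp only [one_pow]
    linarith
  rw [inv_mul_le_iff₀ (by positivity)]
  linarith

end Separation

/-- The packing bound at `pt` allows only a bounded number of separated points in small balls, while
the spheres near the end of the ball contain arbitrarily many. -/
lemma not_hasRiemannianDistance_completion {c : ℝ} (hc : 0 < c) :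
    letI := ballMetricSpace hc
    ¬ HasRiemannianDistance (UniformSpace.Completion PiBall) := by
  let _ := ballMetricSpace hc
  intro h
  obtain ⟨pt, hpt, -⟩ := exists_ball_completion_point hc
  obtain ⟨m, W, hm, hspeed⟩ := exists_radSpeed_bounds hc
  have hW : 0 < W := hm.trans_le ((hspeed 0).1.trans (hspeed 0).2)
  obtain ⟨κ, hκ, hsep⟩ := exists_separated_points hc
  obtain ⟨N, ρ₀, hρ₀, hpack⟩ := h.exists_packing_bound pt (div_pos hκ hW)
  obtain ⟨e, he, τ₀, ⟨hτ₀, hτ₀'⟩, hsep⟩ := hsep N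
  obtain ⟨τ, hτ, hττ⟩ := exists_between (lt_min hτ₀ (div_pos hρ₀ hW))
  have hτ1 : τ < τ₀ := hττ.trans_le (min_le_left _ _)
  have hτ2 : W * τ < ρ₀ := by
    have := (lt_div_iff₀ hW).1 (hττ.trans_le (min_le_right _ _))
    linarith
  have hπ := Real.pi_gt_three
  have habs : |π - τ| < π := by rw [abs_lt]; constructor <;> linarith
  let x : Fin N → PiBall := fun i ↦ radPoint (e i) (he i) (π - τ) habs
  have hx : ∀ i, (x i).val = (π - τ) • e i := fun i ↦ rfl
  -- Points at depth `τ` are within `W τ` of `pt`. The packing constant `κ / W` turns this radius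
  -- into the separation `κ τ`.
  obtain ⟨i, j, hij, hlt⟩ := hpack (W * τ) (mul_pos hW hτ) hτ2
    (fun i ↦ (x i : UniformSpace.Completion PiBall)) fun i ↦ by
      have h1 : ‖(x i).val‖ = π - τ := by
        rw [hx, norm_smul, he, mul_one, Real.norm_of_nonneg (by linarith)]
      rw [dist_comm, dist_completion_point hc hpt, h1]
      have h2 := (arc_sub_bounds hspeed (show π - τ ≤ π by linarith)).2
      linarith
  have h1 := hsep τ hτ hτ1 x hx i j hij
  rw [UniformSpace.Completion.dist_eq] at hlt
  have h2 : κ / W * (W * τ) = κ * τ := by field_simp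
  exact absurd (hlt.trans_eq h2) (not_lt.2 h1)

/-! ### The area of distance spheres -/

section Area

/-- A parametrized patch of the sphere of radius `R`. -/
noncomputable def spherePatch (R : ℝ) (x : Euc 2) : Euc 3 :=
  (R * (cos (x 0) * cos (x 1))) • EuclideanSpace.single 0 1 +
    (R * (sin (x 0) * cos (x 1))) • EuclideanSpace.single 1 1 +
    (R * sin (x 1)) • EuclideanSpace.single 2 1

/-- The parameter square of a patch of the sphere. -/
def patchSquare : Set (Euc 2) := {x | x 0 ∈ Ioo 0 1 ∧ x 1 ∈ Ioo 0 1}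

lemma isOpen_patchSquare : IsOpen patchSquare := by
  have h : ∀ i : Fin 2, Continuous fun x : Euc 2 ↦ x i := fun i ↦ by fun_prop
  exact (isOpen_Ioo.preimage (h 0)).inter (isOpen_Ioo.preimage (h 1))

lemma patchSquare_nonempty : patchSquare.Nonempty :=
  ⟨!₂[1 / 2, 1 / 2], by simp [patchSquare]; norm_num⟩

lemma spherePatch_contDiff (R : ℝ) : ContDiff ℝ ∞ (spherePatch R) := by
  unfold spherePatch
  have h : ∀ i : Fin 2, ContDiff ℝ ∞ fun x : Euc 2 ↦ x i := fun i ↦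
    (EuclideanSpace.proj (𝕜 := ℝ) i).contDiff
  exact (((contDiff_const.mul ((h 0).cos.mul (h 1).cos)).smul contDiff_const).add
    ((contDiff_const.mul ((h 0).sin.mul (h 1).cos)).smul contDiff_const)).add
    ((contDiff_const.mul (h 1).sin).smul contDiff_const)

lemma norm_spherePatch {R : ℝ} (hR : 0 ≤ R) (x : Euc 2) : ‖spherePatch R x‖ = R := by
  rw [EuclideanSpace.norm_eq, Real.sqrt_eq_iff_mul_self_eq (by positivity) hR]
  simp [Fin.sum_univ_three, spherePatch]
  linear_combination (R ^ 2) * (Real.sin_sq_add_cos_sq (x 1)) +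
    (R ^ 2 * cos (x 1) ^ 2) * (Real.sin_sq_add_cos_sq (x 0))

lemma spherePatch_injOn {R : ℝ} (hR : R ≠ 0) : InjOn (spherePatch R) patchSquare := by
  intro x hx y hy h
  have hπ := Real.pi_gt_three
  have h0 := congrArg (fun v : Euc 3 ↦ v 0) h
  have h2 := congrArg (fun v : Euc 3 ↦ v 2) h
  simp [spherePatch, hR] at h0 h2
  have e1 : x 1 = y 1 := Real.injOn_sin ⟨by linarith [hx.2.1], by linarith [hx.2.2]⟩
    ⟨by linarith [hy.2.1], by linarith [hy.2.2]⟩ h2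
  have hc : cos (y 1) ≠ 0 := (Real.cos_pos_of_mem_Ioo
    ⟨by linarith [hy.2.1], by linarith [hy.2.2]⟩).ne'
  rw [e1] at h0
  have e0 : x 0 = y 0 := Real.injOn_cos ⟨hx.1.1.le, by linarith [hx.1.2]⟩
    ⟨hy.1.1.le, by linarith [hy.1.2]⟩ (mul_right_cancel₀ hc h0)
  ext i
  fin_cases i
  · exact e0
  · exact e1

lemma fderiv_spherePatch (R : ℝ) (x a : Euc 2) : fderiv ℝ (spherePatch R) x a =
    (R * (-sin (x 0) * cos (x 1) * a 0 - cos (x 0) * sin (x 1) * a 1)) • EuclideanSpace.single 0 1 +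
    (R * (cos (x 0) * cos (x 1) * a 0 - sin (x 0) * sin (x 1) * a 1)) • EuclideanSpace.single 1 1 +
    (R * (cos (x 1) * a 1)) • EuclideanSpace.single 2 1 := by
  have h : ∀ i : Fin 2, HasFDerivAt (fun x : Euc 2 ↦ x i) (EuclideanSpace.proj (𝕜 := ℝ) i) x :=
    fun i ↦ (EuclideanSpace.proj (𝕜 := ℝ) i).hasFDerivAt
  have h1 := ((((h 0).cos.mul (h 1).cos).const_mul R).smul_const
      (EuclideanSpace.single (0 : Fin 3) (1 : ℝ))).add
    ((((h 0).sin.mul (h 1).cos).const_mul R).smul_const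
      (EuclideanSpace.single (1 : Fin 3) (1 : ℝ))) |>.add
    (((h 1).sin.const_mul R).smul_const (EuclideanSpace.single (2 : Fin 3) (1 : ℝ)))
  refine (congrArg (fun l ↦ l a) h1.fderiv).trans ?_
  ext i
  fin_cases i <;> simp <;> ring

/-- Tangent vectors of the sphere are orthogonal to the position vector, so only the term with
`metA` contributes, and the two coordinate directions are orthogonal to each other. -/
lemma gram_spherePatch (c : ℝ) {R : ℝ} (hR : 0 ≤ R) (x : Euc 2) :
    Matrix.det (Matrix.of fun i j : Fin 2 ↦ inducedForm c (spherePatch R x)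
      (fderiv ℝ (spherePatch R) x (EuclideanSpace.single i 1))
      (fderiv ℝ (spherePatch R) x (EuclideanSpace.single j 1))) =
    (ell c R * sin R / 2 * cos (x 1)) ^ 2 := by
  have hs0 := Real.sin_sq_add_cos_sq (x 0)
  have hs1 := Real.sin_sq_add_cos_sq (x 1)
  have horth : ∀ a, inner ℝ (spherePatch R x) (fderiv ℝ (spherePatch R) x a) = (0 : ℝ) := by
    intro a
    rw [fderiv_spherePatch, PiLp.inner_apply]
    simp [Fin.sum_univ_three, spherePatch]
    linear_combination (-(R ^ 2) * cos (x 1) * sin (x 1) * a 1) * hs0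
  have h00 : inner ℝ (fderiv ℝ (spherePatch R) x (EuclideanSpace.single 0 1))
      (fderiv ℝ (spherePatch R) x (EuclideanSpace.single 0 1)) = (R * cos (x 1)) ^ 2 := by
    rw [fderiv_spherePatch, PiLp.inner_apply]
    simp [Fin.sum_univ_three]
    linear_combination (R ^ 2 * cos (x 1) ^ 2) * hs0
  have h01 : inner ℝ (fderiv ℝ (spherePatch R) x (EuclideanSpace.single 0 1))
      (fderiv ℝ (spherePatch R) x (EuclideanSpace.single 1 1)) = (0 : ℝ) := by
    rw [fderiv_spherePatch, fderiv_spherePatch, PiLp.inner_apply]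
    simp [Fin.sum_univ_three]
    ring
  have h11 : inner ℝ (fderiv ℝ (spherePatch R) x (EuclideanSpace.single 1 1))
      (fderiv ℝ (spherePatch R) x (EuclideanSpace.single 1 1)) = R ^ 2 := by
    rw [fderiv_spherePatch, PiLp.inner_apply]
    simp [Fin.sum_univ_three]
    linear_combination (R ^ 2 * sin (x 1) ^ 2) * hs0 + R ^ 2 * hs1
  rw [Matrix.det_fin_two]
  simp only [Matrix.of_apply, inducedForm_eq, horth, norm_spherePatch hR, h00, h01, h11]
  rw [← metA_mul_sq c hR]
  ring

/-- The area is a supremum over patches, so one patch gives a lower bound; a fixed proportion of the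
sphere suffices for divergence. On this patch the latitude is below `1 < π/3`, so its cosine is at
least `1/2`. -/
lemma le_surfaceArea {c R : ℝ} (hR : 0 < R) (hw : 0 ≤ ell c R * sin R / 2)
    {S : Set (Euc 3)} (hS : ∀ v : Euc 3, ‖v‖ = R → v ∈ S) :
    ENNReal.ofReal (ell c R * sin R / 2 / 2) * volume patchSquare ≤
      surfaceArea (inducedForm c) S := by
  refine le_trans ?_ (le_iSup₂_of_le patchSquare (spherePatch R) <|
    le_iSup₂_of_le isOpen_patchSquare (spherePatch_contDiff R).contDiffOn <|
    le_iSup₂_of_le (spherePatch_injOn hR.ne') (fun x _ ↦ hS _ (norm_spherePatch hR.le x)) le_rfl)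
  rw [patchArea, ← setLIntegral_const]
  refine setLIntegral_mono' isOpen_patchSquare.measurableSet fun x hx ↦ ?_
  rw [gram_spherePatch c hR.le x]
  have h1 : 1 / 2 ≤ cos (x 1) := by
    rw [← Real.cos_pi_div_three]
    exact Real.cos_le_cos_of_nonneg_of_le_pi hx.2.1.le (by linarith [Real.pi_pos])
      (by linarith [hx.2.2, Real.pi_gt_three])
  refine ENNReal.ofReal_le_ofReal ?_
  rw [Real.sqrt_sq (mul_nonneg hw (by linarith))]
  have := mul_le_mul_of_nonneg_left h1 hw
  linarith

lemma tendsto_surfaceArea_div {c : ℝ} (hc : 0 < c) :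
    Tendsto (fun ρ : ℝ ↦ surfaceArea (inducedForm c) (PiBall.val ''
      {x | arc c (π) - arc c ‖x.val‖ = ρ}) / ENNReal.ofReal (4 * π * ρ ^ 2)) (𝓝[>] 0) (𝓝 ⊤) := by
  obtain ⟨m, W, hm, hspeed⟩ := exists_radSpeed_bounds hc
  have hW : 0 < W := hm.trans_le ((hspeed 0).1.trans (hspeed 0).2)
  obtain ⟨κ, hκ, hwarp⟩ := exists_mul_le_ell_mul_sin hc
  have hvol : volume patchSquare ≠ 0 := (isOpen_patchSquare.measure_pos _ patchSquare_nonempty).ne'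
  have hlim : Tendsto (fun ρ : ℝ ↦ ENNReal.ofReal (κ / (8 * π * W) * ρ⁻¹) * volume patchSquare)
      (𝓝[>] 0) (𝓝 ⊤) := by
    have h1 : Tendsto (fun ρ : ℝ ↦ κ / (8 * π * W) * ρ⁻¹) (𝓝[>] 0) atTop :=
      tendsto_inv_nhdsGT_zero.const_mul_atTop (by positivity)
    have h2 := ENNReal.Tendsto.mul_const (b := volume patchSquare)
      (ENNReal.tendsto_ofReal_atTop.comp h1) (Or.inl ENNReal.top_ne_zero)
    rwa [ENNReal.top_mul hvol] at h2
  have hpos : 0 < arc c π - arc c (π / 2) :=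
    sub_pos.2 (arc_strictMono hc (by linarith [Real.pi_pos]))
  refine tendsto_nhds_top_mono hlim ?_
  -- This range of `ρ` places the radius `R` of the distance sphere in `(π/2, π)`, where the squared
  -- warping factor is at least `κ (π - R) ≥ (κ / W) ρ`.
  filter_upwards [Ioo_mem_nhdsGT hpos] with ρ hρ
  obtain ⟨R, hR⟩ := arc_surjective hc (arc c π - ρ)
  have hR1 : π / 2 < R := (arc_strictMono hc).lt_iff_lt.1 (by rw [hR]; linarith [hρ.2])
  have hR2 : R < π := (arc_strictMono hc).lt_iff_lt.1 (by rw [hR]; linarith [hρ.1])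
  have hR0 : 0 < R := by linarith [Real.pi_pos]
  have h1 : ρ ≤ W * (π - R) := by
    have := (arc_sub_bounds hspeed hR2.le).2
    linarith
  have h2 := hwarp R ⟨hR1.le, hR2.le⟩
  have h3 : κ / W * ρ ≤ ell c R * sin R / 2 := by
    refine le_trans ?_ h2
    rw [div_mul_eq_mul_div, div_le_iff₀ hW]
    linarith [mul_le_mul_of_nonneg_left h1 hκ.le]
  have h4 : 0 < κ / W * ρ := mul_pos (div_pos hκ hW) hρ.1
  have h5 := le_surfaceArea hR0 (h4.le.trans h3)
    (S := PiBall.val '' {x | arc c (π) - arc c ‖x.val‖ = ρ}) fun v hv ↦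
      ⟨PiBall.mk v (by rw [mem_ball_zero_iff, hv]; exact hR2), by
        rw [mem_ofPred_eq, PiBall.val_mk, hv, hR]; ring, rfl⟩
  have h6 : 0 < 4 * π * ρ ^ 2 := mul_pos (by positivity) (pow_pos hρ.1 2)
  refine le_trans ?_ (ENNReal.div_le_div_right h5 _)
  rw [ENNReal.mul_div_right_comm, ← ENNReal.ofReal_div_of_pos h6]
  refine mul_le_mul_left (ENNReal.ofReal_le_ofReal ?_) _
  rw [le_div_iff₀ h6]
  -- The area is at least `(κ / W) ρ / 2` times the volume of the parameter square; division by
  -- `4πρ²` leaves a multiple of `ρ⁻¹`.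
  have h7 : κ / (8 * π * W) * ρ⁻¹ * (4 * π * ρ ^ 2) = κ / W * ρ / 2 := by
    have := hρ.1.ne'
    field_simp
    norm_num
  linarith

end Area

theorem mainTheorem6 (c : ℝ) (hc : 0 < c) :
    -- `φ` is a smooth embedding of the ball `B` of radius `π`
    ContDiffOn ℝ ∞ (fun v ↦ (screwMap c v).toProd) (Metric.ball 0 π) ∧
    IsEmbedding (fun x : PiBall ↦ screwMap c x.val) ∧
    -- radial curves are reparametrizations of inextensible geodesics of finite length
    (∀ u : Euc 3, ‖u‖ = 1 →
      ∃ (L : ℝ) (σ : ℝ → ℝ) (γ : ℝ → Euc 3), 0 < L ∧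
        ContDiffOn ℝ ∞ σ (Ioo (-π) π) ∧ (∀ r ∈ Ioo (-π) π, 0 < deriv σ r) ∧
        BijOn σ (Ioo (-π) π) (Ioo (-L) L) ∧
        (∀ r ∈ Ioo (-π) π, γ (σ r) = r • u) ∧
        IsInextensibleGeodesicOn (inducedForm c) (Metric.ball 0 π) γ (Ioo (-L) L) ∧
        curveLength (inducedForm c) γ (Ioo (-L) L) = ENNReal.ofReal (2 * L)) ∧
    -- the induced form is a Riemannian metric `G` on `B`
    ∃ G : ContMDiffRiemannianMetric (𝓡 3) ∞ (Euc 3) (fun x : PiBall ↦ TangentSpace (𝓡 3) x),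
      IsInducedMetric c G ∧
      -- its distance is finite and makes `B` a metric space `m` with the same topology
      ∃ m : MetricSpace PiBall,
        m.toUniformSpace.toTopologicalSpace = PiBall.topology ∧
        (∀ x y : PiBall, ENNReal.ofReal (m.dist x y) = riemDist G x y) ∧
        ¬ @CompleteSpace PiBall m.toUniformSpace ∧
        -- the metric completion of `B` is `B` together with one point `pt`
        ∃ pt : UniformSpace.Completion PiBall,
          (∀ y : UniformSpace.Completion PiBall,
            y ≠ pt ↔ ∃ x : PiBall, (x : UniformSpace.Completion PiBall) = y) ∧
          (∃ h : OnePoint PiBall ≃ₜ UniformSpace.Completion PiBall,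
            h OnePoint.infty = pt ∧
            ∀ x : PiBall, h (x : OnePoint PiBall) = (x : UniformSpace.Completion PiBall)) ∧
          Nonempty (UniformSpace.Completion PiBall ≃ₜ Metric.sphere (0 : Euc 4) 1) ∧
          -- the distance of the completion is not Riemannian
          ¬ HasRiemannianDistance (UniformSpace.Completion PiBall) ∧
          -- the area of the distance spheres centered at `pt`, divided by `4πρ²`, tends to `∞`
          Tendsto (fun ρ : ℝ ↦
              surfaceArea (inducedForm c) (PiBall.val ''
                {x | dist (x : UniformSpace.Completion PiBall) pt = ρ}) /
              ENNReal.ofReal (4 * π * ρ ^ 2))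
            (𝓝[>] 0) (𝓝 ⊤) := by
  refine ⟨(screwMap_contDiff c).contDiffOn, isEmbedding_screwMap hc, exists_radial_geodesic hc,
    ballMetric hc, isInducedMetric_ballMetric hc, ballMetricSpace hc,
    ballMetricSpace_topology hc, ofReal_ballDist hc, ?_⟩
  let _ := ballMetricSpace hc
  obtain ⟨pt, hpt, h⟩ := exists_ball_completion_point hc
  obtain ⟨e, he⟩ := exists_onePoint_homeomorph_completion hpt h
  refine ⟨fun hcomplete ↦ ?_, pt, h, ⟨e, he⟩, ?_, not_hasRiemannianDistance_completion hc, ?_⟩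
  -- If the ball were complete, its image in the completion would be closed as well as dense, and
  -- would contain `pt`.
  · have := UniformSpace.Completion.denseRange_coe (α := PiBall)
    have h1 : IsClosed (range (fun x : PiBall ↦ (x : UniformSpace.Completion PiBall))) :=
      (UniformSpace.Completion.isUniformEmbedding_coe PiBall).isClosedEmbedding.isClosed_range
    obtain ⟨x, hx⟩ := h1.closure_eq ▸ this pt
    exact (h pt).2 ⟨x, hx⟩ rfl
  · obtain ⟨e'⟩ := PiBall.nonempty_onePoint_homeomorph_sphere
    exact ⟨e.symm.trans e'⟩
  · simp only [dist_completion_point hc hpt]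
    exact tendsto_surfaceArea_div hc
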